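/- Let $p\ge 0$, $n\ge 1$. For complex $n\times n$ matrices $A_1,\dots,A_{p+1}$ let $c_j\subset gl(n,\mathbf C)$ be the conjugacy class of $A_j$ under $GL(n,\mathbf C)$, let $d_j=\dim c_j$, and let $\kappa=2n^2-\sum_{j}d_j$ be the index of rigidity. A class $c'$ is *subordinate* to $c$ if it lies in the closure of $c$. **Good tuples.** A Jordan normal form (JNF) $J$ of size $n$ assigns to each of finitely many distinct (unspecified) eigenvalues a family of Jordan block sizes, all sizes together summing to $n$; $d(J)$ is the dimension of a conjugacy class with this JNF, and $n-r(J)$ is the greatest number of Jordan blocks with one eigenvalue. For JNFs $J_1,\dots,J_{p+1}$ of size $n$, put $d_j=d(J_j)$, $r_j=r(J_j)$ and consider $$(\alpha_n)\ \sum_j d_j\ge 2n^2-2,\qquad (\beta_n)\ \sum_{i\ne j}r_i\ge n\ \text{ for all } j,\qquad (\omega_n)\ \sum_j r_j\ge 2n.$$ If $n>1$, $(\alpha_n)$ and $(\beta_n)$ hold and $(\omega_n)$ fails, $\Psi$ replaces $n$ by $n_1=\sum_j r_j-n$ and each $J_j$ by the JNF of size $n_1$ obtained by choosing an eigenvalue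 with the greatest number of Jordan blocks, decreasing by $1$ the sizes of the $n-n_1$ smallest blocks with this eigenvalue, and deleting blocks of size $0$. The tuple is *good* if $n=1$, or if $n>1$, $(\alpha_n)$ and $(\beta_n)$ hold, and iterating $\Psi$ (zero or more times, as long as it is defined) stops at a tuple of some size $n'$ with $n'=1$ or satisfying $(\omega_{n'})$. **Non-genericity relations.** For a tuple of $n\times n$ matrices, choose, for some $0<m<n$ and for every $j$, a submultiset $\Phi_j$ of cardinality $m$ of the eigenvalues (with multiplicity) of the $j$-th matrix. This is an additive (resp. multiplicative) non-genericity relation if the sum (resp. product) of all chosen eigenvalues is $0$ (resp. $1$). The eigenvalues are *generic* if there is no such relation. **Quasi-generic special-diagonal tuples.** The tuple $(A_j)$ is called so, in the additive (resp. multiplicative) version, if $\kappa=2$ and there are integers $l\ge1$, $n_1>1$ with $n=ln_1$ and diagonalizable $l\times l$ matrices $B_1,\dots,B_{p+1}$ such that: 1. for each $j$ the direct sum of $n_1$ copies of $B_j$ lies in the closure of the conjugacy class of $A_j$; 2. the tuple of JNFs of the $B_j$ is good; 3. (multiplicative version only) $\prod_j\det B_j=1$; 4. the eigenvalues of the tuple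 $(B_j)$ are generic (additively, resp. multiplicatively); 5. every additive (resp. multiplicative) non-genericity relation $(\Phi_j)$ of the tuple $(A_j)$ is an obvious one: there is a positive integer $q$ such that for each $j$ the multiset $\Phi_j$ consists of the eigenvalues of $B_j$, each taken $q$ times its multiplicity for $B_j$. **Theorem.** Let $(A_j)$ be a quasi-generic special-diagonal tuple in the additive version with $A_1+\dots+A_{p+1}=0$, or in the multiplicative version with $A_1\cdots A_{p+1}=I$, and suppose that only the scalar matrices commute with all the $A_j$ (i.e. the tuple solves the additive, resp. multiplicative, weak Deligne–Simpson problem for its conjugacy classes). Then there is $P\in GL(n,\mathbf C)$ such that all $P^{-1}A_jP$ are block upper-triangular with the same sizes of the diagonal blocks, there are at least two diagonal blocks, and for each $i$ the tuple of the $i$-th diagonal blocks is irreducible (has positive size and no common proper non-zero invariant subspace) and has index of rigidity $2$. -/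

import Mathlib

namespace DeligneSimpson

/-- Complex square matrices of size `n`. -/
abbrev Mat (n : ℕ) : Type := Matrix (Fin n) (Fin n) ℂ

/-! ### Conjugacy classes

A tuple of conjugacy classes is handled through a tuple of representatives; every notion below
depends on the classes only. -/

/-- The conjugacy class of a matrix under `GL(n, ℂ)`. -/
def conjClass {n : ℕ} (A : Mat n) : Set (Mat n) := {X | IsConj A X}

/-- The class of `A'` is subordinate to the class of `A`: it lies in the closure of that class. -/
def IsSubordinate {n : ℕ} (A' A : Mat n) : Prop := A' ∈ closure (conjClass A)

/-- The tangent space `{[A, X] | X ∈ gl(n, ℂ)}` at `A` of the conjugacy class of `A`. -/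
noncomputable def tangentSpace {n : ℕ} (A : Mat n) : Submodule ℂ (Mat n) :=
  LinearMap.range (LinearMap.mulLeft ℂ A - LinearMap.mulRight ℂ A)

/-- The (complex) dimension `d` of the conjugacy class of `A`, that is, the dimension of its
tangent space; equivalently, `n ^ 2` minus the dimension of the centralizer of `A`. -/
noncomputable def classDim {n : ℕ} (A : Mat n) : ℕ := Module.finrank ℂ (tangentSpace A)

/-- The index of rigidity `κ = 2 n ^ 2 - (d_1 + ⋯ + d_{p+1})` of a tuple. -/
noncomputable def rigidityIndex {p n : ℕ} (A : Fin (p + 1) → Mat n) : ℤ :=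
  2 * (n : ℤ) ^ 2 - ∑ j, (classDim (A j) : ℤ)

/-- The matrix is diagonalizable. -/
def IsDiagonalizable {n : ℕ} (A : Mat n) : Prop :=
  ∃ D : Fin n → ℂ, IsConj A (Matrix.diagonal D)

/-- The eigenvalues, repeated with their (algebraic) multiplicities. -/
noncomputable def eigs {n : ℕ} (A : Mat n) : Multiset ℂ := A.charpoly.roots

/-! ### Jordan normal forms -/

/-- A Jordan normal form: to each of the (distinct, unnamed) eigenvalues belongs the multiset of
the sizes of its Jordan blocks. -/
abbrev JNF : Type := Multiset (Multiset ℕ)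

/-- The number of Jordan blocks of size exactly `k ≥ 1` of `A` with the eigenvalue `μ`. There are
`rank (A - μ) ^ (k - 1) - rank (A - μ) ^ k` blocks of size at least `k`. -/
noncomputable def numBlocks {n : ℕ} (A : Mat n) (μ : ℂ) (k : ℕ) : ℕ :=
  (((A - Matrix.scalar (Fin n) μ) ^ (k - 1)).rank - ((A - Matrix.scalar (Fin n) μ) ^ k).rank) -
    (((A - Matrix.scalar (Fin n) μ) ^ k).rank - ((A - Matrix.scalar (Fin n) μ) ^ (k + 1)).rank)

/-- The sizes of the Jordan blocks of `A` with the eigenvalue `μ`. -/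
noncomputable def blockSizes {n : ℕ} (A : Mat n) (μ : ℂ) : Multiset ℕ :=
  ∑ k ∈ Finset.Icc 1 n, Multiset.replicate (numBlocks A μ k) k

/-- The Jordan normal form `J(A)` of a matrix. -/
noncomputable def jnf {n : ℕ} (A : Mat n) : JNF :=
  (eigs A).toFinset.val.map (blockSizes A)

namespace JNF

/-- The size of a Jordan normal form. -/
def size (J : JNF) : ℕ := (J.map Multiset.sum).sum

/-- The greatest number of Jordan blocks with one and the same eigenvalue. -/
def maxBlocks (J : JNF) : ℕ := (J.map Multiset.card).sup

/-- `r(J)`, the minimal rank of `Y - λ I`, `λ ∈ ℂ`, for a matrix `Y` with `J(Y) = J`. -/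
def r (J : JNF) : ℕ := J.size - J.maxBlocks

/-- The dimension of the centralizer of a matrix with Jordan normal form `J`: each pair of Jordan
blocks of sizes `a`, `b` with the same eigenvalue contributes `min a b`. -/
def centralizerDim (J : JNF) : ℕ :=
  (J.map fun S => (S.map fun a => (S.map fun b => min a b).sum).sum).sum

/-- `d(J)`, the dimension of a conjugacy class with Jordan normal form `J`. -/
def d (J : JNF) : ℕ := J.size ^ 2 - J.centralizerDim

/-- `J'` is obtained from `J` by choosing an eigenvalue with the greatest number of Jordan blocks,
decreasing by `1` the sizes of the `k` smallest blocks with this eigenvalue and deleting the blocks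
of size `0` (and the eigenvalue, if no block is left). Here `T` holds the sizes of the `k` smallest
blocks with the chosen eigenvalue and `U` those of its other blocks. -/
def Reduces (k : ℕ) (J J' : JNF) : Prop :=
  ∃ T U : Multiset ℕ, T + U ∈ J ∧ (T + U).card = J.maxBlocks ∧
    T.card = k ∧ (∀ a ∈ T, ∀ b ∈ U, a ≤ b) ∧
    J' = Multiset.filter (· ≠ 0)
      (Multiset.filter (· ≠ 0) (T.map (· - 1) + U) ::ₘ J.erase (T + U))

end JNF

/-- Condition `(α_n)`: `d_1 + ⋯ + d_{p+1} ≥ 2 n ^ 2 - 2`. -/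
def CondAlpha {p : ℕ} (n : ℕ) (J : Fin (p + 1) → JNF) : Prop :=
  2 * n ^ 2 ≤ (∑ j, (J j).d) + 2

/-- Condition `(β_n)`: for all `j`, the sum of the `r_i` over `i ≠ j` is at least `n`. -/
def CondBeta {p : ℕ} (n : ℕ) (J : Fin (p + 1) → JNF) : Prop :=
  ∀ j, n ≤ ∑ i ∈ Finset.univ.erase j, (J i).r

/-- Condition `(ω_n)`: `r_1 + ⋯ + r_{p+1} ≥ 2 n`. -/
def CondOmega {p : ℕ} (n : ℕ) (J : Fin (p + 1) → JNF) : Prop :=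
  2 * n ≤ ∑ j, (J j).r

/-- One step of the construction `Ψ`, from `X = (n, {J_j^n})` to `Y = (n₁, {J_j^{n₁}})`. It is
defined when `n > 1`, `(α_n)` and `(β_n)` hold and `(ω_n)` fails; then
`n₁ = r_1 + ⋯ + r_{p+1} - n`. -/
def PsiStep {p : ℕ} (X Y : ℕ × (Fin (p + 1) → JNF)) : Prop :=
  1 < X.1 ∧ CondAlpha X.1 X.2 ∧ CondBeta X.1 X.2 ∧ ¬ CondOmega X.1 X.2 ∧
    Y.1 = (∑ j, (X.2 j).r) - X.1 ∧
    ∀ j, JNF.Reduces (X.1 - Y.1) (X.2 j) (Y.2 j)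

/-- A tuple of Jordan normal forms of size `n` is good: either `n = 1`, or `n > 1`, the conditions
`(α_n)`, `(β_n)` hold and the iteration of `Ψ` (zero steps allowed) stops at a tuple with `n' = 1`
or satisfying `(ω_{n'})`. -/
def IsGood {p : ℕ} (n : ℕ) (J : Fin (p + 1) → JNF) : Prop :=
  (∀ j, (J j).size = n) ∧
    (n = 1 ∨
      (1 < n ∧ CondAlpha n J ∧ CondBeta n J ∧
        ∃ Y : ℕ × (Fin (p + 1) → JNF),
          Relation.ReflTransGen PsiStep (n, J) Y ∧ (Y.1 = 1 ∨ CondOmega Y.1 Y.2)))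

/-! ### Non-genericity relations -/

/-- `Φ` selects, for every `j`, the same number `m` of eigenvalues of `A j`, with `0 < m < n`. -/
def IsSelection {p n : ℕ} (A : Fin (p + 1) → Mat n) (Φ : Fin (p + 1) → Multiset ℂ) : Prop :=
  ∃ m : ℕ, 0 < m ∧ m < n ∧ ∀ j, Φ j ≤ eigs (A j) ∧ (Φ j).card = m

/-- The selected eigenvalues satisfy an additive non-genericity relation. -/
def AddNonGenericityRel {p n : ℕ} (A : Fin (p + 1) → Mat n)
    (Φ : Fin (p + 1) → Multiset ℂ) : Prop :=
  IsSelection A Φ ∧ ∑ j, (Φ j).sum = 0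

/-- The selected eigenvalues satisfy a multiplicative non-genericity relation. -/
def MulNonGenericityRel {p n : ℕ} (A : Fin (p + 1) → Mat n)
    (Φ : Fin (p + 1) → Multiset ℂ) : Prop :=
  IsSelection A Φ ∧ ∏ j, (Φ j).prod = 1

/-! ### Special-diagonal and quasi-generic tuples -/

/-- The tuple of the classes of the `A j`, of index of rigidity `2`, is `l`-special with the
diagonalizable classes of the `B j`, where `n = l n₁`, `n₁ > 1`: the direct sum of `n₁` copies of
`B j` is subordinate to `A j`, and the Jordan normal forms of the `B j` are good. (In the
multiplicative case the product of the eigenvalues of the `B j` has to be `1` in addition.) -/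
structure IsSpecialDiagonalWith {p n : ℕ} (A : Fin (p + 1) → Mat n) (l n₁ : ℕ)
    (B : Fin (p + 1) → Mat l) : Prop where
  one_le : 1 ≤ l
  one_lt : 1 < n₁
  rigid : rigidityIndex A = 2
  subordinate : ∃ e : Fin l × Fin n₁ ≃ Fin n, ∀ j,
    IsSubordinate (Matrix.reindex e e (Matrix.blockDiagonal fun _ : Fin n₁ => B j)) (A j)
  good : IsGood l fun j => jnf (B j)
  diagonalizable : ∀ j, IsDiagonalizable (B j)

/-- The relation given by `Φ` is a multiple of the one that the eigenvalues of the `B j` satisfy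
all together. -/
def IsObvious {p l : ℕ} (B : Fin (p + 1) → Mat l) (Φ : Fin (p + 1) → Multiset ℂ) : Prop :=
  ∃ q : ℕ, ∀ j, Φ j = q • eigs (B j)

/-- Quasi-generic special-diagonal tuples, additive version. (That the sum of the eigenvalues of
the `B j` is `0` is automatic when the traces of the `A j` add up to `0`.) -/
def IsQuasiGenericSpecialDiagonalAdd {p n : ℕ} (A : Fin (p + 1) → Mat n) : Prop :=
  ∃ (l n₁ : ℕ) (B : Fin (p + 1) → Mat l),
    IsSpecialDiagonalWith A l n₁ B ∧
    (∀ Φ, ¬ AddNonGenericityRel B Φ) ∧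
    ∀ Φ, AddNonGenericityRel A Φ → IsObvious B Φ

/-- Quasi-generic special-diagonal tuples, multiplicative version. -/
def IsQuasiGenericSpecialDiagonalMul {p n : ℕ} (A : Fin (p + 1) → Mat n) : Prop :=
  ∃ (l n₁ : ℕ) (B : Fin (p + 1) → Mat l),
    IsSpecialDiagonalWith A l n₁ B ∧
    ∏ j, (B j).det = 1 ∧
    (∀ Φ, ¬ MulNonGenericityRel B Φ) ∧
    ∀ Φ, MulNonGenericityRel A Φ → IsObvious B Φ

/-! ### The weak Deligne–Simpson problem and block-triangular forms -/

/-- Only the scalar matrices commute with all matrices of the tuple. -/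
def HasTrivialCentralizer {p n : ℕ} (A : Fin (p + 1) → Mat n) : Prop :=
  ∀ X : Mat n, (∀ j, X * A j = A j * X) → ∃ c : ℂ, X = Matrix.scalar (Fin n) c

/-- The tuple solves the additive weak Deligne–Simpson problem (for its conjugacy classes). -/
def SolvesWeakDSPAdd {p n : ℕ} (A : Fin (p + 1) → Mat n) : Prop :=
  ∑ j, A j = 0 ∧ HasTrivialCentralizer A

/-- The tuple solves the multiplicative weak Deligne–Simpson problem (for its conjugacy classes):
`M_1 ⋯ M_{p+1} = I`, and the centralizer is trivial. -/
def SolvesWeakDSPMul {p n : ℕ} (M : Fin (p + 1) → Mat n) : Prop :=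
  (List.ofFn M).prod = 1 ∧ HasTrivialCentralizer M

/-- The tuple is irreducible: its size is positive and it has no common proper invariant
subspace. -/
def IsIrreducibleTuple {p n : ℕ} (A : Fin (p + 1) → Mat n) : Prop :=
  0 < n ∧ ∀ W : Submodule ℂ (Fin n → ℂ),
    (∀ j, ∀ v ∈ W, (A j).mulVec v ∈ W) → W = ⊥ ∨ W = ⊤

/-- The matrix `P⁻¹ A P`, with its indices split into blocks of sizes `m i` by means of `e`. -/
noncomputable def conjBlocks {n k : ℕ} {m : Fin k → ℕ} (e : Fin n ≃ (i : Fin k) × Fin (m i))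
    (P : (Mat n)ˣ) (A : Mat n) :
    Matrix ((i : Fin k) × Fin (m i)) ((i : Fin k) × Fin (m i)) ℂ :=
  Matrix.reindex e e ((P⁻¹).val * A * P.val)

/-- By a simultaneous conjugation the tuple can be brought to a block upper-triangular form, with
the same sizes `m i` of the (at least two) diagonal blocks for all matrices, such that each of the
tuples of diagonal blocks is irreducible and of index of rigidity `2`. -/
def IsBlockTriangularWithRigidBlocks {p n : ℕ} (A : Fin (p + 1) → Mat n) : Prop :=
  ∃ (k : ℕ) (m : Fin k → ℕ) (e : Fin n ≃ (i : Fin k) × Fin (m i)) (P : (Mat n)ˣ),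
    2 ≤ k ∧
    (∀ j, (conjBlocks e P (A j)).BlockTriangular Sigma.fst) ∧
    ∀ i : Fin k,
      IsIrreducibleTuple (fun j => (conjBlocks e P (A j)).blockDiag' i) ∧
      rigidityIndex (fun j => (conjBlocks e P (A j)).blockDiag' i) = 2

end DeligneSimpson

/-! The given tuple is shown to be an iterated extension of `n₁ ≥ 2` copies of one irreducible tuple
`C` of index of rigidity 2. Here `C` has the eigenvalues of the `B j`, its members are
diagonalizable, and its sum is 0, resp. its product is 1.

Existence of `C` (`exists_hasArm_tuple`). A step of `Ψ` is undone by a reflection at the central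
vertex of a star-shaped quiver, or by its multiplicative analogue: if `A j - y j` factors through
`ℂ^(r j)`, the central space is replaced by the kernel of the map from the direct sum of the `ℂ^(r
j)` to it. The index of rigidity of the multiplicities is unchanged by `Ψ`, and a positive index
excludes `(ω)`, so the iteration ends at size 1, where the solution consists of scalars. The index
equals 2 (`IsSpecialDiagonalWith.diagIndex_eq_two`): `n₁ ^ 2` times it is at least the index of the
`A j`, which is 2; it is even; and `(α)` bounds it by 2. An invariant subspace of `C` would give a
non-genericity relation for the `B j`, so `C` is irreducible (`isSimpleTuple_of_generic`).

Comparison of `A` with `C`. For tuples `A` on `V` and `B` on `U` there is a complex `Hom(U,V) → ⊕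
im(X ↦ A j X - X B j) → Hom(U,V)`. Its kernel on the left consists of the intertwiners `U → V`, and
its cokernel on the right is dual to the intertwiners `V → U`. The Euler characteristic therefore
bounds the intertwiners in the two directions from below (`two_mul_le_sum_finrank_range`). The
characteristic polynomials of the `A j` are powers of those of the `C j`, and the `C j` are
diagonalizable; this makes the Euler characteristic between `A` and `C` positive as soon as the one
of `A` with itself is, and a nonzero map between `A` and `C` exists (`intertwiners_ne_bot`).

Induction (`Rigid.filtered`). Index 2 and trivial centralizer kill the middle cohomology of `A` with
itself, that is, `A` is infinitesimally rigid. Take a maximal invariant subspace filtered by copies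
of `C`, or dually a maximal such quotient. In either case no nonzero intertwiner goes from the
subspace to the quotient, and this lets rigidity pass to both (`Rigid.quotient`, `Rigid.sub`). The
characteristic polynomials of the remaining part are again powers of those of `C`. -/

open Module

namespace DeligneSimpson

/-! ### Intertwiners and the trace pairing -/

section Intertwiners

variable {U V W : Type*} [AddCommGroup U] [Module ℂ U] [AddCommGroup V] [Module ℂ V]
  [AddCommGroup W] [Module ℂ W]

/-- The map `X ↦ a X - X b`. -/
def commMap (a : End ℂ V) (b : End ℂ U) : (U →ₗ[ℂ] V) →ₗ[ℂ] (U →ₗ[ℂ] V) where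
  toFun X := a ∘ₗ X - X ∘ₗ b
  map_add' X Y := by ext; simp; abel
  map_smul' c X := by ext; simp [smul_sub]

theorem commMap_apply (a : End ℂ V) (b : End ℂ U) (X : U →ₗ[ℂ] V) :
    commMap a b X = a ∘ₗ X - X ∘ₗ b := rfl

/-- The space of intertwiners `X`, `A j X = X B j` for all `j`. -/
def intertwiners {k : ℕ} (A : Fin k → End ℂ V) (B : Fin k → End ℂ U) :
    Submodule ℂ (U →ₗ[ℂ] V) := ⨅ j, LinearMap.ker (commMap (A j) (B j))

theorem mem_intertwiners {k : ℕ} {A : Fin k → End ℂ V} {B : Fin k → End ℂ U} {X : U →ₗ[ℂ] V} :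
    X ∈ intertwiners A B ↔ ∀ j, A j ∘ₗ X = X ∘ₗ B j := by
  simp [intertwiners, commMap_apply, sub_eq_zero]

/-- Nondegeneracy of the trace pairing, tested on maps of rank one. -/
theorem eq_zero_of_trace_comp_eq_zero [FiniteDimensional ℂ U] [FiniteDimensional ℂ V]
    (T : V →ₗ[ℂ] U) (h : ∀ X : U →ₗ[ℂ] V, LinearMap.trace ℂ U (T ∘ₗ X) = 0) : T = 0 := by
  ext v
  rw [LinearMap.zero_apply, ← Module.forall_dual_apply_eq_zero_iff ℂ]
  intro φ
  have := h (φ.smulRight v)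
  have h2 : T ∘ₗ φ.smulRight v = φ.smulRight (T v) := by ext; simp
  rwa [h2, LinearMap.trace_smulRight] at this

/-- The trace pairing. -/
noncomputable def tracePairing (U V : Type*) [AddCommGroup U] [Module ℂ U]
    [AddCommGroup V] [Module ℂ V] :
    (V →ₗ[ℂ] U) →ₗ[ℂ] Dual ℂ (U →ₗ[ℂ] V) where
  toFun Z := LinearMap.trace ℂ U ∘ₗ LinearMap.compRight ℂ Z
  map_add' X Y := by ext; simp [LinearMap.add_comp]
  map_smul' c X := by ext; simp [LinearMap.smul_comp]

theorem tracePairing_apply (Z : V →ₗ[ℂ] U) (Y : U →ₗ[ℂ] V) :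
    tracePairing U V Z Y = LinearMap.trace ℂ U (Z ∘ₗ Y) := rfl

/-- Under the trace pairing the annihilator of `R` has dimension complementary to that of `R`. This
converts knowledge of the functionals killing an image into a lower bound for its rank. -/
theorem finrank_mul_le_of_trace_annihilator [FiniteDimensional ℂ U] [FiniteDimensional ℂ V]
    (R : Submodule ℂ (U →ₗ[ℂ] V)) (P : Submodule ℂ (V →ₗ[ℂ] U))
    (h : ∀ Z, (∀ Y ∈ R, LinearMap.trace ℂ U (Z ∘ₗ Y) = 0) → Z ∈ P) :
    finrank ℂ U * finrank ℂ V ≤ finrank ℂ R + finrank ℂ P := by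
  have hinj : Function.Injective (tracePairing U V) := by
    rw [injective_iff_map_eq_zero]
    intro Z hZ
    exact eq_zero_of_trace_comp_eq_zero Z fun X => by
      rw [← tracePairing_apply, hZ, LinearMap.zero_apply]
  have hfr : finrank ℂ (V →ₗ[ℂ] U) = finrank ℂ (Dual ℂ (U →ₗ[ℂ] V)) := by
    rw [Subspace.dual_finrank_eq, finrank_linearMap, finrank_linearMap, mul_comm]
  let e := LinearEquiv.ofInjectiveOfFinrankEq (tracePairing U V) hinj hfr
  have h1 : finrank ℂ R.dualAnnihilator ≤ finrank ℂ P := by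
    have : R.dualAnnihilator.map (e.symm : Dual ℂ (U →ₗ[ℂ] V) →ₗ[ℂ] (V →ₗ[ℂ] U)) ≤ P := by
      rintro _ ⟨φ, hφ, rfl⟩
      apply h
      intro Y hY
      have h3 : tracePairing U V (e.symm φ) = φ := e.apply_symm_apply φ
      rw [LinearEquiv.coe_coe, ← tracePairing_apply, h3]
      exact (Submodule.mem_dualAnnihilator φ).1 hφ Y hY
    calc _ = finrank ℂ (R.dualAnnihilator.map
            (e.symm : Dual ℂ (U →ₗ[ℂ] V) →ₗ[ℂ] (V →ₗ[ℂ] U))) :=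
          (LinearEquiv.finrank_map_eq e.symm _).symm
      _ ≤ _ := Submodule.finrank_mono this
  have h2 := Subspace.finrank_add_finrank_dualAnnihilator_eq R
  rw [finrank_linearMap] at h2
  omega

end Intertwiners

/-! ### The deformation complex of a pair of tuples, its Euler characteristic, rigidity -/

section Fox

variable {k : ℕ} {U V W : Type*} [AddCommGroup U] [Module ℂ U] [AddCommGroup V] [Module ℂ V]
  [AddCommGroup W] [Module ℂ W]

/-- The condition `A_1 + ⋯ + A_k = 0` (`mul = false`) or `A_1 ⋯ A_k = 1` (`mul = true`). -/
def Balanced (mul : Bool) (A : Fin k → End ℂ V) : Prop :=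
  if mul then (List.ofFn A).prod = 1 else ∑ j, A j = 0

/-- The product of the first `t` maps in the multiplicative case, `1` in the additive one. -/
def prefixProd (mul : Bool) (A : Fin k → End ℂ V) (t : ℕ) : End ℂ V :=
  if mul then ((List.ofFn A).take t).prod else 1

/-- The product of all but the first `t` maps in the multiplicative case, `1` in the additive
one. -/
def suffixProd (mul : Bool) (A : Fin k → End ℂ V) (t : ℕ) : End ℂ V :=
  if mul then ((List.ofFn A).drop t).prod else 1

/-- The upper right block of the sum, resp. product, of the block matrices
`[[A j, Y j], [0, B j]]`. -/
def foxSum (mul : Bool) (A : Fin k → End ℂ V) (B : Fin k → End ℂ U) :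
    (Fin k → (U →ₗ[ℂ] V)) →ₗ[ℂ] (U →ₗ[ℂ] V) where
  toFun Y := ∑ j : Fin k, prefixProd mul A j ∘ₗ Y j ∘ₗ suffixProd mul B (j + 1)
  map_add' X Y := by
    simp [LinearMap.add_comp, LinearMap.comp_add, Finset.sum_add_distrib]
  map_smul' c X := by
    simp [LinearMap.smul_comp, LinearMap.comp_smul, Finset.smul_sum]

theorem foxSum_apply (mul : Bool) (A : Fin k → End ℂ V) (B : Fin k → End ℂ U)
    (Y : Fin k → (U →ₗ[ℂ] V)) :
    foxSum mul A B Y = ∑ j : Fin k, prefixProd mul A j ∘ₗ Y j ∘ₗ suffixProd mul B (j + 1) := rfl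

theorem prefixProd_true_succ (A : Fin k → End ℂ V) (j : Fin k) :
    prefixProd true A (j + 1) = prefixProd true A j * A j := by
  simp [prefixProd, List.take_add_one]

theorem suffixProd_true_succ (A : Fin k → End ℂ V) (j : Fin k) :
    suffixProd true A j = A j * suffixProd true A (j + 1) := by
  simp only [suffixProd, if_true]
  rw [List.drop_eq_getElem_cons (by simp)]
  simp

theorem prefixProd_comp (mul : Bool) {A : Fin k → End ℂ V} {B : Fin k → End ℂ U}
    {f : U →ₗ[ℂ] V} (h : ∀ j, A j ∘ₗ f = f ∘ₗ B j) (t : ℕ) :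
    prefixProd mul A t ∘ₗ f = f ∘ₗ prefixProd mul B t := by
  cases mul
  · simp [prefixProd]; rfl
  · induction t with
    | zero => simp [prefixProd]; rfl
    | succ t ih =>
      by_cases ht : t < k
      · rw [prefixProd_true_succ A ⟨t, ht⟩, prefixProd_true_succ B ⟨t, ht⟩, End.mul_eq_comp,
          End.mul_eq_comp, LinearMap.comp_assoc, h, ← LinearMap.comp_assoc, ih,
          LinearMap.comp_assoc]
      · have e : ∀ l : List (End ℂ V), l.length = k → l.take (t + 1) = l.take t := fun l hl => by
          rw [List.take_of_length_le (by omega), List.take_of_length_le (by omega)]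
        have e' : ∀ l : List (End ℂ U), l.length = k → l.take (t + 1) = l.take t := fun l hl => by
          rw [List.take_of_length_le (by omega), List.take_of_length_le (by omega)]
        simp only [prefixProd, if_true] at ih ⊢
        rw [e _ (by simp), e' _ (by simp), ih]

theorem list_prod_comp {ι : Type*} (l : List ι) {A : ι → End ℂ V} {B : ι → End ℂ U}
    {f : U →ₗ[ℂ] V} (h : ∀ j, A j ∘ₗ f = f ∘ₗ B j) :
    (l.map A).prod ∘ₗ f = f ∘ₗ (l.map B).prod := by
  induction l with
  | nil => simp; rfl
  | cons a l ih =>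
    rw [List.map_cons, List.map_cons, List.prod_cons, List.prod_cons, End.mul_eq_comp,
      End.mul_eq_comp, LinearMap.comp_assoc, ih, ← LinearMap.comp_assoc, h, LinearMap.comp_assoc]

theorem suffixProd_comp (mul : Bool) {A : Fin k → End ℂ V} {B : Fin k → End ℂ U}
    {f : U →ₗ[ℂ] V} (h : ∀ j, A j ∘ₗ f = f ∘ₗ B j) (t : ℕ) :
    suffixProd mul A t ∘ₗ f = f ∘ₗ suffixProd mul B t := by
  cases mul
  · simp [suffixProd]; rfl
  · simp only [suffixProd, if_true, List.ofFn_eq_map, ← List.map_drop]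
    exact list_prod_comp _ h

theorem comp_sum_map {ι : Type*} (s : Finset ι) (f : V →ₗ[ℂ] W) (Y : ι → (U →ₗ[ℂ] V)) :
    f ∘ₗ ∑ j ∈ s, Y j = ∑ j ∈ s, f ∘ₗ Y j := by
  ext; simp

theorem sum_comp_map {ι : Type*} (s : Finset ι) (Y : ι → (V →ₗ[ℂ] W)) (g : U →ₗ[ℂ] V) :
    (∑ j ∈ s, Y j) ∘ₗ g = ∑ j ∈ s, Y j ∘ₗ g := by
  ext; simp

/-- Naturality in the target; `foxSum_comp` is naturality in the source. Intertwiners pass through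
the partial products. -/
theorem comp_foxSum (mul : Bool) {A : Fin k → End ℂ V} {A' : Fin k → End ℂ W}
    (B : Fin k → End ℂ U) {f : V →ₗ[ℂ] W} (h : ∀ j, A' j ∘ₗ f = f ∘ₗ A j)
    (Y : Fin k → (U →ₗ[ℂ] V)) :
    f ∘ₗ foxSum mul A B Y = foxSum mul A' B fun j => f ∘ₗ Y j := by
  rw [foxSum_apply, foxSum_apply, comp_sum_map]
  refine Finset.sum_congr rfl fun j _ => ?_
  rw [← LinearMap.comp_assoc, ← prefixProd_comp mul h]
  rfl

theorem foxSum_comp (mul : Bool) (A : Fin k → End ℂ V) {B : Fin k → End ℂ U}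
    {B' : Fin k → End ℂ W} {g : W →ₗ[ℂ] U} (h : ∀ j, B j ∘ₗ g = g ∘ₗ B' j)
    (Y : Fin k → (U →ₗ[ℂ] V)) :
    foxSum mul A B Y ∘ₗ g = foxSum mul A B' fun j => Y j ∘ₗ g := by
  rw [foxSum_apply, foxSum_apply, sum_comp_map]
  refine Finset.sum_congr rfl fun j _ => ?_
  rw [LinearMap.comp_assoc, LinearMap.comp_assoc, suffixProd_comp mul h]
  rfl

/-- Simultaneous infinitesimal conjugation preserves the relation. In the multiplicative case the
terms telescope along `g`, and `g` takes the value `X` at both ends. -/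
theorem foxSum_commMap (mul : Bool) {A : Fin k → End ℂ V} {B : Fin k → End ℂ U}
    (hA : Balanced mul A) (hB : Balanced mul B) (X : U →ₗ[ℂ] V) :
    foxSum mul A B (fun j => commMap (A j) (B j) X) = 0 := by
  rw [foxSum_apply]
  cases mul
  · simp only [Balanced, Bool.false_eq_true, if_false] at hA hB
    have : ∀ j : Fin k, prefixProd false A j ∘ₗ commMap (A j) (B j) X ∘ₗ suffixProd false B (j + 1)
      = A j ∘ₗ X - X ∘ₗ B j := fun j => by simp [prefixProd, suffixProd, commMap_apply]; rfl
    rw [Finset.sum_congr rfl fun j _ => this j, Finset.sum_sub_distrib, ← sum_comp_map,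
      ← comp_sum_map, hA, hB]
    simp
  · simp only [Balanced, if_true] at hA hB
    let g : ℕ → (U →ₗ[ℂ] V) := fun t => prefixProd true A t ∘ₗ X ∘ₗ suffixProd true B t
    have : ∀ j : Fin k, prefixProd true A j ∘ₗ commMap (A j) (B j) X ∘ₗ suffixProd true B (j + 1)
        = g (j + 1) - g j := fun j => by
      simp only [g]
      rw [prefixProd_true_succ, suffixProd_true_succ, commMap_apply]
      ext u
      simp
    rw [Finset.sum_congr rfl fun j _ => this j, Fin.sum_univ_eq_sum_range
      (fun j => g (j + 1) - g j),
      Finset.sum_range_sub]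
    have h1 : prefixProd true A k = 1 := by
      simp only [prefixProd, if_true]
      rw [List.take_of_length_le (by simp), hA]
    have h2 : suffixProd true B 0 = 1 := by simpa [suffixProd] using hB
    have h3 : suffixProd true B k = 1 := by
      simp only [suffixProd, if_true]
      rw [List.drop_of_length_le (by simp), List.prod_nil]
    have h4 : prefixProd true A 0 = 1 := by simp [prefixProd]
    simp only [g, h1, h2, h3, h4, sub_self]

/-- The dual of the cokernel of the second map of the complex consists of intertwiners in the
opposite direction. -/
theorem mem_intertwiners_of_trace_foxSum [FiniteDimensional ℂ U] [FiniteDimensional ℂ V]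
    (mul : Bool) {A : Fin k → End ℂ V} {B : Fin k → End ℂ U}
    (hB : Balanced mul B) (Z : V →ₗ[ℂ] U)
    (h : ∀ X : Fin k → (U →ₗ[ℂ] V),
      LinearMap.trace ℂ U (Z ∘ₗ foxSum mul A B fun j => commMap (A j) (B j) (X j)) = 0) :
    Z ∈ intertwiners B A := by
  -- Testing on tuples supported at the single index `j` and cycling factors under the trace
  -- isolates a commutation relation for each `j`.
  have key : ∀ j : Fin k, (suffixProd mul B (j + 1) ∘ₗ Z ∘ₗ prefixProd mul A j) ∘ₗ A j =
      B j ∘ₗ (suffixProd mul B (j + 1) ∘ₗ Z ∘ₗ prefixProd mul A j) := by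
    intro j
    rw [← sub_eq_zero]
    apply eq_zero_of_trace_comp_eq_zero
    intro X
    have h1 := h (Pi.single j X)
    have h2 : foxSum mul A B (fun i => commMap (A i) (B i)
        ((Pi.single j X : Fin k → (U →ₗ[ℂ] V)) i)) =
        prefixProd mul A j ∘ₗ commMap (A j) (B j) X ∘ₗ suffixProd mul B (j + 1) := by
      rw [foxSum_apply, Finset.sum_eq_single j]
      · simp
      · intro i _ hi
        simp [Pi.single_eq_of_ne hi]
      · simp
    rw [h2, commMap_apply] at h1
    set p := prefixProd mul A j
    set s := suffixProd mul B (j + 1)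
    have h3 : Z ∘ₗ p ∘ₗ (A j ∘ₗ X - X ∘ₗ B j) ∘ₗ s =
        (Z ∘ₗ p ∘ₗ A j ∘ₗ X) ∘ₗ s - (Z ∘ₗ p ∘ₗ X) ∘ₗ (B j ∘ₗ s) := by
      ext; simp
    rw [h3, map_sub, LinearMap.trace_comp_comm' s, LinearMap.trace_comp_comm' (B j ∘ₗ s)] at h1
    rw [LinearMap.sub_comp, map_sub, ← h1]
    rfl
  rw [mem_intertwiners]
  cases mul
  · intro j
    simpa [prefixProd, suffixProd, Module.End.one_eq_id] using (key j).symm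
  -- The relation `key` says that `g (j + 1) = g j`, and `g 0 = Z` because the product of the `B j`
  -- is 1. Hence the partial products around `Z` can be removed.
  · let g : ℕ → (V →ₗ[ℂ] U) := fun t => suffixProd true B t ∘ₗ Z ∘ₗ prefixProd true A t
    have hg : ∀ t, t ≤ k → g t = Z := by
      intro t
      induction t with
      | zero =>
        intro _
        have h2 : suffixProd true B 0 = 1 := by simpa [suffixProd, Balanced] using hB
        have h4 : prefixProd true A 0 = 1 := by simp [prefixProd]
        simp only [g, h2, h4]
        rfl
      | succ t ih =>
        intro ht
        rw [← ih (by omega)]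
        have := key ⟨t, by omega⟩
        simp only [g]
        have e1 := prefixProd_true_succ A ⟨t, by omega⟩
        have e2 := suffixProd_true_succ B ⟨t, by omega⟩
        simp only at e1 e2 this
        rw [e1, e2]
        exact this
    intro j
    have e2 := suffixProd_true_succ B j
    have h1 := hg j (by omega)
    have h2 := hg (j + 1) (by omega)
    have h3 := key j
    have e1 := prefixProd_true_succ A j
    simp only [g] at h1 h2
    rw [e1] at h2
    have h4 : (suffixProd true B (j + 1) ∘ₗ Z ∘ₗ prefixProd true A j) ∘ₗ A j = Z := h2
    calc B j ∘ₗ Z = B j ∘ₗ (suffixProd true B (j + 1) ∘ₗ Z ∘ₗ prefixProd true A j) ∘ₗ A j := by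
          rw [h4]
      _ = (suffixProd true B j ∘ₗ Z ∘ₗ prefixProd true A j) ∘ₗ A j := by rw [e2]; rfl
      _ = Z ∘ₗ A j := by rw [h1]

/-- The image of the tuples `(A j X j - X j B j)` under `foxSum`. -/
def foxRange (mul : Bool) (A : Fin k → End ℂ V) (B : Fin k → End ℂ U) :
    Submodule ℂ (U →ₗ[ℂ] V) :=
  LinearMap.range (foxSum mul A B ∘ₗ LinearMap.pi fun j =>
    commMap (A j) (B j) ∘ₗ LinearMap.proj j)

theorem foxSum_mem_foxRange (mul : Bool) (A : Fin k → End ℂ V) (B : Fin k → End ℂ U)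
    (X : Fin k → (U →ₗ[ℂ] V)) :
    foxSum mul A B (fun j => commMap (A j) (B j) (X j)) ∈ foxRange mul A B :=
  ⟨X, rfl⟩

theorem finrank_mul_le_foxRange [FiniteDimensional ℂ U] [FiniteDimensional ℂ V] (mul : Bool)
    (A : Fin k → End ℂ V) {B : Fin k → End ℂ U}
    (hB : Balanced mul B) :
    finrank ℂ U * finrank ℂ V ≤
      finrank ℂ (foxRange mul A B) + finrank ℂ (intertwiners B A) :=
  finrank_mul_le_of_trace_annihilator _ _ fun Z hZ =>
    mem_intertwiners_of_trace_foxSum mul hB Z fun X => hZ _ (foxSum_mem_foxRange mul A B X)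

/-- The absence of intertwiners in the opposite direction means that the obstruction space, the
cokernel, is zero. -/
theorem exists_foxSum_eq [FiniteDimensional ℂ U] [FiniteDimensional ℂ V] (mul : Bool)
    (A : Fin k → End ℂ V) {B : Fin k → End ℂ U}
    (hB : Balanced mul B) (h : intertwiners B A = ⊥) (E : U →ₗ[ℂ] V) :
    ∃ X : Fin k → (U →ₗ[ℂ] V), foxSum mul A B (fun j => commMap (A j) (B j) (X j)) = E := by
  have h1 := finrank_mul_le_foxRange mul A hB
  rw [h, finrank_bot, add_zero, ← finrank_linearMap] at h1
  have h2 : foxRange mul A B = ⊤ :=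
    Submodule.eq_top_of_finrank_eq (le_antisymm (Submodule.finrank_le _)
      (by rw [finrank_linearMap] at h1 ⊢; nlinarith))
  have : E ∈ foxRange mul A B := h2 ▸ Submodule.mem_top
  obtain ⟨X, hX⟩ := this
  exact ⟨X, hX⟩

/-- The restriction of `foxSum` to the tuples of commutators. -/
def foxRestrict (mul : Bool) (A : Fin k → End ℂ V) (B : Fin k → End ℂ U) :
    (∀ j, LinearMap.range (commMap (A j) (B j))) →ₗ[ℂ] (U →ₗ[ℂ] V) :=
  foxSum mul A B ∘ₗ LinearMap.pi fun j => Submodule.subtype _ ∘ₗ LinearMap.proj j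

/-- The diagonal map `X ↦ (A j X - X B j)`. -/
def diagComm (A : Fin k → End ℂ V) (B : Fin k → End ℂ U) :
    (U →ₗ[ℂ] V) →ₗ[ℂ] (∀ j, LinearMap.range (commMap (A j) (B j))) :=
  LinearMap.pi fun j => (commMap (A j) (B j)).rangeRestrict

theorem ker_diagComm (A : Fin k → End ℂ V) (B : Fin k → End ℂ U) :
    LinearMap.ker (diagComm A B) = intertwiners A B := by
  rw [diagComm, LinearMap.ker_pi, intertwiners]
  simp

theorem range_foxRestrict (mul : Bool) (A : Fin k → End ℂ V) (B : Fin k → End ℂ U) :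
    LinearMap.range (foxRestrict mul A B) = foxRange mul A B := by
  ext E
  constructor
  · rintro ⟨Y, rfl⟩
    choose X hX using fun j => (Y j).2
    refine ⟨X, ?_⟩
    simp only [foxRestrict, LinearMap.comp_apply]
    congr 1
    ext1 j
    exact hX j
  · rintro ⟨X, rfl⟩
    exact ⟨fun j => ⟨_, X j, rfl⟩, rfl⟩

theorem range_diagComm_le (mul : Bool) {A : Fin k → End ℂ V} {B : Fin k → End ℂ U}
    (hA : Balanced mul A) (hB : Balanced mul B) :
    LinearMap.range (diagComm A B) ≤ LinearMap.ker (foxRestrict mul A B) := by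
  rintro _ ⟨X, rfl⟩
  exact foxSum_commMap mul hA hB X

theorem finrank_range_diagComm [FiniteDimensional ℂ U] [FiniteDimensional ℂ V]
    (A : Fin k → End ℂ V) (B : Fin k → End ℂ U) :
    finrank ℂ (LinearMap.range (diagComm A B)) + finrank ℂ (intertwiners A B) =
      finrank ℂ U * finrank ℂ V := by
  rw [← ker_diagComm, LinearMap.finrank_range_add_finrank_ker, finrank_linearMap]

theorem finrank_foxRange_add [FiniteDimensional ℂ U] [FiniteDimensional ℂ V] (mul : Bool)
    (A : Fin k → End ℂ V) (B : Fin k → End ℂ U) :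
    finrank ℂ (foxRange mul A B) + finrank ℂ (LinearMap.ker (foxRestrict mul A B)) =
      ∑ j, finrank ℂ (LinearMap.range (commMap (A j) (B j))) := by
  rw [← range_foxRestrict, LinearMap.finrank_range_add_finrank_ker, finrank_pi_fintype]

/-- The Euler characteristic estimate for the intertwiners between two tuples. -/
theorem two_mul_le_sum_finrank_range [FiniteDimensional ℂ U] [FiniteDimensional ℂ V] (mul : Bool)
    {A : Fin k → End ℂ V} {B : Fin k → End ℂ U}
    (hA : Balanced mul A) (hB : Balanced mul B) :
    2 * (finrank ℂ U * finrank ℂ V) ≤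
      ∑ j, finrank ℂ (LinearMap.range (commMap (A j) (B j))) +
        finrank ℂ (intertwiners A B) + finrank ℂ (intertwiners B A) := by
  have h1 := finrank_mul_le_foxRange mul A hB
  have h2 := finrank_range_diagComm A B
  have h3 := finrank_foxRange_add mul A B
  have h4 := Submodule.finrank_mono (range_diagComm_le mul hA hB)
  omega

/-- Infinitesimal rigidity: the infinitesimal deformations of the tuple inside its conjugacy
classes, with the same sum, resp. product, are trivial. -/
def Rigid (mul : Bool) (A : Fin k → End ℂ V) : Prop :=
  ∀ X : Fin k → End ℂ V, foxSum mul A A (fun j => commMap (A j) (A j) (X j)) = 0 →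
    ∃ Y : End ℂ V, ∀ j, commMap (A j) (A j) (X j) = commMap (A j) (A j) Y

theorem rigid_iff (mul : Bool) {A : Fin k → End ℂ V} :
    Rigid mul A ↔ LinearMap.ker (foxRestrict mul A A) ≤ LinearMap.range (diagComm A A) := by
  constructor
  · intro h Y hY
    choose X hX using fun j => (Y j).2
    obtain ⟨Z, hZ⟩ := h X (by
      have : (fun j => commMap (A j) (A j) (X j)) = fun j => ((Y j : _) : End ℂ V) := funext hX
      rw [this]; exact hY)
    refine ⟨Z, ?_⟩
    ext1 j
    apply Subtype.ext
    rw [← hX j, hZ j]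
    rfl
  · intro h X hX
    obtain ⟨Y, hY⟩ := h (show (fun j => ⟨_, X j, rfl⟩) ∈ LinearMap.ker (foxRestrict mul A A)
      from hX)
    refine ⟨Y, fun j => ?_⟩
    have := congrArg Subtype.val (congrFun hY j)
    exact this.symm

/-- The middle cohomology is zero and the identity is a nonzero self-intertwiner, so the Euler
characteristic is positive. -/
theorem Rigid.sum_finrank_range_lt [FiniteDimensional ℂ V] [Nontrivial V] {mul : Bool}
    {A : Fin k → End ℂ V}
    (h : Rigid mul A) :
    ∑ j, finrank ℂ (LinearMap.range (commMap (A j) (A j))) <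
      2 * (finrank ℂ V * finrank ℂ V) := by
  have h2 := finrank_range_diagComm A A
  have h3 := finrank_foxRange_add mul A A
  have h4 := Submodule.finrank_mono ((rigid_iff mul).1 h)
  have h5 := Submodule.finrank_le (foxRange mul A A)
  rw [finrank_linearMap] at h5
  have h6 : 0 < finrank ℂ (intertwiners A A) := by
    rw [Module.finrank_pos_iff]
    refine ⟨⟨⟨LinearMap.id, mem_intertwiners.2 fun j => rfl⟩, 0, fun h => ?_⟩⟩
    have h7 : (LinearMap.id : V →ₗ[ℂ] V) = 0 := congrArg Subtype.val h
    obtain ⟨v, hv⟩ := exists_ne (0 : V)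
    exact hv (by simpa using LinearMap.congr_fun h7 v)
  omega

/-- Index at least 2 with one-dimensional outer cohomology at each end leaves nothing in the middle.
-/
theorem rigid_of_sum_finrank_range [FiniteDimensional ℂ V] (mul : Bool) {A : Fin k → End ℂ V}
    (hA : Balanced mul A) (h1 : finrank ℂ (intertwiners A A) ≤ 1)
    (h : ∑ j, finrank ℂ (LinearMap.range (commMap (A j) (A j))) + 2 ≤
      2 * (finrank ℂ V * finrank ℂ V)) : Rigid mul A := by
  rw [rigid_iff]
  have h2 := finrank_range_diagComm A A
  have h3 := finrank_foxRange_add mul A A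
  have h5 := finrank_mul_le_foxRange mul A hA
  exact (Submodule.eq_of_le_of_finrank_le (range_diagComm_le mul hA hA) (by omega)).ge

end Fox

/-! ### Extensions of tuples and the inheritance of rigidity -/

section Exact

variable {k : ℕ} {U V W : Type*} [AddCommGroup U] [Module ℂ U] [AddCommGroup V] [Module ℂ V]
  [AddCommGroup W] [Module ℂ W]

/-- A split short exact sequence `0 → U → V → W → 0` of vector spaces. -/
structure SplitExact (i : U →ₗ[ℂ] V) (π : V →ₗ[ℂ] W) (s : W →ₗ[ℂ] V) (ρ : V →ₗ[ℂ] U) : Prop where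
  retract : ∀ u, ρ (i u) = u
  section_eq : ∀ w, π (s w) = w
  comp_zero : ∀ u, π (i u) = 0
  sec_zero : ∀ w, ρ (s w) = 0
  add_eq : ∀ v, i (ρ v) + s (π v) = v

/-- A short exact sequence of tuples of endomorphisms. -/
def IsExtension (A : Fin k → End ℂ U) (B : Fin k → End ℂ V) (C : Fin k → End ℂ W)
    (i : U →ₗ[ℂ] V) (π : V →ₗ[ℂ] W) : Prop :=
  (∃ s ρ, SplitExact i π s ρ) ∧ (∀ j, B j ∘ₗ i = i ∘ₗ A j) ∧ ∀ j, C j ∘ₗ π = π ∘ₗ B j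

theorem isExtension_of_exact {A : Fin k → End ℂ U} {B : Fin k → End ℂ V} {C : Fin k → End ℂ W}
    {i : U →ₗ[ℂ] V} {π : V →ₗ[ℂ] W} (hi : Function.Injective i) (hπ : Function.Surjective π)
    (he : LinearMap.ker π = LinearMap.range i) (h1 : ∀ j, B j ∘ₗ i = i ∘ₗ A j)
    (h2 : ∀ j, C j ∘ₗ π = π ∘ₗ B j) : IsExtension A B C i π := by
  refine ⟨?_, h1, h2⟩
  obtain ⟨s, hs⟩ := π.exists_rightInverse_of_surjective (LinearMap.range_eq_top.2 hπ)
  have hs' : ∀ w, π (s w) = w := fun w => LinearMap.congr_fun hs w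
  let e := LinearEquiv.ofInjective i hi
  have hmem : ∀ v, v - s (π v) ∈ LinearMap.range i := fun v => by
    rw [← he, LinearMap.mem_ker, map_sub, hs', sub_self]
  let p : V →ₗ[ℂ] LinearMap.range i :=
    LinearMap.codRestrict _ (LinearMap.id - s ∘ₗ π) hmem
  have hz : ∀ u, π (i u) = 0 := fun u => by
    rw [← LinearMap.mem_ker, he]; exact ⟨u, rfl⟩
  have hp : ∀ v, (i (e.symm (p v))) = v - s (π v) := fun v =>
    congrArg Subtype.val (e.apply_symm_apply (p v))
  refine ⟨s, e.symm.toLinearMap ∘ₗ p, ⟨fun u => hi ?_, hs', hz, fun w => hi ?_, fun v => ?_⟩⟩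
  · simp [hp, hz]
  · simp [hp, hs']
  · simp [hp]

/-- The extension given by an invariant subspace. -/
theorem isExtension_of_submodule (B : Fin k → End ℂ V) (S : Submodule ℂ V)
    (hS : ∀ j, S ≤ S.comap (B j)) :
    IsExtension (fun j => (B j).restrict (hS j)) B (fun j => S.mapQ S (B j) (hS j))
      S.subtype S.mkQ :=
  isExtension_of_exact S.injective_subtype S.mkQ_surjective (by simp) (fun _ => rfl)
    fun _ => rfl

theorem IsExtension.injective {A : Fin k → End ℂ U} {B : Fin k → End ℂ V} {C : Fin k → End ℂ W}
    {i : U →ₗ[ℂ] V} {π : V →ₗ[ℂ] W} (h : IsExtension A B C i π) : Function.Injective i := by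
  obtain ⟨⟨s, ρ, h⟩, -, -⟩ := h
  exact fun x y hxy => by rw [← h.retract x, hxy, h.retract]

/-- The linear equivalence given by a splitting. -/
def SplitExact.equiv {i : U →ₗ[ℂ] V} {π : V →ₗ[ℂ] W} {s : W →ₗ[ℂ] V} {ρ : V →ₗ[ℂ] U}
    (h : SplitExact i π s ρ) : V ≃ₗ[ℂ] U × W :=
  LinearEquiv.ofLinearMap (ρ.prod π) (i.coprod s)
    (by ext x <;> simp [h.retract, h.section_eq, h.comp_zero, h.sec_zero])
    (by ext x; simp [h.add_eq])

theorem IsExtension.charpoly_eq [FiniteDimensional ℂ U] [FiniteDimensional ℂ V]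
    [FiniteDimensional ℂ W] {A : Fin k → End ℂ U} {B : Fin k → End ℂ V} {C : Fin k → End ℂ W}
    {i : U →ₗ[ℂ] V} {π : V →ₗ[ℂ] W} (h : IsExtension A B C i π) (j : Fin k) :
    (B j).charpoly = (A j).charpoly * (C j).charpoly := by
  obtain ⟨⟨s, ρ, h⟩, h1, h2⟩ := h
  let bU := finBasis ℂ U
  let bW := finBasis ℂ W
  let b := (bU.prod bW).map h.equiv.symm
  have e1 : ∀ x, b (Sum.inl x) = i (bU x) := fun x => by
    simp [b, SplitExact.equiv]
  have e2 : ∀ x, b (Sum.inr x) = s (bW x) := fun x => by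
    simp [b, SplitExact.equiv]
  have r1 : ∀ v x, b.repr v (Sum.inl x) = bU.repr (ρ v) x := fun v x => by
    simp [b, SplitExact.equiv]
  have r2 : ∀ v x, b.repr v (Sum.inr x) = bW.repr (π v) x := fun v x => by
    simp [b, SplitExact.equiv]
  have c1 : ∀ u, B j (i u) = i (A j u) := fun u => LinearMap.congr_fun (h1 j) u
  have c2 : ∀ v, π (B j v) = C j (π v) := fun v => (LinearMap.congr_fun (h2 j) v).symm
  have : LinearMap.toMatrix b b (B j) = Matrix.fromBlocks (LinearMap.toMatrix bU bU (A j))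
      (Matrix.of fun x y => bU.repr (ρ (B j (s (bW y)))) x) 0 (LinearMap.toMatrix bW bW (C j)) := by
    ext x y
    rcases x with x | x <;> rcases y with y | y <;>
      simp [LinearMap.toMatrix_apply, e1, e2, r1, r2, c1, c2, h.retract, h.comp_zero, h.section_eq]
  rw [← LinearMap.charpoly_toMatrix (B j) b, this, Matrix.charpoly_fromBlocks_zero₂₁,
    LinearMap.charpoly_toMatrix, LinearMap.charpoly_toMatrix]

theorem IsExtension.finrank_eq [FiniteDimensional ℂ U] [FiniteDimensional ℂ V]
    [FiniteDimensional ℂ W] {A : Fin k → End ℂ U} {B : Fin k → End ℂ V} {C : Fin k → End ℂ W}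
    {i : U →ₗ[ℂ] V} {π : V →ₗ[ℂ] W} (h : IsExtension A B C i π) :
    finrank ℂ V = finrank ℂ U + finrank ℂ W := by
  obtain ⟨⟨s, ρ, h⟩, -, -⟩ := h
  rw [h.equiv.finrank_eq, finrank_prod]

theorem IsExtension.balanced {mul : Bool} {A : Fin k → End ℂ U} {B : Fin k → End ℂ V}
    {C : Fin k → End ℂ W} {i : U →ₗ[ℂ] V} {π : V →ₗ[ℂ] W} (h : IsExtension A B C i π)
    (hB : Balanced mul B) : Balanced mul A ∧ Balanced mul C := by
  obtain ⟨⟨s, ρ, h⟩, h1, h2⟩ := h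
  cases mul
  · simp only [Balanced, Bool.false_eq_true, if_false] at hB ⊢
    constructor
    · ext u
      have h3 : i ((∑ j, A j) u) = (∑ j, B j) (i u) := by
        simp only [LinearMap.sum_apply, map_sum]
        exact Finset.sum_congr rfl fun j _ => (LinearMap.congr_fun (h1 j) u).symm
      rw [hB, LinearMap.zero_apply] at h3
      rw [← h.retract ((∑ j, A j) u), h3, map_zero]; rfl
    · ext w
      have h3 : (∑ j, C j) (π (s w)) = π ((∑ j, B j) (s w)) := by
        simp only [LinearMap.sum_apply, map_sum]
        exact Finset.sum_congr rfl fun j _ => LinearMap.congr_fun (h2 j) (s w)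
      rw [hB, h.section_eq] at h3
      rw [h3]; simp
  · simp only [Balanced, if_true, List.ofFn_eq_map] at hB ⊢
    have e1 := list_prod_comp (List.finRange k) h1
    have e2 := list_prod_comp (List.finRange k) h2
    rw [hB] at e1 e2
    constructor
    · ext u
      have h3 := LinearMap.congr_fun e1 u
      have h4 : i u = i (((List.finRange k).map A).prod u) := h3
      have h5 := congrArg ρ h4
      rw [h.retract, h.retract] at h5
      exact h5.symm
    · ext w
      have h3 := LinearMap.congr_fun e2 (s w)
      have h4 : ((List.finRange k).map C).prod (π (s w)) = π (s w) := h3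
      rwa [h.section_eq] at h4

section RigidExtension

variable [FiniteDimensional ℂ U] [FiniteDimensional ℂ W]
  {A : Fin k → End ℂ U} {B : Fin k → End ℂ V} {C : Fin k → End ℂ W}
  {i : U →ₗ[ℂ] V} {π : V →ₗ[ℂ] W}

/-- If a tuple of endomorphisms `Z j` of `V` gives rise to an infinitesimal deformation that is
trivial along `U` and `W`, then it can be corrected by endomorphisms factoring through `W → U`,
and the rigidity of `V` produces a block triangular common solution. -/
theorem exists_triangular_solution {mul : Bool} (h : IsExtension A B C i π)
    (hB : Balanced mul B) (hr : Rigid mul B) (hAC : intertwiners C A = ⊥) (Z : Fin k → End ℂ V)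
    (hZ : ∀ j, π ∘ₗ commMap (B j) (B j) (Z j) ∘ₗ i = 0)
    (h1 : π ∘ₗ foxSum mul B B (fun j => commMap (B j) (B j) (Z j)) = 0)
    (h2 : foxSum mul B B (fun j => commMap (B j) (B j) (Z j)) ∘ₗ i = 0) :
    ∃ (X : End ℂ V) (K : Fin k → (W →ₗ[ℂ] U)), π ∘ₗ X ∘ₗ i = 0 ∧
      ∀ j, commMap (B j) (B j) X = commMap (B j) (B j) (Z j) - i ∘ₗ K j ∘ₗ π := by
  have hbal := h.balanced hB
  obtain ⟨⟨s, ρ, h⟩, hi, hπ⟩ := h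
  set F := foxSum mul B B (fun j => commMap (B j) (B j) (Z j)) with hS
  -- By `h1` and `h2` the defect `F` factors as `W → U`. It can be absorbed, since the obstruction
  -- space for such maps is dual to the intertwiners `U → W`, which vanish.
  obtain ⟨K, hK⟩ := exists_foxSum_eq mul A hbal.2 hAC (ρ ∘ₗ F ∘ₗ s)
  have hcomm : ∀ j, commMap (B j) (B j) (i ∘ₗ K j ∘ₗ π) =
      i ∘ₗ commMap (A j) (C j) (K j) ∘ₗ π := by
    intro j
    ext v
    have c1 : ∀ u, B j (i u) = i (A j u) := fun u => LinearMap.congr_fun (hi j) u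
    have c2 : ∀ v, π (B j v) = C j (π v) := fun v => (LinearMap.congr_fun (hπ j) v).symm
    simp [commMap_apply, c1, c2]
  have hsum : foxSum mul B B (fun j => i ∘ₗ commMap (A j) (C j) (K j) ∘ₗ π) = F := by
    have e1 := comp_foxSum mul (A := A) (A' := B) B (f := i) hi
      (fun j => commMap (A j) (C j) (K j) ∘ₗ π)
    have e2 := foxSum_comp mul A (B := C) (B' := B) (g := π) hπ
      (fun j => commMap (A j) (C j) (K j))
    rw [← e1, ← e2, hK]
    ext v
    have f1 : ∀ v, π (F v) = 0 := fun v => LinearMap.congr_fun h1 v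
    have f2 : ∀ u, F (i u) = 0 := fun u => LinearMap.congr_fun h2 u
    have f3 := h.add_eq (F (s (π v)))
    rw [f1, map_zero, add_zero] at f3
    have f4 := congrArg F (h.add_eq v)
    rw [map_add, f2, zero_add] at f4
    simp only [LinearMap.comp_apply]
    rw [f3, f4]
  -- The corrected deformation preserves the relation on `V`, so rigidity makes it a simultaneous
  -- conjugation.
  obtain ⟨X, hX⟩ := hr (fun j => Z j - i ∘ₗ K j ∘ₗ π) (by
    have : (fun j => commMap (B j) (B j) (Z j - i ∘ₗ K j ∘ₗ π)) =
        (fun j => commMap (B j) (B j) (Z j)) -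
          fun j => i ∘ₗ commMap (A j) (C j) (K j) ∘ₗ π := by
      ext1 j; simp [hcomm]
    rw [this, map_sub, hsum, sub_self])
  refine ⟨X, fun j => commMap (A j) (C j) (K j), ?_, fun j => by rw [← hX, map_sub, hcomm]⟩
  -- The component `U → W` of `X` is an intertwiner, hence zero; so `X` preserves `U`.
  have hmem : π ∘ₗ X ∘ₗ i ∈ intertwiners C A := by
    rw [mem_intertwiners]
    intro j
    have c1 : ∀ u, B j (i u) = i (A j u) := fun u => LinearMap.congr_fun (hi j) u
    have c2 : ∀ v, π (B j v) = C j (π v) := fun v => (LinearMap.congr_fun (hπ j) v).symm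
    ext u
    have e1 := LinearMap.congr_fun (hZ j) u
    have e2 := congrArg π (LinearMap.congr_fun (hX j) (i u))
    rw [map_sub, hcomm] at e2
    simp only [LinearMap.sub_apply, LinearMap.comp_apply, h.comp_zero,
      map_zero, sub_zero] at e1 e2
    rw [e1] at e2
    simp only [commMap_apply, LinearMap.sub_apply, LinearMap.comp_apply, map_sub, c1, c2] at e2
    simpa [LinearMap.comp_apply, LinearMap.zero_apply] using (sub_eq_zero.1 e2.symm)
  rw [hAC] at hmem
  exact (Submodule.mem_bot ℂ).1 hmem

/-- A deformation `Y` of the quotient is lifted to `s ∘ Y ∘ π` on `V`. The solution `X` on `V` is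
block triangular, and its block on `W` trivializes `Y`. -/
theorem Rigid.quotient {mul : Bool} (h : IsExtension A B C i π)
    (hB : Balanced mul B) (hr : Rigid mul B) (hAC : intertwiners C A = ⊥) : Rigid mul C := by
  intro Y hY
  have h' := h
  obtain ⟨⟨s, ρ, hs⟩, hi, hπ⟩ := h'
  have c1 : ∀ j u, B j (i u) = i (A j u) := fun j u => LinearMap.congr_fun (hi j) u
  have c2 : ∀ j v, π (B j v) = C j (π v) := fun j v => (LinearMap.congr_fun (hπ j) v).symm
  have hp : ∀ j, π ∘ₗ commMap (B j) (B j) (s ∘ₗ Y j ∘ₗ π) = commMap (C j) (C j) (Y j) ∘ₗ π := by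
    intro j
    ext v
    simp [commMap_apply, c2, hs.section_eq]
  have hq : ∀ j, commMap (B j) (B j) (s ∘ₗ Y j ∘ₗ π) ∘ₗ i = 0 := by
    intro j
    ext u
    simp [commMap_apply, c1, hs.comp_zero]
  obtain ⟨X, K, hX0, hX⟩ := exists_triangular_solution h hB hr hAC (fun j => s ∘ₗ Y j ∘ₗ π)
    (fun j => by rw [hq, LinearMap.comp_zero])
    (by
      rw [comp_foxSum mul (A' := C) B (fun j => hπ j)]
      simp only [hp]
      rw [← foxSum_comp mul C (B := C) hπ, hY, LinearMap.zero_comp])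
    (by
      rw [foxSum_comp mul B (B' := A) (fun j => hi j)]
      simp only [hq]
      exact map_zero _)
  have hX0' : ∀ u, π (X (i u)) = 0 := fun u => LinearMap.congr_fun hX0 u
  have hfac : ∀ v, π (X (s (π v))) = π (X v) := fun v => by
    conv_rhs => rw [← hs.add_eq v]
    rw [map_add, map_add, hX0', zero_add]
  refine ⟨π ∘ₗ X ∘ₗ s, fun j => ?_⟩
  ext w
  have e1 := LinearMap.congr_fun (hp j) (s w)
  have e2 := congrArg π (LinearMap.congr_fun (hX j) (s w))
  simp only [LinearMap.comp_apply, hs.section_eq, LinearMap.sub_apply, map_sub, hs.comp_zero,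
    sub_zero] at e1 e2
  rw [e1] at e2
  rw [← e2]
  simp only [commMap_apply, LinearMap.sub_apply, LinearMap.comp_apply, map_sub, c2]
  rw [← hfac (B j (s w)), c2, hs.section_eq]

/-- Dual to `Rigid.quotient`: the deformation is extended to `V` by the retraction `ρ`, and the
restriction of the solution `X` to `U` trivializes it. -/
theorem Rigid.sub {mul : Bool} (h : IsExtension A B C i π)
    (hB : Balanced mul B) (hr : Rigid mul B) (hAC : intertwiners C A = ⊥) : Rigid mul A := by
  intro Y hY
  have h' := h
  obtain ⟨⟨s, ρ, hs⟩, hi, hπ⟩ := h'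
  have c1 : ∀ j u, B j (i u) = i (A j u) := fun j u => LinearMap.congr_fun (hi j) u
  have c2 : ∀ j v, π (B j v) = C j (π v) := fun j v => (LinearMap.congr_fun (hπ j) v).symm
  have hp : ∀ j, π ∘ₗ commMap (B j) (B j) (i ∘ₗ Y j ∘ₗ ρ) = 0 := by
    intro j
    ext v
    simp [commMap_apply, c2, hs.comp_zero]
  have hq : ∀ j, commMap (B j) (B j) (i ∘ₗ Y j ∘ₗ ρ) ∘ₗ i = i ∘ₗ commMap (A j) (A j) (Y j) := by
    intro j
    ext u
    simp [commMap_apply, c1, hs.retract]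
  obtain ⟨X, K, hX0, hX⟩ := exists_triangular_solution h hB hr hAC (fun j => i ∘ₗ Y j ∘ₗ ρ)
    (fun j => by rw [← LinearMap.comp_assoc, hp, LinearMap.zero_comp])
    (by
      rw [comp_foxSum mul (A' := C) B (fun j => hπ j)]
      simp only [hp]
      exact map_zero _)
    (by
      rw [foxSum_comp mul B (B' := A) (fun j => hi j)]
      simp only [hq]
      rw [← comp_foxSum mul A (A := A) hi, hY, LinearMap.comp_zero])
  have hX0' : ∀ u, π (X (i u)) = 0 := fun u => LinearMap.congr_fun hX0 u
  have hfac : ∀ u, i (ρ (X (i u))) = X (i u) := fun u => by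
    have := hs.add_eq (X (i u))
    rwa [hX0', map_zero, add_zero] at this
  refine ⟨ρ ∘ₗ X ∘ₗ i, fun j => ?_⟩
  ext u
  have e1 := LinearMap.congr_fun (hq j) u
  have e2 := LinearMap.congr_fun (hX j) (i u)
  simp only [LinearMap.comp_apply, LinearMap.sub_apply, hs.comp_zero, map_zero, sub_zero]
    at e1 e2
  rw [e1] at e2
  have e3 := congrArg ρ e2
  rw [hs.retract] at e3
  rw [← e3]
  simp only [commMap_apply, LinearMap.sub_apply, LinearMap.comp_apply, map_sub, c1]
  rw [← hfac u, c1, hs.retract, hs.retract]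

end RigidExtension

end Exact

/-! ### Dimensions of spaces of intertwiners between two endomorphisms -/

section Eigen

variable {U V : Type*} [AddCommGroup U] [Module ℂ U] [AddCommGroup V] [Module ℂ V]
  [FiniteDimensional ℂ U] [FiniteDimensional ℂ V]

theorem finrank_range_commMap (a : End ℂ V) (b : End ℂ U) :
    finrank ℂ (LinearMap.range (commMap a b)) + finrank ℂ (LinearMap.ker (commMap a b)) =
      finrank ℂ U * finrank ℂ V := by
  rw [LinearMap.finrank_range_add_finrank_ker, finrank_linearMap]

theorem roots_charpoly_of_eigenbasis {ι : Type*} [Fintype ι] {b : End ℂ U} (e : Basis ι ℂ U)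
    {d : ι → ℂ} (h : ∀ i, b (e i) = d i • e i) :
    b.charpoly.roots = Finset.univ.val.map d := by
  classical
  have : LinearMap.toMatrix e e b = Matrix.diagonal d := by
    ext i j
    rw [LinearMap.toMatrix_apply, h, map_smul, Basis.repr_self, Matrix.diagonal_apply]
    by_cases hij : i = j
    · simp [hij]
    · simp [hij]
  rw [← LinearMap.charpoly_toMatrix b e, this, Matrix.charpoly_diagonal,
    Finset.prod_eq_multiset_prod, ← Polynomial.roots_multiset_prod_X_sub_C
      (Finset.univ.val.map d), Multiset.map_map]
  rfl

/-- For an eigenvector `u` of `b` with eigenvalue `x`, evaluation at `u` sends an intertwiner into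
the `x`-eigenspace of `a`. Intertwiners killing `u` factor through the quotient by its span, where
induction applies. -/
theorem finrank_ker_commMap_le_aux (n : ℕ) : ∀ {U : Type*} [AddCommGroup U] [Module ℂ U]
    [FiniteDimensional ℂ U] (a : End ℂ V) (b : End ℂ U), finrank ℂ U = n →
    finrank ℂ (LinearMap.ker (commMap a b)) ≤
      (b.charpoly.roots.map fun x => finrank ℂ (a.eigenspace x)).sum := by
  induction n with
  | zero =>
    intro U _ _ _ a b hU
    have := finrank_range_commMap a b
    rw [hU, zero_mul] at this
    omega
  | succ n ih =>
    intro U _ _ _ a b hU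
    have : Nontrivial U := Module.nontrivial_of_finrank_pos (R := ℂ) (by omega)
    obtain ⟨x, hx⟩ := End.exists_eigenvalue b
    obtain ⟨u, hu⟩ := hx.exists_hasEigenvector
    have hbu : b u = x • u := hu.apply_eq_smul
    have hu0 : u ≠ 0 := hu.2
    let S := Submodule.span ℂ {u}
    have hS : S ≤ S.comap b := by
      rw [Submodule.span_le]
      rintro _ rfl
      rw [SetLike.mem_coe, Submodule.mem_comap, hbu]
      exact S.smul_mem x (Submodule.mem_span_singleton_self _)
    have hext := isExtension_of_submodule (fun _ : Fin 1 => b) S (fun _ => hS)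
    have hS1 : finrank ℂ S = 1 := finrank_span_singleton hu0
    have hq : finrank ℂ (U ⧸ S) = n := by have := hext.finrank_eq; omega
    have hch := hext.charpoly_eq 0
    have hroot : (b.restrict hS).charpoly.roots = {x} := by
      rw [roots_charpoly_of_eigenbasis (b := b.restrict hS) (finBasis ℂ S) (d := fun _ => x)]
      · simp [hS1]
      · intro i
        obtain ⟨c, hc⟩ := Submodule.mem_span_singleton.1 (finBasis ℂ S i).2
        apply Subtype.ext
        simp only [LinearMap.coe_restrict_apply, Submodule.coe_smul]
        rw [← hc, map_smul, hbu, smul_comm]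
    have ih' := ih a (S.mapQ S b hS) hq
    rw [hch, Polynomial.roots_mul (mul_ne_zero (LinearMap.charpoly_monic _).ne_zero
      (LinearMap.charpoly_monic _).ne_zero), Multiset.map_add, Multiset.sum_add, hroot,
      Multiset.map_singleton, Multiset.sum_singleton]
    refine le_trans ?_ (Nat.add_le_add_left ih' _)
    let K := LinearMap.ker (commMap a b)
    let ev : (U →ₗ[ℂ] V) →ₗ[ℂ] V := LinearMap.applyₗ u
    have h1 := LinearMap.finrank_range_add_finrank_ker (ev.domRestrict K)
    have h2 : finrank ℂ (LinearMap.range (ev.domRestrict K)) ≤ finrank ℂ (a.eigenspace x) := by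
      apply Submodule.finrank_mono
      rintro _ ⟨⟨X, hX⟩, rfl⟩
      rw [End.mem_eigenspace_iff]
      have := LinearMap.congr_fun (sub_eq_zero.1 (LinearMap.mem_ker.1 hX)) u
      simpa [hbu, ev] using this
    have h3 : finrank ℂ (LinearMap.ker (ev.domRestrict K)) ≤
        finrank ℂ (LinearMap.ker (commMap a (S.mapQ S b hS))) := by
      rw [LinearMap.ker_domRestrict, ← Submodule.finrank_map_subtype_eq]
      refine le_trans (Submodule.finrank_mono ?_)
        (Submodule.finrank_map_le (LinearMap.lcomp ℂ V S.mkQ) _)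
      rintro _ ⟨⟨X, hX⟩, hXu, rfl⟩
      have hXS : S ≤ LinearMap.ker X := by
        rw [Submodule.span_le]
        rintro _ rfl
        exact hXu
      refine ⟨S.liftQ X hXS, ?_, ?_⟩
      · rw [SetLike.mem_coe, LinearMap.mem_ker, commMap_apply]
        apply Submodule.linearMap_qext
        ext w
        exact LinearMap.congr_fun (LinearMap.mem_ker.1 hX) w
      · ext w; rfl
    exact h1 ▸ Nat.add_le_add h2 h3

theorem finrank_ker_commMap_le (a : End ℂ V) (b : End ℂ U) :
    finrank ℂ (LinearMap.ker (commMap a b)) ≤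
      (b.charpoly.roots.map fun x => finrank ℂ (a.eigenspace x)).sum :=
  finrank_ker_commMap_le_aux _ a b rfl

/-- Each vector of an eigenbasis of `b` may be sent to an arbitrary vector of the corresponding
eigenspace of `a`; so the bound of `finrank_ker_commMap_le` is attained. -/
theorem le_finrank_ker_commMap {ι : Type*} [Fintype ι] (a : End ℂ V) {b : End ℂ U}
    (e : Basis ι ℂ U) {d : ι → ℂ} (h : ∀ i, b (e i) = d i • e i) :
    (b.charpoly.roots.map fun x => finrank ℂ (a.eigenspace x)).sum ≤
      finrank ℂ (LinearMap.ker (commMap a b)) := by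
  rw [roots_charpoly_of_eigenbasis e h, Multiset.map_map]
  change ∑ i, finrank ℂ (a.eigenspace (d i)) ≤ _
  rw [← finrank_pi_fintype ℂ]
  let g : (∀ i, a.eigenspace (d i)) →ₗ[ℂ] (U →ₗ[ℂ] V) :=
    (e.constr ℂ).toLinearMap ∘ₗ LinearMap.pi fun i =>
      Submodule.subtype _ ∘ₗ LinearMap.proj i
  have hg : ∀ f i, g f (e i) = f i := fun f i => by
    simp only [g, LinearMap.comp_apply, LinearEquiv.coe_coe]
    rw [Basis.constr_basis]
    rfl
  have hinj : Function.Injective g := fun f f' hff => by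
    ext i
    rw [← hg, hff, hg]
  rw [← LinearMap.finrank_range_of_inj hinj]
  apply Submodule.finrank_mono
  rintro _ ⟨f, rfl⟩
  rw [LinearMap.mem_ker, commMap_apply]
  refine e.ext fun i => ?_
  simp only [LinearMap.sub_apply, LinearMap.comp_apply, hg, h, map_smul, LinearMap.zero_apply]
  rw [End.mem_eigenspace_iff.1 (f i).2, sub_self]

/-- The endomorphism has a basis of eigenvectors. -/
def HasEigenbasis (b : End ℂ U) : Prop :=
  ∃ (ι : Type) (_ : Fintype ι) (e : Basis ι ℂ U) (d : ι → ℂ), ∀ i, b (e i) = d i • e i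

/-- Both sides are compared with the sum of `dim ker (a - x)` over the roots `x`. The roots for `a`
are those for `b` taken `q` times, and for the diagonalizable `b` the bound is an equality. -/
theorem finrank_ker_commMap_le_of_charpoly_eq_pow {a : End ℂ V} {b : End ℂ U}
    (hb : HasEigenbasis b) {q : ℕ} (h : a.charpoly = b.charpoly ^ q) :
    finrank ℂ (LinearMap.ker (commMap a a)) ≤
      q * finrank ℂ (LinearMap.ker (commMap a b)) := by
  obtain ⟨ι, _, e, d, he⟩ := hb
  refine (finrank_ker_commMap_le a a).trans ?_
  refine le_trans (le_of_eq ?_) (Nat.mul_le_mul_left q (le_finrank_ker_commMap a e he))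
  rw [h, Polynomial.roots_pow, Multiset.map_nsmul, Multiset.sum_nsmul, smul_eq_mul]

/-- A tuple of positive index of rigidity whose characteristic polynomials are powers of those of
a tuple of diagonalizable endomorphisms has a nonzero intertwiner from or to the latter. -/
theorem intertwiners_ne_bot {k : ℕ} {mul : Bool} {A : Fin k → End ℂ V} {C : Fin k → End ℂ U}
    (hA : Balanced mul A) (hC : Balanced mul C) (hd : ∀ j, HasEigenbasis (C j)) {q : ℕ}
    (hq : finrank ℂ V = q * finrank ℂ U) (h : ∀ j, (A j).charpoly = (C j).charpoly ^ q)
    (hlt : ∑ j, finrank ℂ (LinearMap.range (commMap (A j) (A j))) <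
      2 * (finrank ℂ V * finrank ℂ V)) :
    intertwiners A C ≠ ⊥ ∨ intertwiners C A ≠ ⊥ := by
  by_contra! hcon
  have h1 := two_mul_le_sum_finrank_range mul hA hC
  rw [hcon.1, hcon.2, finrank_bot, finrank_bot, add_zero, add_zero] at h1
  -- Multiplied by `q`, the Euler estimate between `A` and `C` becomes an estimate of `A` with
  -- itself and contradicts `hlt`.
  have h2 : ∀ j, q * finrank ℂ (LinearMap.range (commMap (A j) (C j))) ≤
      finrank ℂ (LinearMap.range (commMap (A j) (A j))) := by
    intro j
    have e1 := finrank_range_commMap (A j) (C j)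
    have e2 := finrank_range_commMap (A j) (A j)
    have e3 := finrank_ker_commMap_le_of_charpoly_eq_pow (hd j) (h j)
    have e4 := congrArg (q * ·) e1
    simp only [mul_add] at e4
    rw [← mul_assoc q (finrank ℂ U), ← hq] at e4
    omega
  have h3 := Finset.sum_le_sum fun j (_ : j ∈ Finset.univ) => h2 j
  rw [← Finset.mul_sum] at h3
  have h4 := Nat.mul_le_mul_left q h1
  have h5 : q * (2 * (finrank ℂ U * finrank ℂ V)) = 2 * (finrank ℂ V * finrank ℂ V) := by
    conv_rhs => rw [hq]
    rw [hq]; ring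
  omega

end Eigen

/-! ### Iterated extensions of one tuple -/

section Filtration

/-- Iterated extensions of `q` copies of the tuple `C`. -/
inductive Filtered {k : ℕ} {L : Type} [AddCommGroup L] [Module ℂ L] (C : Fin k → End ℂ L) :
    ℕ → ∀ (V : Type) [AddCommGroup V] [Module ℂ V], (Fin k → End ℂ V) → Prop
  | zero (V : Type) [AddCommGroup V] [Module ℂ V] (A : Fin k → End ℂ V) (h : Subsingleton V) :
      Filtered C 0 V A
  | equiv (V : Type) [AddCommGroup V] [Module ℂ V] (A : Fin k → End ℂ V) (e : L ≃ₗ[ℂ] V)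
      (h : ∀ j, A j ∘ₗ e.toLinearMap = e.toLinearMap ∘ₗ C j) : Filtered C 1 V A
  | ext (U V W : Type) [AddCommGroup U] [Module ℂ U] [AddCommGroup V] [Module ℂ V]
      [AddCommGroup W] [Module ℂ W] (A : Fin k → End ℂ U) (M : Fin k → End ℂ V)
      (B : Fin k → End ℂ W) (i : U →ₗ[ℂ] V) (π : V →ₗ[ℂ] W) (p q : ℕ)
      (h : IsExtension A M B i π) (hA : Filtered C p U A) (hB : Filtered C q W B) :
      Filtered C (p + q) V M

variable {k : ℕ} {L V : Type} [AddCommGroup L] [Module ℂ L] {C : Fin k → End ℂ L}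
  [AddCommGroup V] [Module ℂ V] {A : Fin k → End ℂ V}
  {Y : Type} [AddCommGroup Y] [Module ℂ Y] {X : Fin k → End ℂ Y}

theorem intertwiners_eq_bot_iff {U W : Type*} [AddCommGroup U] [Module ℂ U] [AddCommGroup W]
    [Module ℂ W] {A : Fin k → End ℂ U} {B : Fin k → End ℂ W} :
    intertwiners A B = ⊥ ↔ ∀ f : W →ₗ[ℂ] U, (∀ j, A j ∘ₗ f = f ∘ₗ B j) → f = 0 := by
  rw [Submodule.eq_bot_iff]
  exact forall_congr' fun f => by rw [mem_intertwiners]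

/-- Left exactness of Hom along the filtration. Elements of `intertwiners X C` are maps from the
space of `C` to that of `X`. -/
theorem Filtered.intertwiners_eq_bot_of_left {p : ℕ} (h : Filtered C p V A)
    (hX : intertwiners X C = ⊥) : intertwiners X A = ⊥ := by
  induction h with
  | zero V A h =>
    rw [intertwiners_eq_bot_iff]
    intro f _
    ext v
    rw [Subsingleton.elim v 0, map_zero, map_zero]
  | equiv V A e h =>
    rw [intertwiners_eq_bot_iff] at hX ⊢
    intro f hf
    have := hX (f ∘ₗ e.toLinearMap) fun j => by
      rw [LinearMap.comp_assoc, ← h, ← LinearMap.comp_assoc, hf, LinearMap.comp_assoc]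
    ext v
    simpa using LinearMap.congr_fun this (e.symm v)
  | ext U V W A M B i π p q h hA hB ihA ihB =>
    rw [intertwiners_eq_bot_iff] at ihA ihB ⊢
    obtain ⟨⟨s, ρ, hs⟩, hi, hπ⟩ := h
    intro f hf
    have h1 : f ∘ₗ i = 0 := ihA _ fun j => by
      rw [LinearMap.comp_assoc, ← hi, ← LinearMap.comp_assoc, hf, LinearMap.comp_assoc]
    have h1' : ∀ u, f (i u) = 0 := fun u => LinearMap.congr_fun h1 u
    have h2 : f ∘ₗ s ∘ₗ π = f := by
      ext v
      have := congrArg f (hs.add_eq v)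
      rwa [map_add, h1', zero_add] at this
    have h3 : f ∘ₗ s = 0 := ihB _ fun j => by
      ext w
      have e1 := LinearMap.congr_fun (hf j) (s w)
      have e2 := LinearMap.congr_fun h2 (M j (s w))
      have e3 := LinearMap.congr_fun (hπ j) (s w)
      simp only [LinearMap.comp_apply, hs.section_eq] at e1 e2 e3 ⊢
      rw [e1, ← e2, ← e3]
    rw [← h2, ← LinearMap.comp_assoc, h3, LinearMap.zero_comp]

theorem Filtered.intertwiners_eq_bot_of_right {p : ℕ} (h : Filtered C p V A)
    (hX : intertwiners C X = ⊥) : intertwiners A X = ⊥ := by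
  induction h with
  | zero V A h =>
    rw [intertwiners_eq_bot_iff]
    intro f _
    ext v
    exact Subsingleton.elim _ _
  | equiv V A e h =>
    rw [intertwiners_eq_bot_iff] at hX ⊢
    intro f hf
    have := hX (e.symm.toLinearMap ∘ₗ f) fun j => by
      ext y
      have e1 := LinearMap.congr_fun (h j) (e.symm (f y))
      have e2 := LinearMap.congr_fun (hf j) y
      simp only [LinearMap.comp_apply, LinearEquiv.coe_coe, LinearEquiv.apply_symm_apply] at e1 e2 ⊢
      rw [← e2, e1, LinearEquiv.symm_apply_apply]
    ext v
    have := LinearMap.congr_fun this v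
    simpa using this
  | ext U V W A M B i π p q h hA hB ihA ihB =>
    rw [intertwiners_eq_bot_iff] at ihA ihB ⊢
    have hinj := h.injective
    obtain ⟨⟨s, ρ, hs⟩, hi, hπ⟩ := h
    intro f hf
    have h1 : π ∘ₗ f = 0 := ihB _ fun j => by
      rw [← LinearMap.comp_assoc, hπ, LinearMap.comp_assoc, hf, LinearMap.comp_assoc]
    have h1' : ∀ u, π (f u) = 0 := fun u => LinearMap.congr_fun h1 u
    have h2 : ∀ y, i (ρ (f y)) = f y := fun y => by
      have := hs.add_eq (f y)
      rwa [h1', map_zero, add_zero] at this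
    have h3 : ρ ∘ₗ f = 0 := ihA _ fun j => by
      ext y
      apply hinj
      have e1 := LinearMap.congr_fun (hf j) y
      have e3 := LinearMap.congr_fun (hi j) (ρ (f y))
      simp only [LinearMap.comp_apply] at e1 e3 ⊢
      rw [h2, ← e1, ← e3, h2]
    ext y
    rw [← h2, ← LinearMap.comp_apply ρ, h3]
    simp

theorem Filtered.finite [FiniteDimensional ℂ L] {p : ℕ} (h : Filtered C p V A) :
    FiniteDimensional ℂ V := by
  induction h with
  | zero V A h => infer_instance
  | equiv V A e h => exact e.finiteDimensional
  | ext U V W A M B i π p q h hA hB ihA ihB =>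
    obtain ⟨⟨s, ρ, hs⟩, -, -⟩ := h
    exact hs.equiv.symm.finiteDimensional

theorem Filtered.charpoly_eq [FiniteDimensional ℂ L] [hV : FiniteDimensional ℂ V] {p : ℕ}
    (h : Filtered C p V A) (j : Fin k) : (A j).charpoly = (C j).charpoly ^ p := by
  revert hV
  induction h with
  | zero V A h =>
    intro _
    rw [pow_zero, ← LinearMap.charpoly_toMatrix (A j) (Basis.empty V : Basis (Fin 0) ℂ V)]
    simp [Matrix.charpoly]
  | equiv V A e h =>
    intro _
    rw [pow_one, ← LinearEquiv.charpoly_conj e (C j)]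
    congr 1
    ext v
    have := LinearMap.congr_fun (h j) (e.symm v)
    simpa [LinearEquiv.conj_apply] using this
  | ext U V W A M B i π p q h hA hB ihA ihB =>
    intro _
    have hU := hA.finite
    have hW := hB.finite
    rw [h.charpoly_eq, ihA, ihB, pow_add]

end Filtration

/-! ### Rigid tuples with the eigenvalues of a simple tuple are filtered by it -/

section Filtration

variable {k : ℕ} {L V : Type} [AddCommGroup L] [Module ℂ L] {C : Fin k → End ℂ L}
  [AddCommGroup V] [Module ℂ V] {A : Fin k → End ℂ V}

/-- The tuple has no common invariant subspaces except the trivial ones. -/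
def IsSimpleTuple {k : ℕ} {L : Type*} [AddCommGroup L] [Module ℂ L] (C : Fin k → End ℂ L) : Prop :=
  Nontrivial L ∧ ∀ S : Submodule ℂ L, (∀ j, S ≤ S.comap (C j)) → S = ⊥ ∨ S = ⊤

theorem IsSimpleTuple.injective (hC : IsSimpleTuple C) {f : L →ₗ[ℂ] V} (hf0 : f ≠ 0)
    (hf : ∀ j, A j ∘ₗ f = f ∘ₗ C j) : Function.Injective f := by
  rw [← LinearMap.ker_eq_bot]
  refine (hC.2 (LinearMap.ker f) fun j x hx => ?_).resolve_right fun h => ?_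
  · have := LinearMap.congr_fun (hf j) x
    simp only [LinearMap.comp_apply, LinearMap.mem_ker.1 hx, map_zero] at this
    exact this.symm
  · exact hf0 (LinearMap.ker_eq_top.1 h)

theorem IsSimpleTuple.surjective (hC : IsSimpleTuple C) {f : V →ₗ[ℂ] L} (hf0 : f ≠ 0)
    (hf : ∀ j, C j ∘ₗ f = f ∘ₗ A j) : Function.Surjective f := by
  rw [← LinearMap.range_eq_top]
  refine (hC.2 (LinearMap.range f) fun j => ?_).resolve_left fun h => ?_
  · rintro _ ⟨x, rfl⟩
    exact ⟨A j x, (LinearMap.congr_fun (hf j) x).symm⟩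
  · exact hf0 (LinearMap.range_eq_bot.1 h)

/-- There is a filtered invariant subspace `S` such that no copy of `C` is contained in the
quotient by `S`. -/
theorem exists_maximal_filtered_sub [FiniteDimensional ℂ V] (hC : IsSimpleTuple C) :
    ∃ (S : Submodule ℂ V) (hS : ∀ j, S ≤ S.comap (A j)),
      (∃ p, Filtered C p S fun j => (A j).restrict (hS j)) ∧
      intertwiners (fun j => S.mapQ S (A j) (hS j)) C = ⊥ := by
  let P : Set (Submodule ℂ V) := {S | ∃ hS : ∀ j, S ≤ S.comap (A j),
    ∃ p, Filtered C p S fun j => (A j).restrict (hS j)}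
  have hP : P.Nonempty := ⟨⊥, fun j => by simp, 0, Filtered.zero _ _ inferInstance⟩
  obtain ⟨S, ⟨hS, p, hp⟩, hmax⟩ := (wellFounded_gt (α := Submodule ℂ V)).has_min P hP
  refine ⟨S, hS, ⟨p, hp⟩, ?_⟩
  rw [intertwiners_eq_bot_iff]
  intro f hf
  by_contra hf0
  have hinj := hC.injective hf0 hf
  -- A copy of `C` inside the quotient pulls back to a strictly larger filtered subspace.
  let T : Submodule ℂ V := (LinearMap.range f).comap S.mkQ
  have hST : S ≤ T := fun x hx => ⟨0, by
    rw [map_zero]; exact ((Submodule.Quotient.mk_eq_zero S).2 hx).symm⟩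
  have hT : ∀ j, T ≤ T.comap (A j) := by
    rintro j x ⟨y, hy⟩
    refine ⟨C j y, ?_⟩
    have := LinearMap.congr_fun (hf j) y
    simp only [LinearMap.comp_apply, hy] at this
    exact this.symm
  let e := LinearEquiv.ofInjective f hinj
  let g : T →ₗ[ℂ] LinearMap.range f :=
    LinearMap.codRestrict _ (S.mkQ ∘ₗ T.subtype) fun x => x.2
  let π : T →ₗ[ℂ] L := e.symm.toLinearMap ∘ₗ g
  have hπ : ∀ x, f (π x) = S.mkQ x := fun x => congrArg Subtype.val (e.apply_symm_apply (g x))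
  have hext : IsExtension (fun j => (A j).restrict (hS j)) (fun j => (A j).restrict (hT j)) C
      (Submodule.inclusion hST) π := by
    refine isExtension_of_exact (Submodule.inclusion_injective hST) ?_ ?_ (fun _ => rfl) ?_
    · intro y
      obtain ⟨x, hx⟩ := S.mkQ_surjective (f y)
      exact ⟨⟨x, y, hx.symm⟩, hinj ((hπ _).trans hx)⟩
    · ext x
      rw [Submodule.range_inclusion, Submodule.mem_comap, LinearMap.mem_ker]
      constructor
      · intro h
        have := hπ x
        rw [h, map_zero] at this
        exact (Submodule.Quotient.mk_eq_zero S).1 this.symm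
      · intro h
        apply hinj
        rw [hπ, map_zero]
        exact (Submodule.Quotient.mk_eq_zero S).2 h
    · intro j
      ext x
      apply hinj
      have := LinearMap.congr_fun (hf j) (π x)
      simp only [LinearMap.comp_apply] at this ⊢
      rw [← this, hπ, hπ]
      rfl
  refine hmax T ⟨hT, p + 1, Filtered.ext _ _ _ _ _ _ _ _ p 1 hext hp
    (Filtered.equiv L C (LinearEquiv.refl ℂ L) fun _ => rfl)⟩ (lt_of_le_of_ne hST ?_)
  rintro hEq
  apply hf0
  ext y
  obtain ⟨x, hx⟩ := S.mkQ_surjective (f y)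
  have hxT : x ∈ T := ⟨y, hx.symm⟩
  rw [← hEq] at hxT
  rw [← hx, LinearMap.zero_apply]
  exact (Submodule.Quotient.mk_eq_zero S).2 hxT

/-- There is an invariant subspace `S` with filtered quotient that has no quotient `C`. -/
theorem exists_minimal_filtered_quotient [FiniteDimensional ℂ V] (hC : IsSimpleTuple C) :
    ∃ (S : Submodule ℂ V) (hS : ∀ j, S ≤ S.comap (A j)),
      (∃ p, Filtered C p (V ⧸ S) fun j => S.mapQ S (A j) (hS j)) ∧
      intertwiners C (fun j => (A j).restrict (hS j)) = ⊥ := by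
  let P : Set (Submodule ℂ V) := {S | ∃ hS : ∀ j, S ≤ S.comap (A j),
    ∃ p, Filtered C p (V ⧸ S) fun j => S.mapQ S (A j) (hS j)}
  have hP : P.Nonempty := ⟨⊤, fun j => by simp, 0, Filtered.zero _ _ inferInstance⟩
  obtain ⟨S, ⟨hS, p, hp⟩, hmin⟩ := (wellFounded_lt (α := Submodule ℂ V)).has_min P hP
  refine ⟨S, hS, ⟨p, hp⟩, ?_⟩
  rw [intertwiners_eq_bot_iff]
  intro f hf
  by_contra hf0
  have hsurj := hC.surjective hf0 hf
  have hf' : ∀ j (x : S), C j (f x) = f ((A j).restrict (hS j) x) := fun j x =>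
    LinearMap.congr_fun (hf j) x
  -- A map of `S` onto `C` has as its kernel a strictly smaller subspace, whose quotient is still
  -- filtered.
  let T : Submodule ℂ V := (LinearMap.ker f).map S.subtype
  have hTS : T ≤ S := Submodule.map_subtype_le _ _
  have hmem : ∀ x : S, (x : V) ∈ T ↔ f x = 0 := fun x => by
    constructor
    · rintro ⟨y, hy, hxy⟩
      rw [← Subtype.ext hxy]; exact hy
    · exact fun h => ⟨x, h, rfl⟩
  have hT : ∀ j, T ≤ T.comap (A j) := by
    rintro j _ ⟨x, hx, rfl⟩
    have : f ((A j).restrict (hS j) x) = 0 := by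
      rw [← hf', LinearMap.mem_ker.1 hx, map_zero]
    exact (hmem _).2 this
  obtain ⟨σ, hσ⟩ := f.exists_rightInverse_of_surjective (LinearMap.range_eq_top.2 hsurj)
  have hσ' : ∀ y, f (σ y) = y := fun y => LinearMap.congr_fun hσ y
  let i : L →ₗ[ℂ] V ⧸ T := T.mkQ ∘ₗ S.subtype ∘ₗ σ
  have hi : ∀ x : S, T.mkQ (x : V) = i (f x) := fun x => by
    refine (Submodule.Quotient.eq T).2 ?_
    have : f (x - σ (f x)) = 0 := by rw [map_sub, hσ', sub_self]
    exact (hmem _).2 this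
  have hext : IsExtension C (fun j => T.mapQ T (A j) (hT j)) (fun j => S.mapQ S (A j) (hS j)) i
      (Submodule.factor hTS) := by
    refine isExtension_of_exact ?_ (Submodule.factor_surjective hTS) ?_ ?_ ?_
    · rw [injective_iff_map_eq_zero]
      intro y hy
      have := (hmem (σ y)).1 ((Submodule.Quotient.mk_eq_zero T).1 hy)
      rwa [hσ'] at this
    · ext x
      obtain ⟨x, rfl⟩ := T.mkQ_surjective x
      constructor
      · intro h
        have hx : x ∈ S := (Submodule.Quotient.mk_eq_zero S).1 h
        exact ⟨f ⟨x, hx⟩, (hi ⟨x, hx⟩).symm⟩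
      · rintro ⟨y, hy⟩
        rw [← hy]
        exact (Submodule.Quotient.mk_eq_zero S).2 (σ y).2
    · intro j
      ext y
      have e1 := hi ((A j).restrict (hS j) (σ y))
      rw [← hf', hσ'] at e1
      exact e1
    · intro j
      apply Submodule.linearMap_qext
      rfl
  refine hmin T ⟨hT, 1 + p, Filtered.ext _ _ _ _ _ _ _ _ 1 p hext
    (Filtered.equiv L C (LinearEquiv.refl ℂ L) fun _ => rfl) hp⟩ (lt_of_le_of_ne hTS ?_)
  intro hEq
  apply hf0
  ext x
  rw [LinearMap.zero_apply, ← hmem, hEq]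
  exact x.2

theorem charpoly_pow_sub [FiniteDimensional ℂ L] {b : End ℂ L} {P : Polynomial ℂ} {p q : ℕ}
    (hpq : p ≤ q) (h : b.charpoly ^ q = b.charpoly ^ p * P) : P = b.charpoly ^ (q - p) := by
  have h0 : b.charpoly ^ p ≠ 0 := pow_ne_zero _ b.charpoly_monic.ne_zero
  apply mul_left_cancel₀ h0
  rw [← h, ← pow_add, Nat.add_sub_cancel' hpq]

theorem Filtered.finrank_eq [FiniteDimensional ℂ L] {p : ℕ} (h : Filtered C p V A) :
    finrank ℂ V = p * finrank ℂ L := by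
  induction h with
  | zero V A h => rw [finrank_zero_of_subsingleton, zero_mul]
  | equiv V A e h => rw [one_mul, e.finrank_eq]
  | ext U V W A M B i π p q h hA hB ihA ihB =>
    have hU := hA.finite
    have hW := hB.finite
    obtain ⟨⟨s, ρ, hs⟩, -, -⟩ := h
    rw [hs.equiv.finrank_eq, finrank_prod, ihA, ihB, add_mul]

/-- A rigid tuple whose characteristic polynomials are the `q`-th powers of those of an irreducible
diagonalizable tuple `C` is an iterated extension of copies of `C`. -/
theorem Rigid.filtered [FiniteDimensional ℂ L] {mul : Bool} (hC : IsSimpleTuple C)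
    (hCb : Balanced mul C) (hd : ∀ j, HasEigenbasis (C j)) (n : ℕ) :
    ∀ {V : Type} [AddCommGroup V] [Module ℂ V] [FiniteDimensional ℂ V] {A : Fin k → End ℂ V}
      (q : ℕ), finrank ℂ V = n → finrank ℂ V = q * finrank ℂ L → Balanced mul A → Rigid mul A →
      (∀ j, (A j).charpoly = (C j).charpoly ^ q) → Filtered C q V A := by
  have hL := hC.1
  have hLpos : 0 < finrank ℂ L := Module.finrank_pos
  induction n using Nat.strong_induction_on with
  | _ n ih =>
  intro V _ _ _ A q hn hq hA hr hch
  rcases subsingleton_or_nontrivial V with hV | hV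
  · rw [finrank_zero_of_subsingleton] at hq
    have : q = 0 := by
      rcases Nat.mul_eq_zero.1 hq.symm with h | h
      · exact h
      · omega
    subst this
    exact Filtered.zero _ _ hV
  rcases intertwiners_ne_bot hA hCb hd hq hch hr.sum_finrank_range_lt with hne | hne
  · obtain ⟨S, hS, ⟨p, hp⟩, hmax⟩ := exists_maximal_filtered_sub (A := A) hC
    -- No copy of `C` lies in `V ⧸ S`, hence no nonzero intertwiner goes from the filtered `S` to `V
    -- ⧸ S`. This is what `Rigid.quotient` needs.
    have hext := isExtension_of_submodule A S hS
    have hvan := hp.intertwiners_eq_bot_of_left hmax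
    have hfr := hext.finrank_eq
    have hpfr := hp.finrank_eq
    have hpq : p ≤ q := Nat.le_of_mul_le_mul_right (by omega : p * finrank ℂ L ≤ _) hLpos
    -- If `S` were zero, the nonzero map from `C` to `V` would survive in `V ⧸ S`. Positivity makes
    -- the quotient smaller, as the induction requires.
    have hS0 : 0 < finrank ℂ S := by
      rw [Nat.pos_iff_ne_zero]
      intro h0
      have hbot : S = ⊥ := Submodule.finrank_eq_zero.1 h0
      apply hne
      rw [intertwiners_eq_bot_iff] at hmax ⊢
      intro f hf
      have := hmax (S.mkQ ∘ₗ f) fun j => by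
        ext x
        have := LinearMap.congr_fun (hf j) x
        simp only [LinearMap.comp_apply] at this ⊢
        rw [← this]
        rfl
      ext x
      have h2 := LinearMap.congr_fun this x
      have h3 := (Submodule.Quotient.mk_eq_zero S).1 h2
      rw [hbot] at h3
      exact h3
    have hquot := ih (finrank ℂ (V ⧸ S)) (by omega) (A := fun j => S.mapQ S (A j) (hS j))
      (q - p) rfl (by rw [Nat.sub_mul]; omega) (hext.balanced hA).2
      (hr.quotient hext hA hvan) fun j => charpoly_pow_sub hpq (by
        rw [← hch, hext.charpoly_eq, hp.charpoly_eq])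
    have := Filtered.ext _ _ _ _ _ _ _ _ p (q - p) hext hp hquot
    rwa [Nat.add_sub_cancel' hpq] at this
  · obtain ⟨S, hS, ⟨p, hp⟩, hmin⟩ := exists_minimal_filtered_quotient (A := A) hC
    have hext := isExtension_of_submodule A S hS
    have hvan := hp.intertwiners_eq_bot_of_right hmin
    have hfr := hext.finrank_eq
    have hpfr := hp.finrank_eq
    have hpq : p ≤ q := Nat.le_of_mul_le_mul_right (by omega : p * finrank ℂ L ≤ _) hLpos
    have hS0 : 0 < finrank ℂ (V ⧸ S) := by
      rw [Nat.pos_iff_ne_zero]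
      intro h0
      have htop : S = ⊤ := Submodule.eq_top_of_finrank_eq (by omega)
      apply hne
      rw [intertwiners_eq_bot_iff] at hmin ⊢
      intro f hf
      have := hmin (f ∘ₗ S.subtype) fun j => by
        ext x
        exact LinearMap.congr_fun (hf j) x
      ext x
      exact LinearMap.congr_fun this ⟨x, htop ▸ Submodule.mem_top⟩
    have hsub := ih (finrank ℂ S) (by omega) (A := fun j => (A j).restrict (hS j))
      (q - p) rfl (by rw [Nat.sub_mul]; omega) (hext.balanced hA).1
      (hr.sub hext hA hvan) fun j => charpoly_pow_sub hpq (by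
        rw [← hch, hext.charpoly_eq, hp.charpoly_eq, mul_comm])
    have := Filtered.ext _ _ _ _ _ _ _ _ (q - p) p hext hsub hp
    rwa [Nat.sub_add_cancel hpq] at this

/-- A filtered tuple has a basis in which it is block upper triangular with the diagonal
blocks `C`. -/
theorem Filtered.exists_basis {m : Type} [Fintype m] (c : Basis m ℂ L) {q : ℕ}
    (h : Filtered C q V A) :
    ∃ (ι : Type) (_ : Fintype ι) (_ : LinearOrder ι) (b : Basis (ι × m) ℂ V),
      Fintype.card ι = q ∧
      (∀ j x y, y.1 < x.1 → b.repr (A j (b y)) x = 0) ∧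
      ∀ j i s t, b.repr (A j (b (i, t))) (i, s) = c.repr (C j (c t)) s := by
  induction h with
  | zero V A h =>
    exact ⟨Fin 0, inferInstance, inferInstance, Basis.empty V, by simp,
      fun j x => x.1.elim0, fun j i => i.elim0⟩
  | equiv V A e h =>
    refine ⟨Fin 1, inferInstance, inferInstance,
      (c.map e).reindex (Equiv.uniqueProd m (Fin 1)).symm, by simp,
      fun j x y hxy => absurd hxy (by rw [Subsingleton.elim x.1 y.1]; exact lt_irrefl _), ?_⟩
    intro j i s t
    have := LinearMap.congr_fun (h j) (c t)
    simp only [LinearMap.comp_apply, LinearEquiv.coe_coe] at this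
    simp [this]
  | ext U V W A M B i π p q h hA hB ihA ihB =>
    obtain ⟨ι₁, _, _, b₁, hc₁, ht₁, hd₁⟩ := ihA
    obtain ⟨ι₂, _, _, b₂, hc₂, ht₂, hd₂⟩ := ihB
    obtain ⟨⟨s, ρ, hs⟩, hi, hπ⟩ := h
    let e : ((ι₁ × m) ⊕ (ι₂ × m)) ≃ (ι₁ ⊕ₗ ι₂) × m :=
      (Equiv.sumProdDistrib ι₁ ι₂ m).symm.trans (Equiv.prodCongr toLex (Equiv.refl m))
    let b := ((b₁.prod b₂).map hs.equiv.symm).reindex e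
    have e1 : ∀ x t, b (toLex (Sum.inl x), t) = i (b₁ (x, t)) := fun x t => by
      simp [b, SplitExact.equiv, e]
    have e2 : ∀ x t, b (toLex (Sum.inr x), t) = s (b₂ (x, t)) := fun x t => by
      simp [b, SplitExact.equiv, e]
    have r1 : ∀ v x t, b.repr v (toLex (Sum.inl x), t) = b₁.repr (ρ v) (x, t) := fun v x t => by
      rw [Basis.repr_reindex_apply]
      exact Basis.prod_repr_inl b₁ b₂ (hs.equiv v) (x, t)
    have r2 : ∀ v x t, b.repr v (toLex (Sum.inr x), t) = b₂.repr (π v) (x, t) := fun v x t => by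
      rw [Basis.repr_reindex_apply]
      exact Basis.prod_repr_inr b₁ b₂ (hs.equiv v) (x, t)
    have c1 : ∀ j u, M j (i u) = i (A j u) := fun j u => LinearMap.congr_fun (hi j) u
    have c2 : ∀ j v, π (M j v) = B j (π v) := fun j v => (LinearMap.congr_fun (hπ j) v).symm
    -- The lexicographic sum places the indices of the subspace before those of the quotient, so the
    -- form is upper triangular.
    refine ⟨ι₁ ⊕ₗ ι₂, inferInstanceAs (Fintype (ι₁ ⊕ ι₂)), inferInstance, b, ?_, ?_, ?_⟩
    · rw [← hc₁, ← hc₂]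
      exact Fintype.card_sum
    · rintro j ⟨x, t⟩ ⟨y, t'⟩ hxy
      induction x using Lex.rec with | _ x =>
      induction y using Lex.rec with | _ y =>
      rcases x with x | x <;> rcases y with y | y
      · rw [e1, r1, c1, hs.retract]
        exact ht₁ j _ _ (Sum.Lex.inl_lt_inl_iff.1 hxy)
      · exact absurd hxy Sum.Lex.not_inr_lt_inl
      · rw [e1, r2, c1, hs.comp_zero]; simp
      · rw [e2, r2, c2, hs.section_eq]
        exact ht₂ j _ _ (Sum.Lex.inr_lt_inr_iff.1 hxy)
    · intro j x t t'
      induction x using Lex.rec with | _ x =>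
      rcases x with x | x
      · rw [e1, r1, c1, hs.retract, hd₁]
      · rw [e2, r2, c2, hs.section_eq, hd₂]

end Filtration

/-! ### Kernels of split surjections in coordinates -/

section Splitting

/-- The kernel of a surjection with a chosen section, as a direct summand in coordinates. -/
theorem exists_split_kernel {ι : Type*} [Fintype ι] [DecidableEq ι] {a n : ℕ}
    (S : Matrix (Fin a) ι ℂ) (T : Matrix ι (Fin a) ℂ) (h : S * T = 1)
    (hcard : Fintype.card ι = n + a) :
    ∃ (J : Matrix ι (Fin n) ℂ) (K : Matrix (Fin n) ι ℂ),
      J * K = 1 - T * S ∧ K * J = 1 ∧ S * J = 0 ∧ K * T = 0 := by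
  have hST : ∀ v, S.mulVec (T.mulVec v) = v := fun v => by
    rw [Matrix.mulVec_mulVec, h, Matrix.one_mulVec]
  let N := LinearMap.ker S.mulVecLin
  have hsurj : LinearMap.range S.mulVecLin = ⊤ :=
    LinearMap.range_eq_top.2 fun v => ⟨T.mulVec v, hST v⟩
  have hN : finrank ℂ N = n := by
    have := LinearMap.finrank_range_add_finrank_ker S.mulVecLin
    rw [hsurj, finrank_top, finrank_fin_fun, finrank_fintype_fun_eq_card, hcard] at this
    change _ + finrank ℂ N = _ at this
    omega
  let b := finBasisOfFinrankEq ℂ N hN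
  let pr : (ι → ℂ) →ₗ[ℂ] N := LinearMap.codRestrict N
    (LinearMap.id - T.mulVecLin ∘ₗ S.mulVecLin) fun v => by
      rw [LinearMap.mem_ker]
      simp only [LinearMap.sub_apply, map_sub, LinearMap.comp_apply, Matrix.mulVecLin_apply,
        LinearMap.id_apply, hST, sub_self]
  let j : (Fin n → ℂ) →ₗ[ℂ] (ι → ℂ) := N.subtype ∘ₗ b.equivFun.symm.toLinearMap
  let κ : (ι → ℂ) →ₗ[ℂ] (Fin n → ℂ) := b.equivFun.toLinearMap ∘ₗ pr
  have hpr : ∀ x : N, pr x = x := fun x => by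
    apply Subtype.ext
    simp [pr]
  have hjk : j ∘ₗ κ = LinearMap.id - T.mulVecLin ∘ₗ S.mulVecLin := by
    refine LinearMap.ext fun x => ?_
    simp [j, κ, pr]
  have hkj : κ ∘ₗ j = LinearMap.id := by
    refine LinearMap.ext fun x => ?_
    simp only [j, κ, LinearMap.comp_apply, LinearEquiv.coe_coe, Submodule.subtype_apply, hpr,
      LinearEquiv.apply_symm_apply, LinearMap.id_apply]
  have h1 : LinearMap.toMatrix' j * LinearMap.toMatrix' κ = 1 - T * S := by
    rw [← LinearMap.toMatrix'_comp, hjk, ← Matrix.mulVecLin_mul, map_sub, LinearMap.toMatrix'_id]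
    congr 1
    exact LinearMap.toMatrix'_toLin' _
  have h2 : LinearMap.toMatrix' κ * LinearMap.toMatrix' j = 1 := by
    rw [← LinearMap.toMatrix'_comp, hkj, LinearMap.toMatrix'_id]
  refine ⟨LinearMap.toMatrix' j, LinearMap.toMatrix' κ, h1, h2, ?_, ?_⟩
  · calc S * LinearMap.toMatrix' j
        = S * (LinearMap.toMatrix' j * LinearMap.toMatrix' κ) * LinearMap.toMatrix' j := by
          rw [Matrix.mul_assoc, Matrix.mul_assoc, h2, Matrix.mul_one]
      _ = 0 := by
          rw [h1, Matrix.mul_sub, ← Matrix.mul_assoc, h, Matrix.one_mul, Matrix.mul_one, sub_self,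
            Matrix.zero_mul]
  · calc LinearMap.toMatrix' κ * T
        = LinearMap.toMatrix' κ * (LinearMap.toMatrix' j * LinearMap.toMatrix' κ) * T := by
          rw [← Matrix.mul_assoc, h2, Matrix.one_mul]
      _ = 0 := by
          rw [h1, Matrix.mul_assoc, Matrix.sub_mul, Matrix.mul_assoc, h, Matrix.mul_one,
            Matrix.one_mul, sub_self, Matrix.mul_zero]

/-- The version of `exists_split_kernel` for a decomposition into blocks of sizes `r j`. -/
theorem exists_split_kernel_blocks {k a n : ℕ} {r : Fin k → ℕ}
    (P : ∀ j, Matrix (Fin a) (Fin (r j)) ℂ) (T : ∀ j, Matrix (Fin (r j)) (Fin a) ℂ)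
    (h : ∑ j, P j * T j = 1) (hcard : ∑ j, r j = n + a) :
    ∃ (J : ∀ j, Matrix (Fin (r j)) (Fin n) ℂ) (K : ∀ j, Matrix (Fin n) (Fin (r j)) ℂ),
      ∑ j, K j * J j = 1 ∧ ∑ j, P j * J j = 0 ∧
      ∀ (b : ℕ) (Y : ∀ j, Matrix (Fin b) (Fin (r j)) ℂ) (j : Fin k),
        (∑ i, Y i * J i) * K j = Y j - (∑ i, Y i * T i) * P j := by
  let row {c : ℕ} (Z : ∀ j, Matrix (Fin c) (Fin (r j)) ℂ) :
    Matrix (Fin c) (Σ j, Fin (r j)) ℂ := Matrix.of fun v x => Z x.1 v x.2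
  let col {c : ℕ} (Z : ∀ j, Matrix (Fin (r j)) (Fin c) ℂ) :
    Matrix (Σ j, Fin (r j)) (Fin c) ℂ := Matrix.of fun x v => Z x.1 x.2 v
  have hrc : ∀ {c d : ℕ} (Y : ∀ j, Matrix (Fin c) (Fin (r j)) ℂ)
      (Z : ∀ j, Matrix (Fin (r j)) (Fin d) ℂ), row Y * col Z = ∑ j, Y j * Z j := by
    intro c d Y Z
    ext v w
    rw [Matrix.mul_apply, Fintype.sum_sigma, Matrix.sum_apply]
    rfl
  obtain ⟨J, K, h1, h2, h3, h4⟩ := exists_split_kernel (row P) (col T) (by rw [hrc, h])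
    (by simpa using hcard)
  let J' : ∀ j, Matrix (Fin (r j)) (Fin n) ℂ := fun j => Matrix.of fun s v => J ⟨j, s⟩ v
  let K' : ∀ j, Matrix (Fin n) (Fin (r j)) ℂ := fun j => Matrix.of fun v s => K v ⟨j, s⟩
  have hJ : col J' = J := rfl
  have hK : row K' = K := rfl
  refine ⟨J', K', ?_, ?_, ?_⟩
  · rw [← hrc, hJ, hK, h2]
  · rw [← hrc, hJ, h3]
  · intro b Y j
    have e1 : row Y * J * K = row Y - row Y * col T * row P := by
      rw [Matrix.mul_assoc, h1, Matrix.mul_sub, Matrix.mul_one, Matrix.mul_assoc]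
    rw [← hJ, hrc, hrc] at e1
    ext v s
    exact congrFun (congrFun e1 v) ⟨j, s⟩

end Splitting

/-! ### Additive and multiplicative reflections at the central vertex -/

section Reflection

variable {k n n' : ℕ} {r : Fin k → ℕ}

/-- The additive reflection. -/
theorem exists_additive_reflection (P : ∀ j, Matrix (Fin n') (Fin (r j)) ℂ)
    (Q : ∀ j, Matrix (Fin (r j)) (Fin n') ℂ) {c : ℂ} (hc : c ≠ 0)
    (h : ∑ j, P j * Q j = c • (1 : Mat n')) (hn : ∑ j, r j = n + n') :
    ∃ (P' : ∀ j, Matrix (Fin n) (Fin (r j)) ℂ) (Q' : ∀ j, Matrix (Fin (r j)) (Fin n) ℂ),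
      ∑ j, P' j * Q' j = (-c) • (1 : Mat n) ∧
      ∀ j, Q' j * P' j = Q j * P j - c • (1 : Mat (r j)) := by
  -- The relation says that `c⁻¹ Q` is a section of the row `P`. The new space of size `n` is the
  -- kernel of that row, with inclusion `J` and projection `K`.
  obtain ⟨J, K, h1, -, h3⟩ := exists_split_kernel_blocks (n := n) P (fun j => c⁻¹ • Q j)
    (by simp only [Matrix.mul_smul]
        rw [← Finset.smul_sum, h, smul_smul, inv_mul_cancel₀ hc, one_smul]) hn
  refine ⟨fun j => (-c) • K j, J, ?_, fun j => ?_⟩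
  · simp only [Matrix.smul_mul]
    rw [← Finset.smul_sum, h1]
  · have e1 := h3 (r j) (Pi.single (M := fun i => Matrix (Fin (r j)) (Fin (r i)) ℂ) j 1) j
    have e2 : ∀ {d : ℕ} (Z : ∀ i, Matrix (Fin (r i)) (Fin d) ℂ),
        ∑ i, (Pi.single (M := fun i => Matrix (Fin (r j)) (Fin (r i)) ℂ) j 1) i * Z i = Z j := by
      intro d Z
      rw [Finset.sum_eq_single j]
      · rw [Pi.single_eq_same, Matrix.one_mul]
      · intro i _ hi
        rw [Pi.single_eq_of_ne hi, Matrix.zero_mul]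
      · simp
    rw [e2, e2, Pi.single_eq_same] at e1
    rw [Matrix.mul_smul, e1, smul_sub, Matrix.smul_mul, smul_smul, neg_mul, mul_inv_cancel₀ hc]
    module

/-- The multiplicative reflection. -/
theorem exists_multiplicative_reflection (P : ∀ j, Matrix (Fin n') (Fin (r j)) ℂ)
    (Q : ∀ j, Matrix (Fin (r j)) (Fin n') ℂ) {q : ℂ} (hq0 : q ≠ 0) (hq : q ≠ 1)
    (h : (List.ofFn fun j => 1 + P j * Q j).prod = q • (1 : Mat n')) (hn : ∑ j, r j = n + n') :
    ∃ (P' : ∀ j, Matrix (Fin n) (Fin (r j)) ℂ) (Q' : ∀ j, Matrix (Fin (r j)) (Fin n) ℂ),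
      (List.ofFn fun j => 1 + P' j * Q' j).prod = q⁻¹ • (1 : Mat n) ∧
      ∀ j, Q' j * P' j = q⁻¹ • (1 + Q j * P j) - (1 : Mat (r j)) := by
  have hq1 : q - 1 ≠ 0 := sub_ne_zero.2 hq
  let T : ℕ → Mat n' := fun t => ((List.ofFn fun j => 1 + P j * Q j).drop t).prod
  have hTstep : ∀ j : Fin k, T j = T (j + 1) + P j * Q j * T (j + 1) := fun j => by
    simp only [T]
    rw [List.drop_eq_getElem_cons (by simp), List.prod_cons]
    simp [add_mul]
  have hT0 : T 0 = q • (1 : Mat n') := by simpa [T] using h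
  have hTk : T k = 1 := by
    simp only [T]
    rw [List.drop_of_length_le (by simp), List.prod_nil]
  -- Telescoping of the tail products `T`. The total is `q - 1 ≠ 0`, so the maps `(q - 1)⁻¹ Q j T (j
  -- + 1)` form a section of the row `P`.
  have htel : ∀ j : ℕ, j ≤ k →
      ∑ i : Fin k, (if (i : ℕ) < j then P i * (Q i * T (i + 1)) else 0) = T 0 - T j := by
    intro j
    induction j with
    | zero => intro _; simp
    | succ j ih =>
      intro hj
      have e1 : ∀ i : Fin k, (if (i : ℕ) < j + 1 then P i * (Q i * T (i + 1)) else 0) =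
          (if (i : ℕ) < j then P i * (Q i * T (i + 1)) else 0) +
            (if i = ⟨j, hj⟩ then P i * (Q i * T (i + 1)) else 0) := fun i => by
        rcases lt_trichotomy (i : ℕ) j with h | h | h
        · have h2 : i ≠ ⟨j, hj⟩ := fun h' => by simp [h'] at h
          rw [if_pos (by omega), if_pos h, if_neg h2, add_zero]
        · have h2 : i = ⟨j, hj⟩ := Fin.ext h
          rw [if_pos (by omega), if_neg (by omega), if_pos h2, zero_add]
        · have h2 : i ≠ ⟨j, hj⟩ := fun h' => by simp [h'] at h
          rw [if_neg (by omega), if_neg (by omega), if_neg h2, add_zero]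
      rw [Finset.sum_congr rfl fun i _ => e1 i, Finset.sum_add_distrib, ih (by omega),
        Finset.sum_ite_eq' Finset.univ (⟨j, hj⟩ : Fin k), if_pos (Finset.mem_univ _)]
      have := hTstep ⟨j, hj⟩
      simp only at this
      rw [this, ← Matrix.mul_assoc]
      abel
  have hall : ∑ i, P i * (Q i * T (i + 1)) = (q - 1) • (1 : Mat n') := by
    have := htel k le_rfl
    simp only [Fin.is_lt, if_true, hT0, hTk] at this
    rw [this, sub_smul, one_smul]
  obtain ⟨J, K, h1, h2, h3⟩ := exists_split_kernel_blocks (n := n) P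
    (fun j => (q - 1)⁻¹ • (Q j * T (j + 1)))
    (by simp only [Matrix.mul_smul]
        rw [← Finset.smul_sum, hall, smul_smul, inv_mul_cancel₀ hq1, one_smul]) hn
  -- The prescribed values of `Q' j * K i`. The factor `q⁻¹` for `i ≤ j` is chosen so that every row
  -- `Y j` kills the section (`hYT`) and that `Q' j` times the tail product after `j` equals `(q⁻¹ -
  -- 1) J j`.
  let Y : ∀ j i : Fin k, Matrix (Fin (r j)) (Fin (r i)) ℂ := fun j i =>
    (if i ≤ j then q⁻¹ else 1) • (Q j * P i) +
      (q⁻¹ - 1) • Pi.single (M := fun i => Matrix (Fin (r j)) (Fin (r i)) ℂ) j 1 i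
  have hsingle : ∀ (j : Fin k) {d : ℕ} (Z : ∀ i, Matrix (Fin (r i)) (Fin d) ℂ),
      ∑ i, (Pi.single (M := fun i => Matrix (Fin (r j)) (Fin (r i)) ℂ) j 1) i * Z i = Z j := by
    intro j d Z
    rw [Finset.sum_eq_single j]
    · rw [Pi.single_eq_same, Matrix.one_mul]
    · intro i _ hi
      rw [Pi.single_eq_of_ne hi, Matrix.zero_mul]
    · simp
  have hY : ∀ (j : Fin k) {d : ℕ} (Z : ∀ i, Matrix (Fin (r i)) (Fin d) ℂ),
      ∑ i, Y j i * Z i = Q j * (∑ i, P i * Z i) +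
        (q⁻¹ - 1) • (Q j * ∑ i, if i ≤ j then P i * Z i else 0) + (q⁻¹ - 1) • Z j := by
    intro j d Z
    simp only [Y, Matrix.add_mul, Finset.sum_add_distrib, Matrix.smul_mul]
    rw [← Finset.smul_sum, hsingle]
    congr 1
    rw [Matrix.mul_sum, Matrix.mul_sum, Finset.smul_sum, ← Finset.sum_add_distrib]
    refine Finset.sum_congr rfl fun i _ => ?_
    split_ifs with hij
    · rw [Matrix.mul_assoc]; module
    · rw [Matrix.mul_assoc]; simp
  have hYT : ∀ j, ∑ i, Y j i * ((q - 1)⁻¹ • (Q i * T (i + 1))) = 0 := by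
    intro j
    simp only [Matrix.mul_smul]
    rw [← Finset.smul_sum, hY, hall]
    have e1 := htel (j + 1) (by omega)
    have e2 : (∑ i : Fin k, if i ≤ j then P i * (Q i * T (i + 1)) else 0) = T 0 - T (j + 1) := by
      rw [← e1]
      refine Finset.sum_congr rfl fun i _ => ?_
      simp only [Fin.le_def, Nat.lt_succ_iff]
    rw [e2, hT0, Matrix.mul_sub]
    simp only [Matrix.mul_smul, Matrix.mul_one]
    have e3 : (q⁻¹ - 1) * q = 1 - q := by field_simp
    rw [smul_sub, smul_smul, e3]
    module
  let Q' : ∀ j, Matrix (Fin (r j)) (Fin n) ℂ := fun j => ∑ i, Y j i * J i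
  have hQK : ∀ j i, Q' j * K i = Y j i := fun j i => by
    simp only [Q']
    rw [h3, hYT, Matrix.zero_mul, sub_zero]
  have hYdiag : ∀ j, Y j j = q⁻¹ • (1 + Q j * P j) - (1 : Mat (r j)) := fun j => by
    simp only [Y, le_refl, if_true, Pi.single_eq_same]
    module
  refine ⟨K, Q', ?_, fun j => by rw [hQK, hYdiag]⟩
  let G : ℕ → Mat n := fun t => ((List.ofFn fun j => 1 + K j * Q' j).drop t).prod
  -- Induction from the last factor backwards. For `t = k` the sum of the `K i * J i` is the
  -- identity, which leaves `1 + (q⁻¹ - 1) = q⁻¹`.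
  have hG : ∀ t, t ≤ k → G (k - t) =
      1 + (q⁻¹ - 1) • ∑ i : Fin k, if k - t ≤ (i : ℕ) then K i * J i else 0 := by
    intro t
    induction t with
    | zero =>
      intro _
      have : ∀ i : Fin k, ¬ (k ≤ (i : ℕ)) := fun i => by omega
      simp only [G, Nat.sub_zero, this, if_false, Finset.sum_const_zero, smul_zero, add_zero]
      rw [List.drop_of_length_le (by simp), List.prod_nil]
    | succ t ih =>
      intro ht
      have ih := ih (by omega)
      let j : Fin k := ⟨k - (t + 1), by omega⟩
      have hjv : (j : ℕ) = k - (t + 1) := rfl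
      have e0 : k - t = (j : ℕ) + 1 := by omega
      rw [← hjv]
      rw [e0] at ih
      have e1 : G j = (1 + K j * Q' j) * G (j + 1) := by
        simp only [G]
        rw [List.drop_eq_getElem_cons (by simp), List.prod_cons]
        simp
      have e2 : Q' j * G (j + 1) = (q⁻¹ - 1) • J j := by
        rw [ih, Matrix.mul_add, Matrix.mul_one, Matrix.mul_smul, Matrix.mul_sum]
        have e3 : ∀ i : Fin k, Q' j * (if (j : ℕ) + 1 ≤ (i : ℕ) then K i * J i else 0) =
            Q j * (if i ≤ j then 0 else P i * J i) := fun i => by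
          by_cases hij : i ≤ j
          · have hij' : (i : ℕ) ≤ j := hij
            rw [if_neg (by omega), if_pos hij, Matrix.mul_zero, Matrix.mul_zero]
          · have hij' : ¬ (i : ℕ) ≤ j := hij
            have hne : i ≠ j := fun h => hij h.le
            rw [if_pos (by omega), if_neg hij, ← Matrix.mul_assoc, hQK]
            simp only [Y, if_neg hij]
            rw [Pi.single_eq_of_ne hne, one_smul, smul_zero, add_zero, Matrix.mul_assoc]
        rw [Finset.sum_congr rfl fun i _ => e3 i, ← Matrix.mul_sum]
        have e4 : Q' j = (q⁻¹ - 1) • (Q j * ∑ i, if i ≤ j then P i * J i else 0) +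
            (q⁻¹ - 1) • J j := by
          simp only [Q']
          rw [hY, h2, Matrix.mul_zero, zero_add]
        have e5 : (∑ i, if i ≤ j then P i * J i else 0) + (∑ i, if i ≤ j then 0 else P i * J i)
            = 0 := by
          rw [← Finset.sum_add_distrib]
          refine Eq.trans (Finset.sum_congr rfl fun i _ => ?_) h2
          split_ifs <;> simp
        rw [eq_neg_of_add_eq_zero_right e5, e4, Matrix.mul_neg]
        module
      rw [e1, add_mul, one_mul, Matrix.mul_assoc, e2, ih, Matrix.mul_smul, add_assoc, ← smul_add]
      congr 2
      have e6 : K j * J j = ∑ i, if i = j then K i * J i else 0 := by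
        rw [Finset.sum_ite_eq' Finset.univ j, if_pos (Finset.mem_univ _)]
      rw [e6, ← Finset.sum_add_distrib]
      refine Finset.sum_congr rfl fun i _ => ?_
      rcases lt_trichotomy (i : ℕ) j with h | h | h
      · have h2 : i ≠ j := fun h' => by simp [h'] at h
        rw [if_neg (by omega), if_neg h2, if_neg (by omega), add_zero]
      · have h2 : i = j := Fin.ext h
        rw [if_neg (by omega), if_pos h2, if_pos (by omega), zero_add]
      · have h2 : i ≠ j := fun h' => by simp [h'] at h
        rw [if_pos (by omega), if_neg h2, if_pos (by omega), add_zero]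
  have := hG k le_rfl
  simp only [Nat.sub_self, Nat.zero_le, if_true, h1, G, List.drop_zero] at this
  rw [this]
  module

end Reflection

/-! ### Arms: chains of factorizations encoding eigenvalues with multiplicities -/

/-- `HasArm [(x₁, m₁), …, (x_s, m_s)] A`: there is a chain of maps `ℂ^n ⇄ ℂ^(n - m₁) ⇄ ⋯ ⇄ 0`
which factors `A - x₁`, then the induced map minus `x₂`, and so on. If the `x_i` are distinct, this
means that `A` is diagonalizable with the eigenvalues `x_i` of multiplicities `m_i`. -/
def HasArm : List (ℂ × ℕ) → ∀ {n : ℕ}, Mat n → Prop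
  | [], n, _ => n = 0
  | y :: L, n, A => ∃ (r : ℕ) (P : Matrix (Fin n) (Fin r) ℂ) (Q : Matrix (Fin r) (Fin n) ℂ),
      r + y.2 = n ∧ A - y.1 • (1 : Mat n) = P * Q ∧ HasArm L (Q * P + y.1 • (1 : Mat r))

theorem HasArm.affine {L : List (ℂ × ℕ)} (a b : ℂ) {n : ℕ} {A : Mat n} (h : HasArm L A) :
    HasArm (L.map fun y => (a * y.1 + b, y.2)) (a • A + b • (1 : Mat n)) := by
  induction L generalizing n with
  | nil => exact h
  | cons y L ih =>
    obtain ⟨r, P, Q, hr, hPQ, hL⟩ := h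
    refine ⟨r, a • P, Q, hr, ?_, ?_⟩
    · rw [Matrix.smul_mul, ← hPQ]
      module
    · have := ih hL
      convert! this using 1
      rw [Matrix.mul_smul]
      module

/-- The direct sum of a matrix with a scalar matrix. -/
def dirSum {n : ℕ} (d : ℕ) (A : Mat n) (x : ℂ) : Mat (n + d) :=
  Matrix.reindexAlgEquiv ℂ ℂ finSumFinEquiv (Matrix.fromBlocks A 0 0 (x • (1 : Mat d)))

theorem fromBlocks_sub_fromBlocks {l m n o : Type*} (A A' : Matrix n l ℂ) (B B' : Matrix n m ℂ)
    (C C' : Matrix o l ℂ) (D D' : Matrix o m ℂ) :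
    Matrix.fromBlocks A B C D - Matrix.fromBlocks A' B' C' D' =
      Matrix.fromBlocks (A - A') (B - B') (C - C') (D - D') := by
  ext (i | i) (j | j) <;> rfl

theorem dirSum_sub {n d : ℕ} (A : Mat n) (x y : ℂ) :
    dirSum d A x - y • (1 : Mat (n + d)) = dirSum d (A - y • (1 : Mat n)) (x - y) := by
  have h : (1 : Mat (n + d)) = Matrix.reindexAlgEquiv ℂ ℂ finSumFinEquiv 1 := by rw [map_one]
  rw [dirSum, h, ← map_smul, ← map_sub, dirSum]
  congr 1
  rw [← Matrix.fromBlocks_one, Matrix.fromBlocks_smul, fromBlocks_sub_fromBlocks]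
  congr 1 <;> simp [sub_smul]

/-- Extension of the rows by zero. -/
def padRows {n r : ℕ} (d : ℕ) (P : Matrix (Fin n) (Fin r) ℂ) : Matrix (Fin (n + d)) (Fin r) ℂ :=
  (Matrix.fromRows P (0 : Matrix (Fin d) (Fin r) ℂ)).submatrix finSumFinEquiv.symm id

/-- Extension of the columns by zero. -/
def padCols {n r : ℕ} (d : ℕ) (Q : Matrix (Fin r) (Fin n) ℂ) : Matrix (Fin r) (Fin (n + d)) ℂ :=
  (Matrix.fromCols Q (0 : Matrix (Fin r) (Fin d) ℂ)).submatrix id finSumFinEquiv.symm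

theorem padCols_mul_padRows {n r s : ℕ} (d : ℕ) (Q : Matrix (Fin r) (Fin n) ℂ)
    (P : Matrix (Fin n) (Fin s) ℂ) : padCols d Q * padRows d P = Q * P := by
  rw [padCols, padRows, Matrix.submatrix_mul_equiv, Matrix.fromCols_mul_fromRows]
  simp

theorem padRows_mul_padCols {n r : ℕ} (d : ℕ) (P : Matrix (Fin n) (Fin r) ℂ)
    (Q : Matrix (Fin r) (Fin n) ℂ) : padRows d P * padCols d Q = dirSum d (P * Q) 0 := by
  rw [padCols, padRows, ← Matrix.submatrix_mul _ _ _ _ _ Function.bijective_id,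
    Matrix.fromRows_mul_fromCols, dirSum]
  simp [Matrix.coe_reindexAlgEquiv]

/-- Padding `P` and `Q` by zeros leaves `Q * P` unchanged, so only the first multiplicity grows. -/
theorem HasArm.dirSum {x : ℂ} {m d n : ℕ} {L : List (ℂ × ℕ)} {A : Mat n}
    (h : HasArm ((x, m) :: L) A) : HasArm ((x, m + d) :: L) (dirSum d A x) := by
  obtain ⟨r, P, Q, hr, hPQ, hL⟩ := h
  simp only at hr hPQ hL
  refine ⟨r, padRows d P, padCols d Q, by simp only; omega, ?_, ?_⟩
  · simp only
    rw [dirSum_sub, hPQ, padRows_mul_padCols, sub_self]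
  · simp only
    rw [padCols_mul_padRows]
    exact hL

/-- Reflection at an inner vertex of the arm, where the relation is `Q₁ P₁ - P₂ Q₂ = x - y`. If `x =
y` there is no reflection and the middle space is enlarged by zero padding, which is where the order
of the multiplicities enters. -/
theorem HasArm.swap {y x : ℂ × ℕ} {L : List (ℂ × ℕ)} (hm : x.2 ≤ y.2) {n : ℕ} {A : Mat n}
    (h : HasArm (y :: x :: L) A) : HasArm (x :: y :: L) A := by
  obtain ⟨y, my⟩ := y
  obtain ⟨x, mx⟩ := x
  obtain ⟨r, P₁, Q₁, hr, hPQ₁, s, P₂, Q₂, hs, hPQ₂, hL⟩ := h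
  simp only at hr hPQ₁ hs hPQ₂ hL hm
  by_cases hxy : x = y
  · subst hxy
    obtain ⟨d, rfl⟩ := Nat.exists_eq_add_of_le hm
    refine ⟨r + d, padCols d P₁, padRows d Q₁, by simp only; omega, ?_, s, padRows d P₂,
      padCols d Q₂, by simp only; omega, ?_, ?_⟩
    · rw [padCols_mul_padRows]; exact hPQ₁
    · simp only
      rw [padRows_mul_padCols, padRows_mul_padCols, ← hPQ₂, add_sub_cancel_right,
        add_sub_cancel_right]
    · simp only
      rw [padCols_mul_padRows]
      exact hL
  · have hκ : x - y ≠ 0 := sub_ne_zero.2 hxy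
    set κ := x - y with hκdef
    have hrel : Q₁ * P₁ - P₂ * Q₂ = κ • (1 : Mat r) := by
      rw [← hPQ₂, hκdef]; module
    -- The row `(Q₁, -P₂)` is split because `κ ≠ 0`. Its kernel, of dimension `n + s - r = n - mx`,
    -- is the new middle space.
    obtain ⟨J, K, h1, h2, h3, h4⟩ := exists_split_kernel (n := n + s - r)
      (Matrix.fromCols Q₁ (-P₂)) (κ⁻¹ • Matrix.fromRows P₁ Q₂)
      (by rw [Matrix.mul_smul, Matrix.fromCols_mul_fromRows, Matrix.neg_mul, ← sub_eq_add_neg,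
            hrel, smul_smul, inv_mul_cancel₀ hκ, one_smul])
      (by simp; omega)
    have hJ := Matrix.fromRows_toRows J
    have hK := Matrix.fromCols_toCols K
    set J₁ := J.toRows₁
    set J₂ := J.toRows₂
    set K₁ := K.toCols₁
    set K₂ := K.toCols₂
    rw [← hJ, ← hK, Matrix.fromRows_mul_fromCols, Matrix.smul_mul, Matrix.fromRows_mul_fromCols,
      ← Matrix.fromBlocks_one, Matrix.fromBlocks_smul, fromBlocks_sub_fromBlocks,
      Matrix.fromBlocks_inj] at h1
    rw [← hJ, ← hK, Matrix.fromCols_mul_fromRows] at h2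
    obtain ⟨h11, -, -, h22⟩ := h1
    refine ⟨n + s - r, (-κ) • J₁, K₁, by simp only; omega, ?_, s, κ • K₂, J₂,
      by simp only; omega, ?_, ?_⟩
    · simp only
      rw [Matrix.smul_mul, h11, ← hPQ₁, smul_sub, smul_smul, neg_mul, mul_inv_cancel₀ hκ, hκdef]
      module
    · simp only
      have : K₂ * J₂ = 1 - K₁ * J₁ := by rw [← h2]; abel
      rw [Matrix.mul_smul, Matrix.smul_mul, this, hκdef]
      module
    · simp only
      rw [Matrix.mul_smul, h22, Matrix.mul_neg, smul_neg, sub_neg_eq_add, smul_add, smul_smul,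
        mul_inv_cancel₀ hκ, one_smul]
      convert! hL using 1
      rw [hκdef]
      module

/-- The reflection acts on the head of each arm, while `Ψ` picks an eigenvalue of largest
multiplicity anywhere in the list; this restores the order. -/
theorem HasArm.move {y : ℂ × ℕ} {L₁ L₂ : List (ℂ × ℕ)} (hm : ∀ x ∈ L₁, x.2 ≤ y.2) {n : ℕ}
    {A : Mat n} (h : HasArm (y :: (L₁ ++ L₂)) A) : HasArm (L₁ ++ y :: L₂) A := by
  induction L₁ generalizing n with
  | nil => exact h
  | cons x L₁ ih =>
    obtain ⟨r, P, Q, hr, hPQ, hL⟩ := HasArm.swap (hm x (by simp)) h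
    exact ⟨r, P, Q, hr, hPQ, ih (fun z hz => hm z (by simp [hz])) hL⟩

/-- An entry of multiplicity 0 is passed by factoring through the identity; the one entry of
multiplicity 1 carries the scalar and drops to size 0. -/
theorem hasArm_scalar_one {x : ℂ} {L : List (ℂ × ℕ)} (h : (L.map Prod.snd).sum = 1)
    (hx : (L.map fun y => (y.2 : ℂ) * y.1).sum = x) : HasArm L (x • (1 : Mat 1)) := by
  induction L with
  | nil => simp at h
  | cons y L ih =>
    obtain ⟨y, m⟩ := y
    simp only [List.map_cons, List.sum_cons] at h hx
    rcases Nat.eq_zero_or_pos m with hm | hm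
    · subst hm
      refine ⟨1, 1, (x - y) • 1, rfl, ?_, ?_⟩
      · simp only
        rw [Matrix.one_mul]; module
      · simp only
        have := ih (by omega) (by simpa using hx)
        convert! this using 1
        rw [Matrix.mul_one]; module
    · have hm1 : m = 1 := by omega
      subst hm1
      have h0 : (L.map Prod.snd).sum = 0 := by omega
      have hz : ∀ z ∈ L, z.2 = 0 := fun z hz =>
        List.sum_eq_zero_iff.1 h0 _ (List.mem_map_of_mem hz)
      have hx0 : (L.map fun y => (y.2 : ℂ) * y.1).sum = 0 := by
        apply List.sum_eq_zero
        intro w hw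
        obtain ⟨z, hzL, rfl⟩ := List.mem_map.1 hw
        simp [hz z hzL]
      rw [hx0] at hx
      have hxy : x = y := by rw [← hx]; simp
      subst hxy
      refine ⟨0, 0, 0, rfl, by simp, ?_⟩
      simp only
      have : ∀ (L : List (ℂ × ℕ)) (B : Mat 0), (∀ z ∈ L, z.2 = 0) → HasArm L B := by
        intro L
        induction L with
        | nil => intro B _; rfl
        | cons z L ih =>
          intro B h
          exact ⟨0, 0, 0, by rw [h z (by simp)], Subsingleton.elim _ _,
            ih _ fun w hw => h w (by simp [hw])⟩
      exact this L _ hz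

open Polynomial in
-- The characteristic polynomials of `P * Q` and `Q * P` differ by the power of the variable given
-- by the difference of sizes.
theorem HasArm.charpoly_eq {L : List (ℂ × ℕ)} {n : ℕ} {A : Mat n} (h : HasArm L A) :
    A.charpoly = (L.map fun y => (X - C y.1) ^ y.2).prod := by
  induction L generalizing n with
  | nil =>
    have : n = 0 := h
    subst this
    simp [Matrix.charpoly]
  | cons y L ih =>
    obtain ⟨r, P, Q, hr, hPQ, hL⟩ := h
    have key : ∀ {m : ℕ} (B : Mat m) (x : ℂ),
        (B + x • (1 : Mat m)).charpoly = B.charpoly.comp (X - C x) := by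
      intro m B x
      have := Matrix.charpoly_sub_scalar B (-x)
      rw [map_neg, sub_neg_eq_add, Matrix.scalar_apply, ← Matrix.smul_one_eq_diagonal] at this
      rw [this, map_neg, sub_eq_add_neg]
    have hA : A = P * Q + y.1 • (1 : Mat n) := by rw [← hPQ]; abel
    rw [List.map_cons, List.prod_cons, ← ih hL, hA, key, key,
      Matrix.charpoly_mul_comm_of_le P Q (by simp; omega)]
    simp only [mul_comp, Fintype.card_fin, pow_comp, X_comp]
    congr 2
    omega

/-- From `A - x = P Q` and `Q f(A) = f(Q P + x) Q` for polynomials `f`, each arrow of the arm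
contributes one linear factor. -/
theorem HasArm.prod_sub_eq_zero {L : List (ℂ × ℕ)} {n : ℕ} {A : Mat n} (h : HasArm L A) :
    Polynomial.aeval A (L.map fun y => Polynomial.X - Polynomial.C y.1).prod = 0 := by
  induction L generalizing n with
  | nil =>
    have : n = 0 := h
    subst this
    exact Subsingleton.elim _ _
  | cons y L ih =>
    obtain ⟨r, P, Q, hr, hPQ, hL⟩ := h
    have hcomm : ∀ p : Polynomial ℂ, Q * Polynomial.aeval A p =
        Polynomial.aeval (Q * P + y.1 • (1 : Mat r)) p * Q := by
      have hA : A = P * Q + y.1 • (1 : Mat n) := by rw [← hPQ]; abel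
      have h1 : Q * A = (Q * P + y.1 • (1 : Mat r)) * Q := by
        rw [hA, Matrix.mul_add, Matrix.add_mul, Matrix.mul_assoc]
        simp
      intro p
      induction p using Polynomial.induction_on' with
      | add p q hp hq => rw [map_add, map_add, Matrix.mul_add, Matrix.add_mul, hp, hq]
      | monomial k a =>
        rw [Polynomial.aeval_monomial, Polynomial.aeval_monomial, Algebra.algebraMap_eq_smul_one,
          Algebra.algebraMap_eq_smul_one, smul_mul_assoc, smul_mul_assoc, one_mul, one_mul,
          Matrix.mul_smul, Matrix.smul_mul]
        congr 1
        induction k with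
        | zero => simp
        | succ k ih => rw [pow_succ, pow_succ, ← Matrix.mul_assoc, ih, Matrix.mul_assoc, h1,
            Matrix.mul_assoc]
    rw [List.map_cons, List.prod_cons, map_mul, map_sub, Polynomial.aeval_X, Polynomial.aeval_C,
      Algebra.algebraMap_eq_smul_one, hPQ]
    rw [Matrix.mul_assoc, hcomm, ih hL, Matrix.zero_mul, Matrix.mul_zero]

theorem hasEigenbasis_of_isSemisimple {V : Type} [AddCommGroup V] [Module ℂ V]
    [FiniteDimensional ℂ V] {f : End ℂ V} (h : f.IsSemisimple) : HasEigenbasis f := by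
  classical
  have hint : DirectSum.IsInternal fun μ => f.eigenspace μ :=
    (DirectSum.isInternal_submodule_iff_iSupIndep_and_iSup_eq_top _).2
      ⟨f.eigenspaces_iSupIndep, h.iSup_eigenspace_eq_top⟩
  let b := hint.collectedBasis fun μ => finBasis ℂ (f.eigenspace μ)
  have : Fintype (Σ μ : ℂ, Fin (finrank ℂ (f.eigenspace μ))) :=
    FiniteDimensional.fintypeBasisIndex b
  refine ⟨_, this, b, fun x => x.1, fun x => ?_⟩
  exact End.mem_eigenspace_iff.1 (hint.collectedBasis_mem _ x)

/-- With distinct eigenvalues, the annihilating product of linear factors is squarefree. -/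
theorem HasArm.hasEigenbasis {L : List (ℂ × ℕ)} {n : ℕ} {A : Mat n} (h : HasArm L A)
    (hL : (L.map Prod.fst).Nodup) : HasEigenbasis (Matrix.toLin' A) := by
  apply hasEigenbasis_of_isSemisimple
  apply End.isSemisimple_of_squarefree_aeval_eq_zero
    (p := (L.map fun y => Polynomial.X - Polynomial.C y.1).prod)
  · have : (L.map fun y => Polynomial.X - Polynomial.C y.1) =
        (L.map Prod.fst).map fun x => Polynomial.X - Polynomial.C x := by simp
    rw [this, ← List.prod_toFinset _ hL]
    apply Polynomial.Separable.squarefree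
    exact Polynomial.separable_prod_X_sub_C_iff'.2 (fun x _ y _ hxy => hxy)
  · have := congrArg (Matrix.toLinAlgEquiv' (R := ℂ)) h.prod_sub_eq_zero
    rw [map_zero, ← Polynomial.aeval_algHom_apply] at this
    exact this

/-! ### Undoing one step of `Ψ` -/

section Steps

variable {k : ℕ}

/-- The sum (`mul = false`) or the product (`mul = true`) of a tuple of matrices. -/
def total (mul : Bool) {n : ℕ} (A : Fin k → Mat n) : Mat n :=
  if mul then (List.ofFn A).prod else ∑ j, A j

/-- The condition on the eigenvalues imposed by the trace, resp. determinant. -/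
def WeightCond (mul : Bool) (L : Fin k → List (ℂ × ℕ)) (c : ℂ) (n : ℕ) : Prop :=
  if mul then c ≠ 0 ∧ (∀ j, ∀ y ∈ L j, y.1 ≠ 0) ∧
    ∏ j, ((L j).map fun y => y.1 ^ y.2).prod = c ^ n
  else ∑ j, ((L j).map fun y => (y.2 : ℂ) * y.1).sum = n * c

theorem dirSum_zero {n d : ℕ} : dirSum d (0 : Mat n) 0 = 0 := by
  rw [dirSum, zero_smul, Matrix.fromBlocks_zero, map_zero]

theorem dirSum_add {n d : ℕ} (A B : Mat n) (x y : ℂ) :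
    dirSum d (A + B) (x + y) = dirSum d A x + dirSum d B y := by
  rw [dirSum, dirSum, dirSum, ← map_add, Matrix.fromBlocks_add]
  simp [add_smul]

theorem dirSum_smul_one {n d : ℕ} (c : ℂ) :
    dirSum d (c • (1 : Mat n)) c = c • (1 : Mat (n + d)) := by
  have h := dirSum_sub (d := d) (c • (1 : Mat n)) c c
  rw [sub_self, sub_self, dirSum_zero, sub_eq_zero] at h
  exact h

theorem dirSum_mul {n d : ℕ} (A B : Mat n) (x y : ℂ) :
    dirSum d (A * B) (x * y) = dirSum d A x * dirSum d B y := by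
  rw [dirSum, dirSum, dirSum, ← map_mul, Matrix.fromBlocks_multiply]
  simp [smul_smul, mul_comm]

theorem sum_dirSum {n d : ℕ} {ι : Type*} (s : Finset ι) (A : ι → Mat n) (x : ι → ℂ) :
    ∑ j ∈ s, dirSum d (A j) (x j) = dirSum d (∑ j ∈ s, A j) (∑ j ∈ s, x j) := by
  classical
  induction s using Finset.induction_on with
  | empty => simp [dirSum_zero]
  | insert a s ha ih => rw [Finset.sum_insert ha, Finset.sum_insert ha, Finset.sum_insert ha, ih,
      dirSum_add]

theorem list_prod_dirSum {n d : ℕ} {ι : Type*} (l : List ι) (A : ι → Mat n) (x : ι → ℂ) :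
    (l.map fun j => dirSum d (A j) (x j)).prod = dirSum d (l.map A).prod (l.map x).prod := by
  induction l with
  | nil =>
    have := dirSum_smul_one (n := n) (d := d) 1
    rw [one_smul, one_smul] at this
    simp [this]
  | cons a l ih => rw [List.map_cons, List.prod_cons, ih, List.map_cons, List.prod_cons,
      List.map_cons, List.prod_cons, dirSum_mul]

theorem list_prod_smul {R : Type*} [Ring R] [Algebra ℂ R] {ι : Type*} (l : List ι)
    (x : ι → ℂ) (A : ι → R) :
    (l.map fun j => x j • A j).prod = (l.map x).prod • (l.map A).prod := by
  induction l with
  | nil => simp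
  | cons a l ih => simp only [List.map_cons, List.prod_cons, ih, smul_mul_smul_comm]

theorem list_sum_affine (L : List (ℂ × ℕ)) (b : ℂ) :
    ((L.map fun y => (1 * y.1 + b, y.2)).map fun y => (y.2 : ℂ) * y.1).sum =
      (L.map fun y => (y.2 : ℂ) * y.1).sum + ((L.map Prod.snd).sum : ℕ) * b := by
  induction L with
  | nil => simp
  | cons y L ih =>
    simp only [List.map_cons, List.sum_cons, ih]
    push_cast
    ring

theorem list_prod_scale (L : List (ℂ × ℕ)) (a : ℂ) :
    ((L.map fun y => (a * y.1 + 0, y.2)).map fun y => y.1 ^ y.2).prod =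
      (L.map fun y => y.1 ^ y.2).prod * a ^ (L.map Prod.snd).sum := by
  induction L with
  | nil => simp
  | cons y L ih =>
    simp only [List.map_cons, List.prod_cons, ih, List.sum_cons]
    rw [add_zero, mul_pow, pow_add]
    ring

variable {n' δ : ℕ} {y : Fin k → ℂ × ℕ} {L : Fin k → List (ℂ × ℕ)} {c : ℂ}

/-- Subtracting `y j` from each matrix puts the tuple in the form `P j * Q j` with sum `c - ∑ y j`.
If that scalar is nonzero the additive reflection applies, and if it is zero a scalar summand of
size `δ` is added instead. -/
theorem exists_step_add (hδ : ∀ j, δ ≤ (y j).2)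
    (hsize : ∀ j, (y j).2 + ((L j).map Prod.snd).sum = n' + δ)
    (hsum : ∑ j, ((L j).map Prod.snd).sum = (n' + δ) + n')
    (hw : WeightCond false (fun j => y j :: L j) c (n' + δ)) :
    ∃ (c' : ℂ) (y' : Fin k → ℂ) (L' : Fin k → List (ℂ × ℕ)),
      (∀ j, (L' j).map Prod.snd = (L j).map Prod.snd) ∧
      WeightCond false (fun j => (y' j, (y j).2 - δ) :: L' j) c' n' ∧
      ∀ A' : Fin k → Mat n', total false A' = c' • (1 : Mat n') →
        (∀ j, HasArm ((y' j, (y j).2 - δ) :: L' j) (A' j)) →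
        ∃ A : Fin k → Mat (n' + δ), total false A = c • (1 : Mat (n' + δ)) ∧
          ∀ j, HasArm (y j :: L j) (A j) := by
  simp only [WeightCond, total, Bool.false_eq_true, if_false, List.map_cons, List.sum_cons]
    at hw ⊢
  by_cases hl : ∑ j, (y j).1 - c = 0
  · refine ⟨c, fun j => (y j).1, L, fun j => rfl, ?_, fun A' hA' hL' => ?_⟩
    · have h1 : ∀ j, (((y j).2 - δ : ℕ) : ℂ) = (y j).2 - δ := fun j => by
        rw [Nat.cast_sub (hδ j)]
      simp only [h1, sub_mul]
      have h2 : ∑ j, (((y j).2 : ℂ) * (y j).1 - δ * (y j).1 +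
          ((L j).map fun y => (y.2 : ℂ) * y.1).sum) =
          ∑ j, (((y j).2 : ℂ) * (y j).1 + ((L j).map fun y => (y.2 : ℂ) * y.1).sum) -
            δ * ∑ j, (y j).1 := by
        rw [Finset.mul_sum, ← Finset.sum_sub_distrib]
        exact Finset.sum_congr rfl fun j _ => by ring
      rw [h2, hw, sub_eq_zero.1 hl]
      push_cast
      ring
    · refine ⟨fun j => dirSum δ (A' j) (y j).1, ?_, fun j => ?_⟩
      · rw [sum_dirSum, hA', sub_eq_zero.1 hl, dirSum_smul_one]
      · have := (hL' j).dirSum (d := δ)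
        rwa [Nat.sub_add_cancel (hδ j)] at this
  · set l := ∑ j, (y j).1 - c with hldef
    -- The reflected matrix `P j * Q j` has the eigenvalue 0 at its head, and since `Q' P' = Q P -
    -- l` the other eigenvalues `z - y j` become `z - y j + l`.
    refine ⟨l, fun _ => 0, fun j => (L j).map fun z => (1 * z.1 + (l - (y j).1), z.2),
      fun j => by simp, ?_, fun A' hA' hL' => ?_⟩
    · simp only [list_sum_affine, mul_zero, zero_add]
      have h1 : ∀ j, (((L j).map Prod.snd).sum : ℂ) = n' + δ - (y j).2 := fun j => by
        rw [← Nat.cast_add, ← hsize j]; push_cast; ring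
      have h2 : ∀ j, ((L j).map fun y => (y.2 : ℂ) * y.1).sum +
          (((L j).map Prod.snd).sum : ℕ) * (l - (y j).1) =
          (((y j).2 : ℂ) * (y j).1 + ((L j).map fun y => (y.2 : ℂ) * y.1).sum) +
            ((((L j).map Prod.snd).sum : ℕ) : ℂ) * l - (n' + δ) * (y j).1 := fun j => by
        have h1 : ((((L j).map Prod.snd).sum : ℕ) : ℂ) = n' + δ - (y j).2 := by
          rw [← Nat.cast_add, ← hsize j]; push_cast; ring
        rw [h1]; ring
      rw [Finset.sum_congr rfl fun j _ => h2 j, Finset.sum_sub_distrib, Finset.sum_add_distrib, hw,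
        ← Finset.sum_mul, ← Nat.cast_sum, hsum, ← Finset.mul_sum]
      have h3 : ∑ j, (y j).1 = l + c := by rw [hldef]; ring
      rw [h3]
      push_cast
      ring
    · choose r P Q hr hPQ hL using hL'
      simp only [zero_smul, sub_zero, add_zero] at hr hPQ hL
      have hrL : ∀ j, r j = ((L j).map Prod.snd).sum := fun j => by
        have := hsize j; have := hr j; have := hδ j; omega
      obtain ⟨P', Q', h1, h2⟩ := exists_additive_reflection (n := n' + δ) P Q hl
        (by rw [← hA']; exact Finset.sum_congr rfl fun j _ => (hPQ j).symm)
        (by rw [← hsum]; exact Finset.sum_congr rfl fun j _ => hrL j)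
      refine ⟨fun j => P' j * Q' j + (y j).1 • 1, ?_, fun j => ⟨r j, P' j, Q' j, ?_, ?_, ?_⟩⟩
      · rw [Finset.sum_add_distrib, h1, ← Finset.sum_smul, ← add_smul, hldef]
        congr 1; ring
      · have := hr j; have := hδ j; omega
      · rw [add_sub_cancel_right]
      · have := (hL j).affine 1 ((y j).1 - l)
        rw [List.map_map] at this
        convert! this using 1
        · conv_lhs => rw [← List.map_id (L j)]
          refine List.map_congr_left fun z _ => ?_
          simp only [id, Function.comp_apply]
          ext1
          · simp only; ring
          · rfl
        · rw [h2]; module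

/-- The same with division by `y j` in place of subtraction: the normalized product is `q⁻¹` for `q
= (∏ y j) / c`, and `q = 1` is the case of a scalar summand. -/
theorem exists_step_mul (hδ : ∀ j, δ ≤ (y j).2)
    (hsize : ∀ j, (y j).2 + ((L j).map Prod.snd).sum = n' + δ)
    (hsum : ∑ j, ((L j).map Prod.snd).sum = (n' + δ) + n')
    (hw : WeightCond true (fun j => y j :: L j) c (n' + δ)) :
    ∃ (c' : ℂ) (y' : Fin k → ℂ) (L' : Fin k → List (ℂ × ℕ)),
      (∀ j, (L' j).map Prod.snd = (L j).map Prod.snd) ∧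
      WeightCond true (fun j => (y' j, (y j).2 - δ) :: L' j) c' n' ∧
      ∀ A' : Fin k → Mat n', total true A' = c' • (1 : Mat n') →
        (∀ j, HasArm ((y' j, (y j).2 - δ) :: L' j) (A' j)) →
        ∃ A : Fin k → Mat (n' + δ), total true A = c • (1 : Mat (n' + δ)) ∧
          ∀ j, HasArm (y j :: L j) (A j) := by
  simp only [WeightCond, total, if_true, List.map_cons, List.prod_cons] at hw ⊢
  obtain ⟨hc, hne, hw⟩ := hw
  have hy : ∀ j, (y j).1 ≠ 0 := fun j => hne j _ (by simp)
  have hLne : ∀ j, ∀ z ∈ L j, z.1 ≠ 0 := fun j z hz => hne j z (by simp [hz])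
  have hyprod : ∏ j, (y j).1 ≠ 0 := Finset.prod_ne_zero_iff.2 fun j _ => hy j
  by_cases hl : (∏ j, (y j).1) / c = 1
  · have hyc : ∏ j, (y j).1 = c := by rwa [div_eq_one_iff_eq hc] at hl
    refine ⟨c, fun j => (y j).1, L, fun j => rfl, ⟨hc, ?_, ?_⟩, fun A' hA' hL' => ?_⟩
    · intro j z hz
      rcases List.mem_cons.1 hz with rfl | hz
      · exact hy j
      · exact hLne j z hz
    · have h0 : (∏ j, (y j).1) ^ δ ≠ 0 := pow_ne_zero _ hyprod
      apply mul_left_cancel₀ h0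
      conv_rhs => rw [hyc, ← pow_add, add_comm δ, ← hw]
      rw [← Finset.prod_pow, ← Finset.prod_mul_distrib]
      refine Finset.prod_congr rfl fun j _ => ?_
      rw [← mul_assoc, ← pow_add, Nat.add_sub_cancel' (hδ j)]
    · refine ⟨fun j => dirSum δ (A' j) (y j).1, ?_, fun j => ?_⟩
      · rw [List.ofFn_eq_map] at hA' ⊢
        rw [list_prod_dirSum, hA', ← List.ofFn_eq_map, List.prod_ofFn, hyc, dirSum_smul_one]
      · have := (hL' j).dirSum (d := δ)
        rwa [Nat.sub_add_cancel (hδ j)] at this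
  · set q := (∏ j, (y j).1) / c with hqdef
    have hq0 : q ≠ 0 := div_ne_zero hyprod hc
    refine ⟨q, fun _ => 1, fun j => (L j).map fun z => (q / (y j).1 * z.1 + 0, z.2),
      fun j => by simp, ⟨hq0, ?_, ?_⟩, fun A' hA' hL' => ?_⟩
    · intro j z hz
      rcases List.mem_cons.1 hz with rfl | hz
      · exact one_ne_zero
      · obtain ⟨w, hwL, rfl⟩ := List.mem_map.1 hz
        simp only [add_zero]
        exact mul_ne_zero (div_ne_zero hq0 (hy j)) (hLne j w hwL)
    · simp only [list_prod_scale, one_pow, one_mul]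
      have h0 : (∏ j, (y j).1) ^ (n' + δ) ≠ 0 := pow_ne_zero _ hyprod
      apply mul_left_cancel₀ h0
      have h2 : ∀ j, (y j).1 ^ (n' + δ) * (((L j).map fun z => z.1 ^ z.2).prod *
          (q / (y j).1) ^ ((L j).map Prod.snd).sum) =
          ((y j).1 ^ (y j).2 * ((L j).map fun z => z.1 ^ z.2).prod) *
            q ^ ((L j).map Prod.snd).sum := fun j => by
        rw [← hsize j, pow_add, div_pow]
        have := pow_ne_zero ((L j).map Prod.snd).sum (hy j)
        field_simp
      rw [← Finset.prod_pow, ← Finset.prod_mul_distrib, Finset.prod_congr rfl fun j _ => h2 j,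
        Finset.prod_mul_distrib, hw, Finset.prod_pow_eq_pow_sum, hsum, pow_add q, ← mul_assoc,
        ← mul_pow, Finset.prod_pow, hqdef, mul_div_cancel₀ _ hc]
    · choose r P Q hr hPQ hL using hL'
      simp only [one_smul] at hr hPQ hL
      have hrL : ∀ j, r j = ((L j).map Prod.snd).sum := fun j => by
        have := hsize j; have := hr j; have := hδ j; omega
      have hA'' : ∀ j, 1 + P j * Q j = A' j := fun j => by rw [← hPQ]; abel
      obtain ⟨P', Q', h1, h2⟩ := exists_multiplicative_reflection (n := n' + δ) P Q hq0 hl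
        (by rw [← hA']; simp only [hA''])
        (by rw [← hsum]; exact Finset.sum_congr rfl fun j _ => hrL j)
      refine ⟨fun j => (y j).1 • (1 + P' j * Q' j), ?_,
        fun j => ⟨r j, (y j).1 • P' j, Q' j, ?_, ?_, ?_⟩⟩
      · rw [List.ofFn_eq_map] at h1 ⊢
        rw [list_prod_smul, h1, ← List.ofFn_eq_map, List.prod_ofFn, smul_smul, hqdef]
        congr 1
        field_simp
      · have := hr j; have := hδ j; omega
      · rw [Matrix.smul_mul]; module
      · have := (hL j).affine ((y j).1 / q) 0
        rw [List.map_map] at this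
        convert! this using 1
        · conv_lhs => rw [← List.map_id (L j)]
          refine List.map_congr_left fun z _ => ?_
          simp only [id, Function.comp_apply]
          ext1
          · have := hy j
            simp only
            field_simp
            ring
          · rfl
        · rw [Matrix.mul_smul, h2, div_eq_mul_inv, zero_smul, add_zero, mul_smul, ← smul_add]
          congr 1
          rw [add_comm (Q j * P j)]
          abel

end Steps

/-! ### Multiplicities under `Ψ`, and realization of good tuples -/

section Numerics

/-- The Jordan normal form of a diagonalizable matrix whose eigenvalues have the multiplicities
`s`; zeros in `s` are discarded. -/
def diagJNF (s : Multiset ℕ) : JNF := (s.filter (· ≠ 0)).map fun m => Multiset.replicate m 1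

theorem diagJNF_cons {m : ℕ} (hm : m ≠ 0) (s : Multiset ℕ) :
    diagJNF (m ::ₘ s) = Multiset.replicate m 1 ::ₘ diagJNF s := by
  rw [diagJNF, Multiset.filter_cons_of_pos (p := (· ≠ 0)) _ hm, Multiset.map_cons, diagJNF]

theorem diagJNF_zero_cons (s : Multiset ℕ) : diagJNF (0 ::ₘ s) = diagJNF s := by
  rw [diagJNF, Multiset.filter_cons_of_neg (p := (· ≠ 0)) _ (by simp), diagJNF]

theorem size_diagJNF (s : Multiset ℕ) : (diagJNF s).size = s.sum := by
  induction s using Multiset.induction_on with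
  | empty => rfl
  | cons m s ih =>
    rcases eq_or_ne m 0 with rfl | hm
    · rw [diagJNF_zero_cons, ih, Multiset.sum_cons, zero_add]
    · rw [diagJNF_cons hm, Multiset.sum_cons, ← ih]
      simp [JNF.size]

theorem maxBlocks_diagJNF (s : Multiset ℕ) : (diagJNF s).maxBlocks = s.sup := by
  induction s using Multiset.induction_on with
  | empty => rfl
  | cons m s ih =>
    rcases eq_or_ne m 0 with rfl | hm
    · rw [diagJNF_zero_cons, ih, Multiset.sup_cons]
      simp
    · rw [diagJNF_cons hm, Multiset.sup_cons, ← ih]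
      simp [JNF.maxBlocks]

/-- The sum of the squares of the elements of a multiset. -/
def sqSum (s : Multiset ℕ) : ℕ := (s.map (· ^ 2)).sum

theorem sqSum_cons (m : ℕ) (s : Multiset ℕ) : sqSum (m ::ₘ s) = m ^ 2 + sqSum s := by
  simp [sqSum]

theorem centralizerDim_diagJNF (s : Multiset ℕ) :
    (diagJNF s).centralizerDim = sqSum s := by
  induction s using Multiset.induction_on with
  | empty => rfl
  | cons m s ih =>
    rcases eq_or_ne m 0 with rfl | hm
    · rw [diagJNF_zero_cons, ih, sqSum_cons]
      simp
    · rw [diagJNF_cons hm, sqSum_cons, ← ih]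
      simp [JNF.centralizerDim, sq]

/-- All blocks have size 1, so shortening `δ` of them deletes them and lowers the largest
multiplicity by `δ`. -/
theorem reduces_diagJNF {δ : ℕ} {s : Multiset ℕ} {J : JNF} (h : JNF.Reduces δ (diagJNF s) J) :
    ∃ m s', s = m ::ₘ s' ∧ m = s.sup ∧ δ ≤ m ∧ J = diagJNF ((m - δ) ::ₘ s') := by
  obtain ⟨T, U, hTU, hmax, hT, -, rfl⟩ := h
  obtain ⟨m, hm, hmTU⟩ := Multiset.mem_map.1 hTU
  obtain ⟨hms, hm0⟩ := Multiset.mem_filter.1 hm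
  obtain ⟨s', rfl⟩ := Multiset.exists_cons_of_mem hms
  have hone : ∀ x ∈ T + U, x = 1 := fun x hx => by
    rw [← hmTU] at hx
    exact Multiset.eq_of_mem_replicate hx
  have hcard : T.card + U.card = m := by
    rw [← Multiset.card_add, ← hmTU, Multiset.card_replicate]
  have hTr : T = Multiset.replicate δ 1 :=
    Multiset.eq_replicate.2 ⟨hT, fun x hx => hone x (by simp [hx])⟩
  have hUr : U = Multiset.replicate (m - δ) 1 :=
    Multiset.eq_replicate.2 ⟨by omega, fun x hx => hone x (by simp [hx])⟩
  refine ⟨m, s', rfl, ?_, by omega, ?_⟩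
  · rw [← maxBlocks_diagJNF, ← hmax, Multiset.card_add, hcard]
  · have hfil : ∀ s : Multiset ℕ, (diagJNF s).filter (· ≠ 0) = diagJNF s := by
      intro s
      rw [Multiset.filter_eq_self]
      intro a ha
      obtain ⟨x, hx, rfl⟩ := Multiset.mem_map.1 ha
      have := (Multiset.mem_filter.1 hx).2
      intro h
      have := congrArg Multiset.card h
      simp at this
      contradiction
    have hblock : Multiset.filter (· ≠ 0) (T.map (· - 1) + U) = Multiset.replicate (m - δ) 1 := by
      rw [hTr, hUr, Multiset.map_replicate, Multiset.filter_add,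
        Multiset.filter_eq_nil.2 fun a ha => ?_, Multiset.filter_eq_self.2 fun a ha => ?_, zero_add]
      · rw [Multiset.eq_of_mem_replicate ha]
        exact one_ne_zero
      · rw [Multiset.eq_of_mem_replicate ha]
        simp
    rw [hblock, ← hmTU, diagJNF_cons hm0, Multiset.erase_cons_head]
    rcases eq_or_ne (m - δ) 0 with h0 | h0
    · rw [h0, diagJNF_zero_cons, Multiset.replicate_zero,
        Multiset.filter_cons_of_neg _ (by simp), hfil]
    · rw [← diagJNF_cons h0, hfil]

/-- The multiplicities in a list of eigenvalues with multiplicities. -/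
def mults (L : List (ℂ × ℕ)) : Multiset ℕ := (L.map Prod.snd : List ℕ)

theorem mults_cons (y : ℂ × ℕ) (L : List (ℂ × ℕ)) : mults (y :: L) = y.2 ::ₘ mults L := rfl

theorem exists_append_of_mults_eq_cons {L : List (ℂ × ℕ)} {m : ℕ} {s : Multiset ℕ}
    (h : mults L = m ::ₘ s) :
    ∃ (L₁ : List (ℂ × ℕ)) (y : ℂ × ℕ) (L₂ : List (ℂ × ℕ)), L = L₁ ++ y :: L₂ ∧ y.2 = m ∧
      mults (L₁ ++ L₂) = s := by
  have hm : m ∈ L.map Prod.snd := by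
    have : m ∈ mults L := by rw [h]; exact Multiset.mem_cons_self _ _
    exact this
  obtain ⟨y, hy, rfl⟩ := List.mem_map.1 hm
  obtain ⟨L₁, L₂, rfl⟩ := List.append_of_mem hy
  refine ⟨L₁, y, L₂, rfl, rfl, ?_⟩
  have h2 : mults (L₁ ++ y :: L₂) = y.2 ::ₘ mults (L₁ ++ L₂) := by
    rw [mults, mults, Multiset.cons_coe, Multiset.coe_eq_coe]
    simp only [List.map_append, List.map_cons]
    exact List.perm_middle
  rw [h2] at h
  exact (Multiset.cons_inj_right _).1 h

variable {p : ℕ}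

/-- The index of rigidity of a tuple of diagonalizable classes of size `n` with multiplicities
`s j`. -/
def diagIndex (n : ℕ) (s : Fin (p + 1) → Multiset ℕ) : ℤ :=
  (1 - p) * (n : ℤ) ^ 2 + ∑ j, (sqSum (s j) : ℤ)

theorem sqSum_le (s : Multiset ℕ) : sqSum s ≤ s.sup * s.sum := by
  have h : (s.map fun m => s.sup * m).sum = s.sup * s.sum := by
    rw [Multiset.sum_map_mul_left, Multiset.map_id']
  rw [← h]
  refine Multiset.sum_map_le_sum_map _ _ fun m hm => ?_
  rw [sq]
  exact Nat.mul_le_mul_right _ (Multiset.le_sup hm)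

/-- The sum of the squares of the multiplicities is at most `n` times the largest one, so `n * r j +
sqSum (s j) ≤ n ^ 2`. Summing over `j`, `(ω)` would make the index nonpositive. -/
theorem not_condOmega_of_diagIndex_pos {n : ℕ} {s : Fin (p + 1) → Multiset ℕ}
    (hs : ∀ j, (s j).sum = n) (h : 0 < diagIndex n s) :
    ¬ CondOmega n fun j => diagJNF (s j) := by
  intro hω
  simp only [CondOmega, JNF.r, size_diagJNF, maxBlocks_diagJNF, hs] at hω
  have h1 : ∀ j, (n - (s j).sup) * n + sqSum (s j) ≤ n * n := fun j => by
    have h2 := sqSum_le (s j)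
    rw [hs j] at h2
    have h3 : (s j).sup ≤ n := by
      rw [← hs j]
      exact Multiset.sup_le.2 fun m hm => Multiset.le_sum_of_mem hm
    have : (n - (s j).sup) * n + (s j).sup * n = n * n := by
      rw [← add_mul, Nat.sub_add_cancel h3]
    omega
  have h4 := Finset.sum_le_sum fun j (_ : j ∈ Finset.univ) => h1 j
  rw [Finset.sum_add_distrib, ← Finset.sum_mul] at h4
  simp only [Finset.sum_const, Finset.card_univ, Fintype.card_fin, smul_eq_mul] at h4
  have h5 := Nat.mul_le_mul_right n hω
  have h6 : 2 * n * n + ∑ j, sqSum (s j) ≤ (p + 1) * (n * n) := by omega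
  have h7 : (2 * n * n + ∑ j, (sqSum (s j) : ℤ) : ℤ) ≤ (p + 1) * (n * n) := by exact_mod_cast h6
  rw [diagIndex] at h
  nlinarith

/-- A tuple of eigenvalue multiplicities for which the algorithm `Ψ` stops at size one is
realized, in the weak sense of `HasArm`, by a tuple with given scalar sum or product. -/
theorem exists_hasArm_tuple (mul : Bool) {X Y : ℕ × (Fin (p + 1) → JNF)}
    (h : Relation.ReflTransGen PsiStep X Y) (hY : Y.1 = 1 ∨ CondOmega Y.1 Y.2) :
    ∀ (L : Fin (p + 1) → List (ℂ × ℕ)) (c : ℂ), (∀ j, X.2 j = diagJNF (mults (L j))) →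
      (∀ j, (mults (L j)).sum = X.1) → 0 < diagIndex X.1 (fun j => mults (L j)) →
      WeightCond mul L c X.1 →
      ∃ A : Fin (p + 1) → Mat X.1, total mul A = c • (1 : Mat X.1) ∧ ∀ j, HasArm (L j) (A j) := by
  induction h using Relation.ReflTransGen.head_induction_on with
  | refl =>
    intro L c hJ hsum hpos hw
    obtain ⟨n, J⟩ := Y
    simp only at hY hJ hsum hpos hw ⊢
    obtain rfl : J = fun j => diagJNF (mults (L j)) := funext hJ
    have hn : n = 1 := hY.resolve_right (not_condOmega_of_diagIndex_pos hsum hpos)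
    subst hn
    have hs' : ∀ j, ((L j).map Prod.snd).sum = 1 := fun j => by
      have := hsum j
      rwa [mults, Multiset.sum_coe] at this
    -- At size 1 both expressions equal the only eigenvalue of multiplicity 1.
    have hx : ∀ j, ((L j).map fun y => y.1 ^ y.2).prod =
        ((L j).map fun y => (y.2 : ℂ) * y.1).sum := fun j => by
      have := hs' j
      generalize L j = M at this
      clear hs' hw hpos hsum hY hJ
      have hz : ∀ M : List (ℂ × ℕ), (M.map Prod.snd).sum = 0 →
          (M.map fun y => y.1 ^ y.2).prod = 1 ∧ (M.map fun y => (y.2 : ℂ) * y.1).sum = 0 := by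
        intro M
        induction M with
        | nil => simp
        | cons y M ih =>
          intro h
          simp only [List.map_cons, List.sum_cons, List.prod_cons] at h ⊢
          obtain ⟨e1, e2⟩ := ih (by omega)
          have : y.2 = 0 := by omega
          simp [e1, e2, this]
      induction M with
      | nil => simp at this
      | cons y M ih =>
        simp only [List.map_cons, List.sum_cons, List.prod_cons] at this ⊢
        rcases Nat.eq_zero_or_pos y.2 with h0 | h0
        · rw [ih (by omega), h0]; simp
        · obtain ⟨e1, e2⟩ := hz M (by omega)
          have : y.2 = 1 := by omega
          rw [e1, e2, this]; simp
    refine ⟨fun j => ((L j).map fun y => (y.2 : ℂ) * y.1).sum • 1, ?_, fun j =>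
      hasArm_scalar_one (hs' j) rfl⟩
    cases mul
    · simp only [WeightCond, total, Bool.false_eq_true, if_false] at hw ⊢
      rw [← Finset.sum_smul, hw]
      simp
    · simp only [WeightCond, total, if_true] at hw ⊢
      rw [List.ofFn_eq_map, list_prod_smul, ← List.ofFn_eq_map, List.prod_ofFn, ← pow_one c,
        ← hw.2.2, Finset.prod_congr rfl fun j _ => hx j]
      simp
  | @head X Z hstep _ ih =>
    intro L c hJ hsum hpos hw
    obtain ⟨n, J⟩ := X
    obtain ⟨n', J'⟩ := Z
    obtain ⟨hn, -, hβ, hω, hn', hred⟩ := hstep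
    simp only at hn hβ hω hn' hred hJ hsum hpos hw ih ⊢
    obtain rfl : J = fun j => diagJNF (mults (L j)) := funext hJ
    have hred' := fun j => reduces_diagJNF (hred j)
    choose m s' hs hm hδ hJ' using hred'
    choose L₁ y L₂ hL hym hs' using fun j => exists_append_of_mults_eq_cons (hs j)
    beta_reduce at hn' hω
    have hr : ∀ j, (diagJNF (mults (L j))).r = (((L₁ j ++ L₂ j)).map Prod.snd).sum := fun j => by
      have e1 := hsum j
      rw [hs j, Multiset.sum_cons] at e1
      rw [JNF.r, size_diagJNF, maxBlocks_diagJNF, ← hm j, hsum, ← Multiset.sum_coe]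
      have : (((L₁ j ++ L₂ j)).map Prod.snd : Multiset ℕ) = s' j := hs' j
      rw [this]; omega
    have hsize : ∀ j, (y j).2 + (((L₁ j ++ L₂ j)).map Prod.snd).sum = n := fun j => by
      have e1 := hsum j
      rw [hs j, Multiset.sum_cons] at e1
      rw [hym, ← Multiset.sum_coe]
      have : (((L₁ j ++ L₂ j)).map Prod.snd : Multiset ℕ) = s' j := hs' j
      rw [this]; omega
    -- Condition `(β)` makes the subtraction defining `n'` exact.
    have hR : n ≤ ∑ j, (diagJNF (mults (L j))).r :=
      (hβ 0).trans (Finset.sum_le_sum_of_subset (Finset.erase_subset _ _))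
    have hlt : n' < n := by
      rw [CondOmega, not_le] at hω
      omega
    obtain ⟨δ, rfl⟩ := Nat.exists_eq_add_of_le hlt.le
    rw [Nat.add_sub_cancel_left] at hδ hJ'
    have hsumr : ∑ j, (((L₁ j ++ L₂ j)).map Prod.snd).sum = (n' + δ) + n' := by
      rw [← Finset.sum_congr rfl fun j _ => hr j]
      omega
    have hstepw : WeightCond mul (fun j => y j :: (L₁ j ++ L₂ j)) c (n' + δ) := by
      have hperm : ∀ j, (L j).Perm (y j :: (L₁ j ++ L₂ j)) := fun j => by
        rw [hL j]; exact List.perm_middle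
      cases mul
      · simp only [WeightCond, Bool.false_eq_true, if_false] at hw ⊢
        rw [← hw]
        exact Finset.sum_congr rfl fun j _ => ((hperm j).map _).sum_eq.symm
      · simp only [WeightCond, if_true] at hw ⊢
        refine ⟨hw.1, fun j z hz => hw.2.1 j z ((hperm j).mem_iff.2 hz), ?_⟩
        rw [← hw.2.2]
        exact Finset.prod_congr rfl fun j _ => ((hperm j).map _).prod_eq.symm
    have hδ' : ∀ j, δ ≤ (y j).2 := fun j => by rw [hym]; exact hδ j
    have hstep : ∃ (c' : ℂ) (y' : Fin (p + 1) → ℂ) (L' : Fin (p + 1) → List (ℂ × ℕ)),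
      (∀ j, (L' j).map Prod.snd = (L₁ j ++ L₂ j).map Prod.snd) ∧
      WeightCond mul (fun j => (y' j, (y j).2 - δ) :: L' j) c' n' ∧
      ∀ A' : Fin (p + 1) → Mat n', total mul A' = c' • (1 : Mat n') →
        (∀ j, HasArm ((y' j, (y j).2 - δ) :: L' j) (A' j)) →
        ∃ A : Fin (p + 1) → Mat (n' + δ), total mul A = c • (1 : Mat (n' + δ)) ∧
          ∀ j, HasArm (y j :: (L₁ j ++ L₂ j)) (A j) := by
      cases mul
      · exact exists_step_add hδ' hsize hsumr hstepw
      · exact exists_step_mul hδ' hsize hsumr hstepw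
    obtain ⟨c', y', L', hL', hw', hlift⟩ := hstep
    have hmL' : ∀ j, mults (L' j) = s' j := fun j => by
      rw [mults, hL' j]; exact hs' j
    have hnew : ∀ j, mults ((y' j, (y j).2 - δ) :: L' j) = (m j - δ) ::ₘ s' j := fun j => by
      rw [mults_cons, hmL', hym]
    obtain ⟨A', hA', hArm'⟩ := ih (fun j => (y' j, (y j).2 - δ) :: L' j) c'
      (fun j => by rw [hJ', hnew])
      (fun j => by
        have e1 := hsum j
        rw [hs j, Multiset.sum_cons] at e1
        have := hδ j
        rw [hnew, Multiset.sum_cons]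
        omega)
      (by
        -- The index does not change: each `m j` drops by `δ`, and `e2` gives the sum of the `m j`
        -- in terms of `n'` and `δ`.
        refine lt_of_lt_of_eq hpos ?_
        simp only [diagIndex, hnew, hs, sqSum_cons]
        have e1 : ∀ j, ((((m j - δ) ^ 2 + sqSum (s' j) : ℕ)) : ℤ) =
            ((m j ^ 2 + sqSum (s' j) : ℕ) : ℤ) - 2 * δ * m j + δ ^ 2 := fun j => by
          push_cast [Nat.cast_sub (hδ j)]
          ring
        rw [Finset.sum_congr rfl fun j _ => e1 j, Finset.sum_add_distrib, Finset.sum_sub_distrib,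
          ← Finset.mul_sum]
        have e2 : (∑ j, (m j : ℤ)) + ((n' + δ) + n') = (p + 1) * (n' + δ) := by
          have : ∑ j, ((y j).2 + (((L₁ j ++ L₂ j)).map Prod.snd).sum) =
            ∑ _j : Fin (p + 1), (n' + δ) := Finset.sum_congr rfl fun j _ => hsize j
          rw [Finset.sum_add_distrib, hsumr, Finset.sum_congr rfl fun j _ => hym j] at this
          simp only [Finset.sum_const, Finset.card_univ, Fintype.card_fin, smul_eq_mul] at this
          exact_mod_cast this
        have e3 : (∑ j, (m j : ℤ)) = (p + 1) * (n' + δ) - ((n' + δ) + n') := by linarith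
        rw [e3]
        simp only [Finset.sum_const, Finset.card_univ, Fintype.card_fin, nsmul_eq_mul]
        push_cast
        ring)
      hw'
    obtain ⟨A, hA, hArm⟩ := hlift A' hA' hArm'
    refine ⟨A, hA, fun j => ?_⟩
    rw [hL j]
    -- The eigenvalue at the head has the largest multiplicity, so it can return to its place in `L
    -- j`.
    refine HasArm.move (fun x hx => ?_) (hArm j)
    rw [hym, hm j]
    refine Multiset.le_sup ?_
    rw [hL j]
    exact List.mem_map_of_mem (by simp [hx])

end Numerics

/-! ### Characteristic polynomials of subordinate classes -/

section Charpoly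

variable {n l : ℕ}

theorem charpoly_eq_of_isConj {A X : Mat n} (h : IsConj A X) : X.charpoly = A.charpoly := by
  obtain ⟨c, hc⟩ := h
  have hX : X = c.val * A * (c⁻¹).val := by
    rw [hc.eq, mul_assoc, Units.mul_inv, mul_one]
  rw [hX, Matrix.charpoly_mul_comm, ← mul_assoc, Units.inv_mul, one_mul]

/-- The values of the characteristic polynomial are continuous and constant on a class, hence
constant on its closure. -/
theorem charpoly_eq_of_isSubordinate {A' A : Mat n} (h : IsSubordinate A' A) :
    A'.charpoly = A.charpoly := by
  refine Polynomial.funext fun t => ?_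
  have hcont : Continuous fun X : Mat n => X.charpoly.eval t := by
    simp only [Matrix.eval_charpoly]
    exact (continuous_const.sub continuous_id).matrix_det
  have hclosed : IsClosed {X : Mat n | X.charpoly.eval t = A.charpoly.eval t} :=
    isClosed_eq hcont continuous_const
  refine hclosed.closure_subset_iff.2 (fun X hX => ?_) h
  exact congrArg (Polynomial.eval t) (charpoly_eq_of_isConj hX)

theorem charpoly_blockDiagonal_const (B : Mat l) (n₁ : ℕ) :
    (Matrix.blockDiagonal fun _ : Fin n₁ => B).charpoly = B.charpoly ^ n₁ := by
  refine Polynomial.funext fun t => ?_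
  rw [Polynomial.eval_pow, Matrix.eval_charpoly, Matrix.eval_charpoly]
  have : Matrix.scalar (Fin l × Fin n₁) t - (Matrix.blockDiagonal fun _ : Fin n₁ => B) =
      Matrix.blockDiagonal fun _ : Fin n₁ => Matrix.scalar (Fin l) t - B := by
    ext ⟨i, a⟩ ⟨j, b⟩
    by_cases hab : a = b <;> by_cases hij : i = j <;>
      simp [Matrix.blockDiagonal_apply, hab, hij]
  rw [this, Matrix.det_blockDiagonal]
  simp

theorem IsSpecialDiagonalWith.charpoly_eq {p n₁ : ℕ} {A : Fin (p + 1) → Mat n}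
    {B : Fin (p + 1) → Mat l} (h : IsSpecialDiagonalWith A l n₁ B) (j : Fin (p + 1)) :
    (A j).charpoly = (B j).charpoly ^ n₁ := by
  obtain ⟨e, he⟩ := h.subordinate
  rw [← charpoly_eq_of_isSubordinate (he j), Matrix.charpoly_reindex, charpoly_blockDiagonal_const]

theorem card_eigs (A : Mat n) : (eigs A).card = n := by
  rw [eigs, ← (IsAlgClosed.splits A.charpoly).natDegree_eq_card_roots,
    Matrix.charpoly_natDegree_eq_dim, Fintype.card_fin]

theorem prod_X_sub_C_eigs (A : Mat n) :
    ((eigs A).map fun x => Polynomial.X - Polynomial.C x).prod = A.charpoly :=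
  ((IsAlgClosed.splits A.charpoly).eq_prod_roots_of_monic A.charpoly_monic).symm

theorem trace_eq_sum_eigs (A : Mat n) : A.trace = (eigs A).sum :=
  Matrix.trace_eq_sum_roots_charpoly_of_splits (IsAlgClosed.splits _)

theorem det_eq_prod_eigs (A : Mat n) : A.det = (eigs A).prod :=
  Matrix.det_eq_prod_roots_charpoly_of_splits (IsAlgClosed.splits _)

end Charpoly

/-! ### Eigenvalues listed with multiplicities -/

section EigenvalueList

variable {n : ℕ}

/-- The list of the eigenvalues with their multiplicities. -/
noncomputable def eigList (A : Mat n) : List (ℂ × ℕ) :=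
  (eigs A).toFinset.toList.map fun x => (x, (eigs A).count x)

theorem nodup_eigList (A : Mat n) : ((eigList A).map Prod.fst).Nodup := by
  have : (eigList A).map Prod.fst = (eigs A).toFinset.toList := by
    rw [eigList, List.map_map]
    exact List.map_id _
  rw [this]
  exact Finset.nodup_toList _

theorem prod_map_eigList {M : Type*} [CommMonoid M] (A : Mat n) (f : ℂ × ℕ → M) :
    ((eigList A).map f).prod = ∏ x ∈ (eigs A).toFinset, f (x, (eigs A).count x) := by
  rw [eigList, List.map_map, ← Finset.prod_map_toList]
  rfl

theorem sum_map_eigList {M : Type*} [AddCommMonoid M] (A : Mat n) (f : ℂ × ℕ → M) :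
    ((eigList A).map f).sum = ∑ x ∈ (eigs A).toFinset, f (x, (eigs A).count x) := by
  rw [eigList, List.map_map, ← Finset.sum_map_toList]
  rfl

theorem prod_pow_eigList (A : Mat n) :
    ((eigList A).map fun y => (Polynomial.X - Polynomial.C y.1) ^ y.2).prod = A.charpoly := by
  rw [prod_map_eigList, ← prod_X_sub_C_eigs, Finset.prod_multiset_map_count]

theorem sum_mul_eigList (A : Mat n) :
    ((eigList A).map fun y => (y.2 : ℂ) * y.1).sum = A.trace := by
  rw [sum_map_eigList, trace_eq_sum_eigs, Finset.sum_multiset_count]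
  simp

theorem prod_value_pow_eigList (A : Mat n) :
    ((eigList A).map fun y => y.1 ^ y.2).prod = A.det := by
  rw [prod_map_eigList, det_eq_prod_eigs, Finset.prod_multiset_count]

theorem ne_zero_of_mem_eigList {A : Mat n} (hA : A.det ≠ 0) {y : ℂ × ℕ} (hy : y ∈ eigList A) :
    y.1 ≠ 0 := by
  obtain ⟨x, hx, rfl⟩ := List.mem_map.1 hy
  rw [Finset.mem_toList, Multiset.mem_toFinset] at hx
  rintro rfl
  exact hA (by rw [det_eq_prod_eigs]; exact Multiset.prod_eq_zero hx)

theorem mults_eigList (A : Mat n) :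
    mults (eigList A) = (eigs A).toFinset.val.map fun x => (eigs A).count x := by
  rw [mults, eigList, List.map_map, ← Finset.coe_toList, Multiset.map_coe]
  rfl

theorem sum_mults_eigList (A : Mat n) : (mults (eigList A)).sum = n := by
  rw [mults_eigList]
  change ∑ x ∈ (eigs A).toFinset, (eigs A).count x = n
  rw [Multiset.toFinset_sum_count_eq, card_eigs]

theorem sqSum_mults_eigList (A : Mat n) :
    sqSum (mults (eigList A)) = ((eigs A).map fun x => (eigs A).count x).sum := by
  rw [mults_eigList, sqSum, Multiset.map_map, Finset.sum_multiset_map_count (eigs A)]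
  change ∑ x ∈ (eigs A).toFinset, (eigs A).count x ^ 2 = _
  simp [sq]

end EigenvalueList

/-! ### Jordan data and centralizers of diagonalizable matrices -/

section Diagonalizable

variable {n : ℕ}

/-- The rank is the same for all positive powers, so `blockSizes` sees only blocks of size 1. -/
theorem IsDiagonalizable.rank_pow {A : Mat n} (hA : IsDiagonalizable A) (x : ℂ) {k : ℕ}
    (hk : k ≠ 0) : ((A - Matrix.scalar (Fin n) x) ^ k).rank = n - (eigs A).count x := by
  obtain ⟨D, c, hc⟩ := hA
  have hdet : IsUnit c.val.det := (Matrix.isUnit_iff_isUnit_det _).1 c.isUnit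
  have hsemi : SemiconjBy c.val (A - Matrix.scalar (Fin n) x)
      (Matrix.diagonal D - Matrix.scalar (Fin n) x) :=
    SemiconjBy.sub_right hc ((Matrix.scalar_commute x (fun r => mul_comm x r) c.val).symm)
  have hpow := hsemi.pow_right k
  have h1 : ((A - Matrix.scalar (Fin n) x) ^ k).rank =
      ((Matrix.diagonal D - Matrix.scalar (Fin n) x) ^ k).rank := by
    rw [← Matrix.rank_mul_eq_right_of_isUnit_det c.val _ hdet, hpow.eq,
      Matrix.rank_mul_eq_left_of_isUnit_det _ _ hdet]
  have h2 : (Matrix.diagonal D - Matrix.scalar (Fin n) x) ^ k =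
      Matrix.diagonal fun i => (D i - x) ^ k := by
    rw [Matrix.scalar_apply, Matrix.diagonal_sub, Matrix.diagonal_pow]
    rfl
  have h3 : eigs A = Finset.univ.val.map D := by
    have h : (Matrix.diagonal D).charpoly =
        ((Finset.univ.val.map D).map fun x => Polynomial.X - Polynomial.C x).prod := by
      rw [Matrix.charpoly_diagonal, Multiset.map_map]
      rfl
    rw [eigs, ← charpoly_eq_of_isConj ⟨c, hc⟩, h, Polynomial.roots_multiset_prod_X_sub_C]
  have h4 : (eigs A).count x = (Finset.univ.filter fun i => D i = x).card := by
    rw [h3, Multiset.count_map, Finset.card_def, Finset.filter_val]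
    simp only [eq_comm]
  have h5 := Finset.card_filter_add_card_filter_not (s := (Finset.univ : Finset (Fin n)))
    (fun i => D i = x)
  rw [Finset.card_univ, Fintype.card_fin] at h5
  rw [h1, h2, Matrix.rank_diagonal, Fintype.card_subtype, h4]
  have h6 : (Finset.univ.filter fun i => (D i - x) ^ k ≠ 0) =
      Finset.univ.filter fun i => ¬ D i = x := by
    ext i
    simp [hk, sub_eq_zero]
  rw [h6]
  omega

theorem IsDiagonalizable.blockSizes_eq {A : Mat n} (hA : IsDiagonalizable A) (x : ℂ) :
    blockSizes A x = Multiset.replicate ((eigs A).count x) 1 := by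
  have hle : (eigs A).count x ≤ n := (Multiset.count_le_card _ _).trans_eq (card_eigs A)
  rcases Nat.eq_zero_or_pos n with rfl | hn
  · have : (eigs A).count x = 0 := by omega
    simp [blockSizes, this]
  rw [blockSizes, Finset.sum_eq_single 1]
  · rw [numBlocks, hA.rank_pow x one_ne_zero, hA.rank_pow x two_ne_zero, Nat.sub_self, pow_zero,
      Matrix.rank_one, Fintype.card_fin]
    congr 1
    omega
  · intro k hk hk1
    rw [Finset.mem_Icc] at hk
    rw [numBlocks, hA.rank_pow x (by omega), hA.rank_pow x (by omega), Nat.sub_self, Nat.zero_sub,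
      Multiset.replicate_zero]
  · intro h
    exact absurd (Finset.mem_Icc.2 ⟨le_rfl, hn⟩) h

theorem IsDiagonalizable.jnf_eq {A : Mat n} (hA : IsDiagonalizable A) :
    jnf A = diagJNF (mults (eigList A)) := by
  rw [mults_eigList, diagJNF, Multiset.filter_eq_self.2, Multiset.map_map, jnf]
  · exact Multiset.map_congr rfl fun x _ => hA.blockSizes_eq x
  · intro m hm
    obtain ⟨x, hx, rfl⟩ := Multiset.mem_map.1 hm
    exact Multiset.count_ne_zero.2 (Multiset.mem_toFinset.1 hx)

theorem finrank_eigenspace_of_hasEigenbasis {V : Type*} [AddCommGroup V] [Module ℂ V]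
    [FiniteDimensional ℂ V] {b : End ℂ V} (hb : HasEigenbasis b) (x : ℂ) :
    finrank ℂ (b.eigenspace x) = b.charpoly.roots.count x := by
  refine le_antisymm ?_ ?_
  · rw [Polynomial.count_roots]
    exact b.finrank_eigenspace_le x
  · classical
    obtain ⟨ι, _, e, d, he⟩ := hb
    rw [roots_charpoly_of_eigenbasis e he, Multiset.count_map]
    have h1 : Multiset.card (Finset.univ.val.filter fun i => x = d i) =
        Fintype.card {i // x = d i} := (Fintype.card_subtype _).symm
    rw [h1]
    have hli : LinearIndependent ℂ fun i : {i // x = d i} =>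
        (⟨e i, End.mem_eigenspace_iff.2 (by rw [he, ← i.2])⟩ : b.eigenspace x) := by
      refine LinearIndependent.of_comp (b.eigenspace x).subtype ?_
      exact e.linearIndependent.comp _ Subtype.val_injective
    exact hli.fintype_card_le_finrank

theorem finrank_ker_commMap_self_of_hasEigenbasis {V : Type*} [AddCommGroup V] [Module ℂ V]
    [FiniteDimensional ℂ V] {b : End ℂ V} (hb : HasEigenbasis b) :
    finrank ℂ (LinearMap.ker (commMap b b)) =
      (b.charpoly.roots.map fun x => b.charpoly.roots.count x).sum := by
  have h : (b.charpoly.roots.map fun x => finrank ℂ (b.eigenspace x)).sum =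
      (b.charpoly.roots.map fun x => b.charpoly.roots.count x).sum := by
    simp only [finrank_eigenspace_of_hasEigenbasis hb]
  rw [← h]
  refine le_antisymm (finrank_ker_commMap_le b b) ?_
  obtain ⟨ι, _, e, d, he⟩ := hb
  exact le_finrank_ker_commMap b e he

end Diagonalizable

/-! ### From matrices to endomorphisms -/

section Bridge

variable {p n : ℕ}

theorem classDim_eq (A : Mat n) :
    classDim A =
      finrank ℂ (LinearMap.range (commMap (Matrix.toLin' A) (Matrix.toLin' A))) := by
  have h : commMap (Matrix.toLin' A) (Matrix.toLin' A) ∘ₗ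
      (Matrix.toLin' : Mat n ≃ₗ[ℂ] End ℂ (Fin n → ℂ)).toLinearMap =
      (Matrix.toLin' : Mat n ≃ₗ[ℂ] End ℂ (Fin n → ℂ)).toLinearMap ∘ₗ
        (LinearMap.mulLeft ℂ A - LinearMap.mulRight ℂ A) := by
    refine LinearMap.ext fun X => ?_
    simp only [LinearMap.comp_apply, LinearEquiv.coe_coe, commMap_apply, LinearMap.sub_apply,
      LinearMap.mulLeft_apply, LinearMap.mulRight_apply, map_sub, Matrix.toLin'_mul]
  have h2 := congrArg LinearMap.range h
  rw [LinearMap.range_comp_of_range_eq_top _ (LinearEquiv.range _), LinearMap.range_comp] at h2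
  rw [h2, classDim, tangentSpace]
  exact (LinearEquiv.finrank_map_eq _ _).symm

theorem classDim_add_finrank_ker (A : Mat n) :
    classDim A + finrank ℂ (LinearMap.ker (commMap (Matrix.toLin' A) (Matrix.toLin' A))) =
      n * n := by
  rw [classDim_eq, finrank_range_commMap]
  simp

theorem toLin'_list_prod {ι : Type*} (L : List ι) (A : ι → Mat n) :
    Matrix.toLin' (L.map A).prod = (L.map fun j => Matrix.toLin' (A j)).prod := by
  induction L with
  | nil => simp; rfl
  | cons a L ih => simp only [List.map_cons, List.prod_cons, Matrix.toLin'_mul, ih]; rfl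

theorem balanced_toLin' {mul : Bool} {A : Fin (p + 1) → Mat n}
    (h : total mul A = if mul then 1 else 0) : Balanced mul fun j => Matrix.toLin' (A j) := by
  cases mul
  · simp only [total, Balanced, Bool.false_eq_true, if_false] at h ⊢
    rw [← map_sum, h, map_zero]
  · simp only [total, Balanced, if_true] at h ⊢
    rw [List.ofFn_eq_map, ← toLin'_list_prod, ← List.ofFn_eq_map, h, Matrix.toLin'_one]
    rfl

theorem HasTrivialCentralizer.finrank_intertwiners_le {A : Fin (p + 1) → Mat n}
    (h : HasTrivialCentralizer A) :
    finrank ℂ (intertwiners (fun j => Matrix.toLin' (A j)) fun j => Matrix.toLin' (A j)) ≤ 1 := by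
  refine finrank_le_one ⟨LinearMap.id, mem_intertwiners.2 fun j => rfl⟩ fun w => ?_
  obtain ⟨w, hw⟩ := w
  rw [mem_intertwiners] at hw
  obtain ⟨c, hc⟩ := h (LinearMap.toMatrix' w) fun j => by
    have := congrArg LinearMap.toMatrix' (hw j)
    rw [LinearMap.toMatrix'_comp, LinearMap.toMatrix'_comp, LinearMap.toMatrix'_toLin'] at this
    exact this.symm
  refine ⟨c, Subtype.ext ?_⟩
  apply LinearMap.toMatrix'.injective
  change LinearMap.toMatrix' (c • LinearMap.id) = LinearMap.toMatrix' w
  rw [hc, map_smul, LinearMap.toMatrix'_id]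
  exact Matrix.smul_one_eq_diagonal c

theorem rigid_toLin' {mul : Bool} {A : Fin (p + 1) → Mat n}
    (h : total mul A = if mul then 1 else 0) (hc : HasTrivialCentralizer A)
    (hκ : rigidityIndex A = 2) : Rigid mul fun j => Matrix.toLin' (A j) := by
  refine rigid_of_sum_finrank_range mul (balanced_toLin' h) hc.finrank_intertwiners_le ?_
  rw [rigidityIndex] at hκ
  simp only [← classDim_eq, Module.finrank_fin_fun]
  zify
  linarith [sq (n : ℤ)]

end Bridge

/-! ### The index of the tuple `B` -/

section Index

variable {p n l n₁ : ℕ}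

theorem even_sqSum_add_sum (s : Multiset ℕ) : Even (sqSum s + s.sum) := by
  induction s using Multiset.induction_on with
  | empty => simp [sqSum]
  | cons m s ih =>
    have h : Even (m ^ 2 + m) := by
      have := Nat.even_mul_succ_self m
      rwa [mul_add, mul_one, ← sq] at this
    rw [sqSum_cons, Multiset.sum_cons, add_add_add_comm]
    exact h.add ih

/-- Squares have the parity of their bases, so modulo 2 the index is `(1 - p) n + (p + 1) n = 2 n`.
-/
theorem even_diagIndex {s : Fin (p + 1) → Multiset ℕ} (hs : ∀ j, (s j).sum = n) :
    Even (diagIndex n s) := by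
  have h1 : Even (∑ j, (sqSum (s j) + (s j).sum)) :=
    Finset.even_sum _ fun j _ => even_sqSum_add_sum (s j)
  rw [Finset.sum_add_distrib, Finset.sum_congr rfl fun j _ => hs j] at h1
  simp only [Finset.sum_const, Finset.card_univ, Fintype.card_fin, smul_eq_mul] at h1
  obtain ⟨a, ha⟩ := h1
  obtain ⟨b, hb⟩ := Int.even_mul_succ_self n
  have ha' : (∑ j, (sqSum (s j) : ℤ)) + (p + 1) * n = a + a := by exact_mod_cast ha
  refine ⟨(1 - p) * b + a - n, ?_⟩
  rw [diagIndex]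
  linear_combination (1 - (p : ℤ)) * hb + ha'

theorem diagIndex_le_two {s : Fin (p + 1) → Multiset ℕ}
    (h : IsGood n fun j => diagJNF (s j)) : diagIndex n s ≤ 2 := by
  obtain ⟨hsize, h⟩ := h
  simp only [size_diagJNF] at hsize
  have hle : ∀ j, sqSum (s j) ≤ n * n := fun j => by
    refine (sqSum_le (s j)).trans ?_
    rw [hsize j]
    refine Nat.mul_le_mul_right _ ?_
    rw [← hsize j]
    exact Multiset.sup_le.2 fun m hm => Multiset.le_sum_of_mem hm
  rw [diagIndex]
  rcases h with rfl | ⟨-, hα, -⟩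
  · have : ∑ j, sqSum (s j) ≤ (p + 1) * 1 := by
      refine (Finset.sum_le_card_nsmul _ _ 1 fun j _ => hle j).trans_eq ?_
      simp
    have : (∑ j, (sqSum (s j) : ℤ)) ≤ (p + 1) * 1 := by exact_mod_cast this
    push_cast
    linarith
  · simp only [CondAlpha, JNF.d, size_diagJNF, hsize, centralizerDim_diagJNF] at hα
    have h1 : ∑ j, (n ^ 2 - sqSum (s j)) + ∑ j, sqSum (s j) = (p + 1) * n ^ 2 := by
      rw [← Finset.sum_add_distrib, Finset.sum_congr rfl fun j _ =>
        Nat.sub_add_cancel ((hle j).trans_eq (sq n).symm)]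
      simp
    have h2 : 2 * n ^ 2 + ∑ j, sqSum (s j) ≤ (p + 1) * n ^ 2 + 2 := by omega
    have h3 : 2 * (n : ℤ) ^ 2 + ∑ j, (sqSum (s j) : ℤ) ≤ (p + 1) * (n : ℤ) ^ 2 + 2 := by
      exact_mod_cast h2
    linarith

theorem IsSpecialDiagonalWith.size_eq {A : Fin (p + 1) → Mat n} {B : Fin (p + 1) → Mat l}
    (h : IsSpecialDiagonalWith A l n₁ B) : n = n₁ * l := by
  obtain ⟨e, -⟩ := h.subordinate
  have := Fintype.card_congr e
  simp only [Fintype.card_prod, Fintype.card_fin] at this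
  rw [← this, mul_comm]

/-- The right side is the dimension of the centralizer of `n₁` copies of `B j`. Among matrices with
a given characteristic polynomial the diagonalizable ones have the largest centralizer, since
geometric multiplicities are at most algebraic ones. -/
theorem IsSpecialDiagonalWith.finrank_ker_le {A : Fin (p + 1) → Mat n}
    {B : Fin (p + 1) → Mat l} (h : IsSpecialDiagonalWith A l n₁ B) (j : Fin (p + 1)) :
    finrank ℂ (LinearMap.ker (commMap (Matrix.toLin' (A j)) (Matrix.toLin' (A j)))) ≤
      n₁ * n₁ * sqSum (mults (eigList (B j))) := by
  refine (finrank_ker_commMap_le _ _).trans ?_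
  have h1 : (Matrix.toLin' (A j)).charpoly.roots = n₁ • eigs (B j) := by
    rw [Matrix.charpoly_toLin', h.charpoly_eq, Polynomial.roots_pow, eigs]
  have h2 : ((Matrix.toLin' (A j)).charpoly.roots.map fun x =>
      finrank ℂ (End.eigenspace (Matrix.toLin' (A j)) x)).sum ≤
      ((n₁ • eigs (B j)).map fun x => (n₁ • eigs (B j)).count x).sum := by
    rw [← h1]
    refine Multiset.sum_map_le_sum_map _ _ fun x _ => ?_
    rw [Polynomial.count_roots]
    exact LinearMap.finrank_eigenspace_le _ x
  refine h2.trans_eq ?_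
  rw [Multiset.map_nsmul, Multiset.sum_nsmul, sqSum_mults_eigList]
  simp only [Multiset.count_nsmul, Multiset.sum_map_mul_left, smul_eq_mul]
  ring

theorem IsSpecialDiagonalWith.diagIndex_eq_two {A : Fin (p + 1) → Mat n}
    {B : Fin (p + 1) → Mat l} (h : IsSpecialDiagonalWith A l n₁ B) :
    diagIndex l (fun j => mults (eigList (B j))) = 2 := by
  have h1 : diagIndex l (fun j => mults (eigList (B j))) ≤ 2 := by
    apply diagIndex_le_two
    have := h.good
    rwa [funext fun j => (h.diagonalizable j).jnf_eq] at this
  have h2 := even_diagIndex fun j => sum_mults_eigList (B j)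
  have h3 : 0 < diagIndex l (fun j => mults (eigList (B j))) := by
    have hκ := h.rigid
    rw [rigidityIndex] at hκ
    have h4 : n * n * (p + 1) ≤ ∑ j, classDim (A j) +
        n₁ * n₁ * ∑ j, sqSum (mults (eigList (B j))) := by
      rw [Finset.mul_sum, ← Finset.sum_add_distrib]
      have : ∑ _j : Fin (p + 1), n * n = n * n * (p + 1) := by simp [mul_comm]
      rw [← this]
      refine Finset.sum_le_sum fun j _ => ?_
      rw [← classDim_add_finrank_ker (A j)]
      exact Nat.add_le_add_left (h.finrank_ker_le j) _
    have h5 : (n : ℤ) * n * (p + 1) ≤ ∑ j, (classDim (A j) : ℤ) +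
        n₁ * n₁ * ∑ j, (sqSum (mults (eigList (B j))) : ℤ) := by exact_mod_cast h4
    have h6 : (n : ℤ) = n₁ * l := by exact_mod_cast h.size_eq
    -- The index of the `A j` is 2 and is at most that of the direct sums of `n₁` copies of the `B
    -- j`.
    have h7 : 2 ≤ (n₁ : ℤ) ^ 2 * diagIndex l (fun j => mults (eigList (B j))) := by
      rw [diagIndex]
      rw [h6] at h5 hκ
      linarith
    by_contra hneg
    have := mul_nonneg (sq_nonneg (n₁ : ℤ)) (neg_nonneg.2 (not_lt.1 hneg))
    linarith
  obtain ⟨a, ha⟩ := h2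
  omega

theorem exists_hasArm_of_isGood {mul : Bool} {B : Fin (p + 1) → Mat l} {c : ℂ}
    (hB : ∀ j, IsDiagonalizable (B j)) (h : IsGood l fun j => jnf (B j))
    (hpos : 0 < diagIndex l fun j => mults (eigList (B j)))
    (hw : WeightCond mul (fun j => eigList (B j)) c l) :
    ∃ C : Fin (p + 1) → Mat l, total mul C = c • (1 : Mat l) ∧
      ∀ j, HasArm (eigList (B j)) (C j) := by
  obtain ⟨-, h⟩ := h
  have key : ∃ Y, Relation.ReflTransGen PsiStep (l, fun j => jnf (B j)) Y ∧
      (Y.1 = 1 ∨ CondOmega Y.1 Y.2) := by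
    rcases h with h | ⟨-, -, -, h⟩
    · exact ⟨_, Relation.ReflTransGen.refl, Or.inl h⟩
    · exact h
  obtain ⟨Y, hY, hend⟩ := key
  exact exists_hasArm_tuple mul hY hend (fun j => eigList (B j)) c (fun j => (hB j).jnf_eq)
    (fun j => sum_mults_eigList (B j)) hpos hw

end Index

/-! ### Irreducibility and index of the realized tuple -/

section Irreducible

variable {p l : ℕ} {mul : Bool}

/-- On an invariant subspace the restrictions still have sum 0, resp. product 1. Taking traces,
resp. determinants, the eigenvalues there form a relation that genericity forbids. -/
theorem isSimpleTuple_of_generic {B C : Fin (p + 1) → Mat l} (hl : 0 < l)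
    (hch : ∀ j, (C j).charpoly = (B j).charpoly)
    (hC : Balanced mul fun j => Matrix.toLin' (C j))
    (hgen : ∀ Φ, IsSelection B Φ →
      if mul then ∏ j, (Φ j).prod ≠ 1 else ∑ j, (Φ j).sum ≠ 0) :
    IsSimpleTuple fun j => Matrix.toLin' (C j) := by
  have : NeZero l := ⟨hl.ne'⟩
  refine ⟨inferInstance, fun S hS => ?_⟩
  by_contra! hne
  have hext := isExtension_of_submodule (fun j => Matrix.toLin' (C j)) S hS
  have hpos : 0 < finrank ℂ S := by
    rw [Nat.pos_iff_ne_zero, Ne, Submodule.finrank_eq_zero]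
    exact hne.1
  have hlt : finrank ℂ S < l := by
    have := Submodule.finrank_lt hne.2
    rwa [Module.finrank_fin_fun] at this
  let R : Fin (p + 1) → End ℂ S := fun j => (Matrix.toLin' (C j)).restrict (hS j)
  have hR : Balanced mul R := (hext.balanced hC).1
  have hsel : IsSelection B fun j => (R j).charpoly.roots := by
    refine ⟨finrank ℂ S, hpos, hlt, fun j => ⟨?_, ?_⟩⟩
    · have h1 := hext.charpoly_eq j
      rw [Matrix.charpoly_toLin', hch] at h1
      rw [eigs, h1]
      exact Polynomial.roots.le_of_dvd (mul_ne_zero (LinearMap.charpoly_monic _).ne_zero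
        (LinearMap.charpoly_monic _).ne_zero) (dvd_mul_right _ _)
    · rw [← (IsAlgClosed.splits (R j).charpoly).natDegree_eq_card_roots,
        LinearMap.charpoly_natDegree]
  have h := hgen _ hsel
  cases mul
  · simp only [Bool.false_eq_true, if_false, Balanced] at h hR
    apply h
    simp only [← End.trace_eq_sum_roots_charpoly_of_splits (IsAlgClosed.splits _)]
    rw [← map_sum, hR, map_zero]
  · simp only [if_true, Balanced] at h hR
    apply h
    simp only [← End.det_eq_prod_roots_charpoly_of_splits (IsAlgClosed.splits _)]
    have h2 := congrArg (LinearMap.det (M := S) (A := ℂ)) hR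
    rw [map_list_prod, map_one, List.map_ofFn, List.prod_ofFn] at h2
    exact h2

theorem IsSimpleTuple.isIrreducibleTuple {C : Fin (p + 1) → Mat l} (hl : 0 < l)
    (h : IsSimpleTuple fun j => Matrix.toLin' (C j)) : IsIrreducibleTuple C :=
  ⟨hl, fun W hW => h.2 W fun j v hv => by
    rw [Submodule.mem_comap, Matrix.toLin'_apply]
    exact hW j v hv⟩

theorem rigidityIndex_eq_diagIndex {B C : Fin (p + 1) → Mat l}
    (hch : ∀ j, (C j).charpoly = (B j).charpoly)
    (hd : ∀ j, HasEigenbasis (Matrix.toLin' (C j))) :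
    rigidityIndex C = diagIndex l fun j => mults (eigList (B j)) := by
  have h1 : ∀ j, (classDim (C j) : ℤ) = l ^ 2 - sqSum (mults (eigList (B j))) := fun j => by
    have h2 := classDim_add_finrank_ker (C j)
    rw [finrank_ker_commMap_self_of_hasEigenbasis (hd j), Matrix.charpoly_toLin', hch] at h2
    rw [sqSum_mults_eigList, eq_sub_iff_add_eq, sq]
    exact_mod_cast h2
  rw [rigidityIndex, Finset.sum_congr rfl fun j _ => h1 j, Finset.sum_sub_distrib, diagIndex]
  simp only [Finset.sum_const, Finset.card_univ, Fintype.card_fin, nsmul_eq_mul]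
  push_cast
  ring

end Irreducible

/-! ### Passage to the block-triangular form and conclusion -/

section BlockTriangular

variable {p n l n₁ : ℕ}

/-- The columns of `P` are a basis adapted to the filtration; in it every tuple of diagonal blocks
is `C` itself, not merely conjugate to it. -/
theorem isBlockTriangularWithRigidBlocks_of_filtered {A : Fin (p + 1) → Mat n}
    {C : Fin (p + 1) → Mat l} (hn : n = n₁ * l) (hn₁ : 2 ≤ n₁)
    (h : Filtered (fun j => Matrix.toLin' (C j)) n₁ (Fin n → ℂ) fun j => Matrix.toLin' (A j))
    (hC : IsIrreducibleTuple C) (hκ : rigidityIndex C = 2) :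
    IsBlockTriangularWithRigidBlocks A := by
  obtain ⟨ι, _, _, b, hι, htri, hdiag⟩ := h.exists_basis (Pi.basisFun ℂ (Fin l))
  let f : ι ≃o Fin n₁ := (Fintype.orderIsoFinOfCardEq ι hι).symm
  have hcard : Fintype.card (Fin n) = Fintype.card ((_i : Fin n₁) × Fin l) := by
    simp [hn]
  let e : Fin n ≃ (_i : Fin n₁) × Fin l := Fintype.equivOfCardEq hcard
  let g : ι × Fin l ≃ Fin n :=
    ((f.toEquiv.prodCongr (Equiv.refl _)).trans (Equiv.sigmaEquivProd _ _).symm).trans e.symm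
  let b' : Basis (Fin n) ℂ (Fin n → ℂ) := b.reindex g
  let P : (Mat n)ˣ := ⟨(Pi.basisFun ℂ (Fin n)).toMatrix b', b'.toMatrix (Pi.basisFun ℂ (Fin n)),
    Basis.toMatrix_mul_toMatrix_flip _ _, Basis.toMatrix_mul_toMatrix_flip _ _⟩
  have hg : ∀ i t, g.symm (e.symm ⟨i, t⟩) = (f.symm i, t) := fun i t => by
    rw [Equiv.symm_apply_eq]
    simp [g]
  have hentry : ∀ j x y, conjBlocks e P (A j) x y =
      b.repr (Matrix.toLin' (A j) (b (f.symm y.1, y.2))) (f.symm x.1, x.2) := by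
    rintro j ⟨i, s⟩ ⟨i', t⟩
    have h1 : (P⁻¹).val * A j * P.val = LinearMap.toMatrix b' b' (Matrix.toLin' (A j)) := by
      rw [← basis_toMatrix_mul_linearMap_toMatrix_mul_basis_toMatrix b' (Pi.basisFun ℂ (Fin n)) b'
        (Pi.basisFun ℂ (Fin n)), LinearMap.toMatrix_eq_toMatrix',
        LinearMap.toMatrix'_toLin']
      rfl
    rw [conjBlocks, h1, Matrix.reindex_apply, Matrix.submatrix_apply, LinearMap.toMatrix_apply]
    simp only [b', Basis.repr_reindex_apply, Basis.reindex_apply, hg]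
  have hblock : ∀ i : Fin n₁,
      (fun j => (conjBlocks (m := fun _ : Fin n₁ => l) e P (A j)).blockDiag' i) = C := fun i => by
    funext j
    ext s t
    rw [Matrix.blockDiag'_apply, hentry, hdiag]
    simp
  refine ⟨n₁, fun _ => l, e, P, hn₁, fun j x y hxy => ?_, fun i => ?_⟩
  · rw [hentry]
    exact htri j _ _ (f.symm.lt_iff_lt.2 hxy)
  · exact ⟨(hblock i).symm ▸ hC, (hblock i).symm ▸ hκ⟩

end BlockTriangular

theorem IsSpecialDiagonalWith.isBlockTriangularWithRigidBlocks {p n l n₁ : ℕ} {mul : Bool}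
    {A : Fin (p + 1) → Mat n} {B : Fin (p + 1) → Mat l} (h : IsSpecialDiagonalWith A l n₁ B)
    (hw : WeightCond mul (fun j => eigList (B j)) (if mul then 1 else 0) l)
    (hgen : ∀ Φ, IsSelection B Φ →
      if mul then ∏ j, (Φ j).prod ≠ 1 else ∑ j, (Φ j).sum ≠ 0)
    (hA : total mul A = if mul then 1 else 0) (hc : HasTrivialCentralizer A) :
    IsBlockTriangularWithRigidBlocks A := by
  have hκ := h.diagIndex_eq_two
  obtain ⟨C, hC, harm⟩ :=
    exists_hasArm_of_isGood h.diagonalizable h.good (by rw [hκ]; norm_num) hw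
  have hch : ∀ j, (C j).charpoly = (B j).charpoly := fun j => by
    rw [(harm j).charpoly_eq, prod_pow_eigList]
  have hd : ∀ j, HasEigenbasis (Matrix.toLin' (C j)) := fun j =>
    (harm j).hasEigenbasis (nodup_eigList (B j))
  have hCb : Balanced mul fun j => Matrix.toLin' (C j) := by
    refine balanced_toLin' (hC.trans ?_)
    cases mul <;> simp
  have hsimple := isSimpleTuple_of_generic h.one_le hch hCb hgen
  refine isBlockTriangularWithRigidBlocks_of_filtered h.size_eq h.one_lt ?_
    (hsimple.isIrreducibleTuple h.one_le) ((rigidityIndex_eq_diagIndex hch hd).trans hκ)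
  refine Rigid.filtered hsimple hCb hd n n₁ (by simp) (by simp [h.size_eq])
    (balanced_toLin' hA) (rigid_toLin' hA hc h.rigid) fun j => ?_
  rw [Matrix.charpoly_toLin', Matrix.charpoly_toLin', hch, h.charpoly_eq]

/-- The trace of `A j` is `n₁` times that of `B j`, and `n₁ ≠ 0`. -/
theorem IsSpecialDiagonalWith.sum_trace_eq_zero {p n l n₁ : ℕ} {A : Fin (p + 1) → Mat n}
    {B : Fin (p + 1) → Mat l} (h : IsSpecialDiagonalWith A l n₁ B) (hA : ∑ j, A j = 0) :
    ∑ j, (B j).trace = 0 := by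
  have h1 : ∀ j, (A j).trace = n₁ * (B j).trace := fun j => by
    rw [trace_eq_sum_eigs, trace_eq_sum_eigs, eigs, h.charpoly_eq, Polynomial.roots_pow,
      Multiset.sum_nsmul, nsmul_eq_mul, eigs]
  have h2 := congrArg Matrix.trace hA
  rw [Matrix.trace_sum, Matrix.trace_zero, Finset.sum_congr rfl fun j _ => h1 j,
    ← Finset.mul_sum] at h2
  exact (mul_eq_zero.1 h2).resolve_left (Nat.cast_ne_zero.2 (by have := h.one_lt; omega))

end DeligneSimpson

theorem corollary1p20 (p n : ℕ) (A : Fin (p + 1) → DeligneSimpson.Mat n) :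
    (DeligneSimpson.IsQuasiGenericSpecialDiagonalAdd A →
      DeligneSimpson.SolvesWeakDSPAdd A →
      DeligneSimpson.IsBlockTriangularWithRigidBlocks A) ∧
    (DeligneSimpson.IsQuasiGenericSpecialDiagonalMul A →
      DeligneSimpson.SolvesWeakDSPMul A →
      DeligneSimpson.IsBlockTriangularWithRigidBlocks A) := by
  constructor
  · rintro ⟨l, n₁, B, h, hgen, -⟩ ⟨hA, hc⟩
    refine h.isBlockTriangularWithRigidBlocks (mul := false) ?_ (fun Φ hΦ hsum => hgen Φ ⟨hΦ, hsum⟩)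
      hA hc
    simp only [DeligneSimpson.WeightCond, Bool.false_eq_true, if_false,
      DeligneSimpson.sum_mul_eigList, mul_zero]
    exact h.sum_trace_eq_zero hA
  · rintro ⟨l, n₁, B, h, hdet, hgen, -⟩ ⟨hA, hc⟩
    refine h.isBlockTriangularWithRigidBlocks (mul := true) ?_
      (fun Φ hΦ hprod => hgen Φ ⟨hΦ, hprod⟩)
      hA hc
    simp only [DeligneSimpson.WeightCond, if_true, DeligneSimpson.prod_value_pow_eigList, one_pow]
    refine ⟨one_ne_zero, fun j y hy => DeligneSimpson.ne_zero_of_mem_eigList ?_ hy, hdet⟩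
    intro h0
    have : ∏ j, (B j).det = 0 := Finset.prod_eq_zero (Finset.mem_univ j) h0
    rw [this] at hdet
    exact zero_ne_one hdet
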